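/- For a finite set $S\subset\mathbb{R}^2$, a dominating set of $S$ is a subset $S'\subseteq S$ such that the closed unit disks centred at the points of $S'$ cover $S$; the geometric minimum dominating set (MDS) problem asks for one of minimum cardinality, and $OPT$ denotes such a set. A cell is a closed regular hexagon of side length $\frac12$ with two vertical sides. Tile the plane by cells, and group the cells into super-cells $\mathcal D_{i,j}$ ($i,j\in\mathbb Z$): each super-cell consists of 15 cells, five consecutive ones in each of three consecutive rows, the middle row being shifted to the right by half the width of a cell, and $\mathcal D_{i,j}=\mathcal D_{0,0}+i\left(\frac{5\sqrt3}{2},0\right)+j\left(\frac{15\sqrt3}{4},\frac94\right)$. The super-cell $\mathcal D_{i,j}$ gets the colour $i \bmod 3$. Then the following hold. (1) For every position of the partition (i.e. after any translation), the super-cells cover the plane and have pairwise disjoint interiors. Any two points in the interiors of two distinct super-cells of the same colour are at distance greater than $2$. In every super-cell, any point of the left region (the first cell of each row) and any point of the right region (the last cell of each row) are at distance greater than $2$, so that no unit disk meets both regions. (2) (The 3-colouring scheme.) For every finite set $S\subset\mathbb R^2$ the partition can be translated so that no point of $S$ lies on the boundary of a super-cell. For every such position, if for each super-cell $\mathcal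 D$ a minimum cardinality set $N_{\mathcal D}$ of points of $S$ is chosen, each of whose unit disks contains a point of $S\cap\mathcal D$ and whose unit disks together cover $S\cap\mathcal D$, then $\bigcup_{\mathcal D}N_{\mathcal D}$ is a dominating set of $S$ with at most $3\,|OPT|$ points. (3) There is a 3-factor approximation algorithm for the geometric MDS problem with running time $O(n^{11}\log n)$: one program for a real random access machine (unit-cost exact real arithmetic $+,-,\times,/,\sqrt{\ }$ and comparisons, addition, subtraction and comparison of natural numbers, indirect addressing, no rounding) which, for every $n$ and every set $S$ of $n$ points in $\mathbb R^2$ given by their coordinates, halts with a dominating set of $S$ of size at most $3\,|OPT|$, the worst-case number of steps over all inputs of $n$ points being $O(n^{11}\log n)$. -/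

import Mathlib

open Set Filter Asymptotics

namespace GeomMDS

/-- The Euclidean plane. -/
abbrev Pt : Type := EuclideanSpace ℝ (Fin 2)

/-! ### Covering by unit disks and dominating sets -/

/-- The closed unit disks centred at the points of `C` cover `A`. -/
def Covers (C A : Set Pt) : Prop := ∀ a ∈ A, ∃ c ∈ C, dist a c ≤ 1

/-- `D` is a dominating set of `S`: a subset of `S` whose unit disks cover `S`. -/
def IsDominating (S D : Set Pt) : Prop := D ⊆ S ∧ Covers D S

/-- `D` is a dominating set of `S` of minimum cardinality. -/
def IsMinDominating (S D : Set Pt) : Prop :=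
  IsDominating S D ∧ ∀ E, IsDominating S E → D.encard ≤ E.encard

/-- `D` is a feasible solution of the minimum dominating set problem for `S`, of size at most
`ρ` times the optimum. -/
def IsApproxMDS (ρ : ℕ) (S D : Set Pt) : Prop :=
  IsDominating S D ∧ ∀ O, IsMinDominating S O → D.encard ≤ (ρ : ℕ∞) * O.encard

/-- The points of `V` whose unit disk covers at least one point of `U`. -/
def chi (U V : Set Pt) : Set Pt := {c | c ∈ V ∧ ∃ u ∈ U, dist u c ≤ 1}

/-- `N` is an optimal solution of the single-region problem for the region `D`: a minimum
cardinality subset of `chi (S ∩ D) S` whose unit disks cover `S ∩ D`. -/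
def IsOptimalFor (S D N : Set Pt) : Prop :=
  (N ⊆ chi (S ∩ D) S ∧ Covers N (S ∩ D)) ∧
    ∀ M, M ⊆ chi (S ∩ D) S → Covers M (S ∩ D) → N.encard ≤ M.encard

/-! ### The super-cell partition -/

/-- The closed regular hexagon of side length `1/2` with centre `c` and two vertical sides:
its vertices are `c + (0, ±1/2)` and `c + (±√3/4, ±1/4)`. -/
def hexCell (c : Pt) : Set Pt :=
  {p | |p 0 - c 0| ≤ √3 / 4 ∧ |p 0 - c 0| / √3 + |p 1 - c 1| ≤ 1 / 2}

/-- The centre of the cell in row `r` (from bottom to top) and place `k` (from left to right) of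
the super-cell `d = (i, j)`; the middle row is shifted to the right by half the width `√3/2` of a
cell. The whole partition is translated by `v`. -/
noncomputable def cellCentre (v : Pt) (d : ℤ × ℤ) (r : Fin 3) (k : Fin 5) : Pt :=
  !₂[v 0 + √3 / 4 *
        (10 * (d.1 : ℝ) + 15 * (d.2 : ℝ) + (if r = 1 then 1 else 0) + 2 * ((k : ℕ) : ℝ)),
     v 1 + 3 / 4 * (3 * (d.2 : ℝ) + ((r : ℕ) : ℝ))]

/-- The super-cell `d`: 15 hexagonal cells, in three consecutive rows of five. -/
def superCell (v : Pt) (d : ℤ × ℤ) : Set Pt :=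
  ⋃ (r : Fin 3) (k : Fin 5), hexCell (cellCentre v d r k)

/-- The left region of a super-cell: the first cell of each row. -/
def leftRegion (v : Pt) (d : ℤ × ℤ) : Set Pt :=
  ⋃ r : Fin 3, hexCell (cellCentre v d r 0)

/-- The right region of a super-cell: the last cell of each row. (The middle region consists of
the remaining nine cells.) -/
def rightRegion (v : Pt) (d : ℤ × ℤ) : Set Pt :=
  ⋃ r : Fin 3, hexCell (cellCentre v d r 4)

/-- The 3-colouring of the super-cells. The six neighbours of a super-cell carry the two other
colours alternately. -/
def colour (d : ℤ × ℤ) : ZMod 3 := (d.1 : ZMod 3)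

/-- No point of `S` lies on the boundary of a super-cell. -/
def OffBoundary (S : Set Pt) (v : Pt) : Prop :=
  ∀ d : ℤ × ℤ, Disjoint S (frontier (superCell v d))

/-! ### The real random access machine

Programs are structured programs over finitely many registers and two unbounded memories with
indirect addressing, one for natural numbers and one for real numbers. Every elementary
instruction and every evaluation of a test takes one unit of time. Real arithmetic is exact; there
is no rounding operation and no multiplication of natural numbers. Division by zero and the
square root of a negative number return zero. -/

/-- The state of the machine. -/
structure State where
  /-- registers holding natural numbers -/
  natReg : ℕ → ℕ
  /-- registers holding real numbers -/
  realReg : ℕ → ℝ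
  /-- memory holding natural numbers -/
  natMem : ℕ → ℕ
  /-- memory holding real numbers -/
  realMem : ℕ → ℝ

/-- Elementary instructions; `a`, `b`, `c` are names of registers. -/
inductive Instr : Type
  /-- `natReg a := m` -/
  | natConst (a m : ℕ)
  /-- `natReg a := natReg b + natReg c` -/
  | natAdd (a b c : ℕ)
  /-- `natReg a := natReg b - natReg c` (truncated at zero) -/
  | natSub (a b c : ℕ)
  /-- `natReg a := natMem (natReg b)` -/
  | natLoad (a b : ℕ)
  /-- `natMem (natReg a) := natReg b` -/
  | natStore (a b : ℕ)
  /-- `realReg a := q` -/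
  | realConst (a : ℕ) (q : ℚ)
  /-- `realReg a := realReg b + realReg c` -/
  | realAdd (a b c : ℕ)
  /-- `realReg a := realReg b - realReg c` -/
  | realSub (a b c : ℕ)
  /-- `realReg a := realReg b * realReg c` -/
  | realMul (a b c : ℕ)
  /-- `realReg a := realReg b / realReg c` -/
  | realDiv (a b c : ℕ)
  /-- `realReg a := √(realReg b)` -/
  | realSqrt (a b : ℕ)
  /-- `realReg a := realMem (natReg b)` -/
  | realLoad (a b : ℕ)
  /-- `realMem (natReg a) := realReg b` -/
  | realStore (a b : ℕ)

/-- The effect of an elementary instruction. -/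
noncomputable def Instr.apply (s : State) : Instr → State
  | .natConst a m => { s with natReg := Function.update s.natReg a m }
  | .natAdd a b c => { s with natReg := Function.update s.natReg a (s.natReg b + s.natReg c) }
  | .natSub a b c => { s with natReg := Function.update s.natReg a (s.natReg b - s.natReg c) }
  | .natLoad a b => { s with natReg := Function.update s.natReg a (s.natMem (s.natReg b)) }
  | .natStore a b => { s with natMem := Function.update s.natMem (s.natReg a) (s.natReg b) }
  | .realConst a q => { s with realReg := Function.update s.realReg a (q : ℝ) }
  | .realAdd a b c =>
      { s with realReg := Function.update s.realReg a (s.realReg b + s.realReg c) }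
  | .realSub a b c =>
      { s with realReg := Function.update s.realReg a (s.realReg b - s.realReg c) }
  | .realMul a b c =>
      { s with realReg := Function.update s.realReg a (s.realReg b * s.realReg c) }
  | .realDiv a b c =>
      { s with realReg := Function.update s.realReg a (s.realReg b / s.realReg c) }
  | .realSqrt a b => { s with realReg := Function.update s.realReg a (√(s.realReg b)) }
  | .realLoad a b => { s with realReg := Function.update s.realReg a (s.realMem (s.natReg b)) }
  | .realStore a b => { s with realMem := Function.update s.realMem (s.natReg a) (s.realReg b) }

/-- Tests comparing two registers. -/
inductive Test : Type
  /-- `natReg a = natReg b` -/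
  | natEq (a b : ℕ)
  /-- `natReg a < natReg b` -/
  | natLt (a b : ℕ)
  /-- `realReg a ≤ realReg b` -/
  | realLe (a b : ℕ)
  /-- `realReg a < realReg b` -/
  | realLt (a b : ℕ)

/-- The outcome of a test. -/
def Test.Holds (s : State) : Test → Prop
  | .natEq a b => s.natReg a = s.natReg b
  | .natLt a b => s.natReg a < s.natReg b
  | .realLe a b => s.realReg a ≤ s.realReg b
  | .realLt a b => s.realReg a < s.realReg b

/-- Programs. -/
inductive Program : Type
  | skip
  | instr (i : Instr)
  | seq (P Q : Program)
  | ifThenElse (b : Test) (P Q : Program)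
  | whileDo (b : Test) (P : Program)

/-- `Runs P s t s'`: the program `P`, started in the state `s`, halts after exactly `t` steps in
the state `s'`. -/
inductive Runs : Program → State → ℕ → State → Prop
  | skip (s : State) : Runs .skip s 1 s
  | instr (i : Instr) (s : State) : Runs (.instr i) s 1 (i.apply s)
  | seq {P Q : Program} {s s' s'' : State} {t t' : ℕ} :
      Runs P s t s' → Runs Q s' t' s'' → Runs (.seq P Q) s (t + t') s''
  | ifTrue {b : Test} {P Q : Program} {s s' : State} {t : ℕ} :
      b.Holds s → Runs P s t s' → Runs (.ifThenElse b P Q) s (1 + t) s'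
  | ifFalse {b : Test} {P Q : Program} {s s' : State} {t : ℕ} :
      ¬ b.Holds s → Runs Q s t s' → Runs (.ifThenElse b P Q) s (1 + t) s'
  | whileFalse {b : Test} {P : Program} {s : State} :
      ¬ b.Holds s → Runs (.whileDo b P) s 1 s
  | whileTrue {b : Test} {P : Program} {s s' s'' : State} {t t' : ℕ} :
      b.Holds s → Runs P s t s' → Runs (.whileDo b P) s' t' s'' →
        Runs (.whileDo b P) s (1 + t + t') s''

/-- The initial state on the input `p 0, …, p (n - 1)`: register `0` holds `n`, the real memory
holds the coordinates of the points one after the other, everything else is zero. -/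
noncomputable def initState {n : ℕ} (p : Fin n → Pt) : State where
  natReg := fun a => if a = 0 then n else 0
  realReg := fun _ => 0
  natMem := fun _ => 0
  realMem := fun m =>
    if h : m / 2 < n then p ⟨m / 2, h⟩ (if m % 2 = 0 then 0 else 1) else 0

/-- The output read off a final state: the set of the input points whose entry in the natural
number memory is nonzero. -/
def output {n : ℕ} (p : Fin n → Pt) (s : State) : Set Pt :=
  p '' {i : Fin n | s.natMem (i : ℕ) ≠ 0}

/-- `P` is a `ρ`-factor approximation algorithm for the minimum dominating set problem which, on
every set of `n` points, halts after at most `T n` steps. -/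
def IsApproxAlgorithm (ρ : ℕ) (P : Program) (T : ℕ → ℕ) : Prop :=
  ∀ (n : ℕ) (p : Fin n → Pt), Function.Injective p →
    ∃ (t : ℕ) (s : State), Runs P (initState p) t s ∧ t ≤ T n ∧
      IsApproxMDS ρ (Set.range p) (output p s)

end GeomMDS

open GeomMDS

/-! The geometric claims reduce to integer arithmetic. In units of half a cell width horizontally
and half a side vertically, the cell centres are the points (A, 3R) with A and R integers of equal
parity, and a cell is the unit ball of `hexNorm` about its centre. The tiling says that these unit
balls cover the plane (`iUnion_superCell`) while distinct centres are at norm at least 2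
(`two_le_hexNorm`). Sixteen times a squared distance is 3 dx² + dy² in these units, so distance
bounds follow from the integer offsets of the centres (`scaledDist_le_of_hexNorm_le_one`).

For the colouring scheme, `isApproxMDS_three_of_isOptimalFor`: the points of an optimum O whose
disks meet S in a given super-cell are feasible there, hence at least as many as the chosen optimal
set. For super-cells of one colour these parts of O are disjoint, since a unit disk has diameter 2.
So each colour class contributes at most |O| points, and there are three colours.

The algorithm does not use the super-cells. It cuts the points greedily into horizontal strips of
height 1 whose bases are at least 1 apart. A unit disk reaches points in at most three strips
(`Valid.card_bases_le`). Hence, if an item is a pair of a centre and a strip, and it counts only for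
the points of its strip, there is a cover by at most 3|O| items (`Valid.exists_stripCover`). It is
enough to find a cover with no more centres than a minimum strip cover has items.

The strips are strung along one line by the key X + 2Z·base, where Z exceeds all coordinates in
absolute value by at least 10. In a minimum strip cover at most ten items have keys in an interval
of length 2 (`Valid.card_window_le`), because everything they cover in their strip lies in a 4 × 1
rectangle, which splits into ten rectangles of diameter below 1, and one point from each suffices.
So a dynamic program that scans the sorted items needs to remember only the last ten chosen. Its
states are numbers with ten digits in base B = 3n + 1; the oldest item is the leading digit, and
states are treated in increasing order. Soundness (`Table.trace_covers_of_fin`): any path of back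
pointers from an accepted state is a cover. Completeness (`Chain.score`): the sorted minimum strip
cover is a path of the program.

For each of the B¹⁰ states the check on all predecessors is a single threshold comparison
(`windowProg_spec`), so a state costs O(B) steps and the whole program O(n¹¹), which is within the
claimed bound. The rest implements this on the machine, with a Hoare calculus that bounds running
times and infers from the program text what is left unchanged. -/

namespace GeomMDS

/-! ### Scaled coordinates -/

theorem Pt.dist_sq (p q : Pt) : dist p q ^ 2 = (p 0 - q 0) ^ 2 + (p 1 - q 1) ^ 2 := by
  rw [EuclideanSpace.dist_eq, Real.sq_sqrt (by positivity), Fin.sum_univ_two, Real.dist_eq,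
    Real.dist_eq, sq_abs, sq_abs]

theorem Pt.dist_le_one_iff (p q : Pt) :
    dist p q ≤ 1 ↔ (p 0 - q 0) ^ 2 + (p 1 - q 1) ^ 2 ≤ 1 := by
  rw [← Pt.dist_sq, sq_le_one_iff₀ dist_nonneg]

/-- The abscissa relative to `v`, in units of half the width of a cell. -/
noncomputable def scaledX (v p : Pt) : ℝ := (p 0 - v 0) * (4 / √3)

/-- The ordinate relative to `v`, in units of half the side of a cell. -/
noncomputable def scaledY (v p : Pt) : ℝ := 4 * (p 1 - v 1)

theorem dist_sq_scaled (v p q : Pt) : 16 * dist p q ^ 2 =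
    3 * (scaledX v p - scaledX v q) ^ 2 + (scaledY v p - scaledY v q) ^ 2 := by
  have h3 : √3 ^ 2 = 3 := Real.sq_sqrt (by norm_num)
  have h : √3 ≠ 0 := by positivity
  rw [Pt.dist_sq, scaledX, scaledX, scaledY, scaledY]
  field_simp
  rw [h3]
  ring

/-- Position of a cell in its row, in units of half the width of a cell. -/
def cellPos (d : ℤ × ℤ) (r : Fin 3) (k : Fin 5) : ℤ :=
  10 * d.1 + 15 * d.2 + (if r = 1 then 1 else 0) + 2 * (k : ℕ)

/-- The row of a cell. -/
def cellRow (d : ℤ × ℤ) (r : Fin 3) : ℤ := 3 * d.2 + (r : ℕ)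

/-- The norm whose unit ball is the cell, in scaled coordinates. -/
noncomputable def hexNorm (a b : ℝ) : ℝ := max |a| ((|a| + |b|) / 2)

theorem hexNorm_add_le (a b c d : ℝ) : hexNorm (a + c) (b + d) ≤ hexNorm a b + hexNorm c d := by
  unfold hexNorm
  have h1 := abs_add_le a c
  have h2 := abs_add_le b d
  have h3 := le_max_left |a| ((|a| + |b|) / 2)
  have h4 := le_max_right |a| ((|a| + |b|) / 2)
  have h5 := le_max_left |c| ((|c| + |d|) / 2)
  have h6 := le_max_right |c| ((|c| + |d|) / 2)
  exact max_le (by linarith) (by linarith)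

theorem hexNorm_neg (a b : ℝ) : hexNorm (-a) (-b) = hexNorm a b := by
  simp [hexNorm]

theorem hexNorm_le_one_iff {a b : ℝ} : hexNorm a b ≤ 1 ↔ |a| ≤ 1 ∧ |a| + |b| ≤ 2 := by
  rw [hexNorm, max_le_iff, div_le_iff₀ (by norm_num : (0:ℝ) < 2), one_mul]

/-- This turns cells into unit balls of a norm about integral centres, after which √3 no longer
occurs in the tiling argument. -/
theorem mem_hexCell_iff (v : Pt) (d : ℤ × ℤ) (r : Fin 3) (k : Fin 5) (p : Pt) :
    p ∈ hexCell (cellCentre v d r k) ↔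
      hexNorm (scaledX v p - cellPos d r k) (scaledY v p - 3 * cellRow d r) ≤ 1 := by
  have h : (0:ℝ) < √3 := by positivity
  have h0 : p 0 - cellCentre v d r k 0 = √3 / 4 * (scaledX v p - cellPos d r k) := by
    simp only [cellCentre, scaledX, cellPos, Matrix.cons_val_zero]
    push_cast
    field_simp
    ring
  have h1 : p 1 - cellCentre v d r k 1 = (scaledY v p - 3 * cellRow d r) / 4 := by
    simp only [cellCentre, scaledY, cellRow, Matrix.cons_val_one]
    push_cast
    ring
  rw [hexNorm_le_one_iff]
  simp only [hexCell, mem_ofPred_eq, h0, h1]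
  rw [abs_mul, abs_of_pos (by positivity : 0 < √3 / 4), abs_div,
    abs_of_pos (by norm_num : (0:ℝ) < 4)]
  have e : √3 / 4 * |scaledX v p - cellPos d r k| / √3 = |scaledX v p - cellPos d r k| / 4 := by
    field_simp
  rw [e]
  constructor
  · rintro ⟨a, b⟩
    exact ⟨by nlinarith, by linarith⟩
  · rintro ⟨a, b⟩
    exact ⟨by nlinarith, by linarith⟩

theorem mem_superCell_iff (v : Pt) (d : ℤ × ℤ) (p : Pt) :
    p ∈ superCell v d ↔ ∃ r k,
      hexNorm (scaledX v p - cellPos d r k) (scaledY v p - 3 * cellRow d r) ≤ 1 := by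
  simp only [superCell, mem_iUnion, mem_hexCell_iff]

/-! ### The cells form a tiling -/

/-- Division with remainder by 3 for the row, then by 10 for the place in the row; the parity makes
the remainder, after the shift of the middle row, an even number 2k below 10. -/
theorem exists_cell (A R : ℤ) (h : (A - R) % 2 = 0) :
    ∃ (d : ℤ × ℤ) (r : Fin 3) (k : Fin 5), cellPos d r k = A ∧ cellRow d r = R := by
  obtain ⟨j, r, hr, rfl⟩ : ∃ (j : ℤ) (r : Fin 3), R % 3 = (r : ℕ) ∧ R = 3 * j + (r : ℕ) := by
    refine ⟨R / 3, ⟨(R % 3).toNat, by omega⟩, ?_, ?_⟩ <;> simp <;> omega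
  let e : ℤ := if r = 1 then 1 else 0
  have he : (A - 15 * j - e) % 2 = 0 := by
    fin_cases r <;> simp [e] at h ⊢ <;> omega
  refine ⟨((A - 15 * j - e) / 10, j), r, ⟨((A - 15 * j - e) % 10 / 2).toNat, by omega⟩, ?_, rfl⟩
  simp only [cellPos]
  change _ + e + _ = _
  rw [Int.toNat_of_nonneg (by omega)]
  omega

theorem cellPos_parity (d : ℤ × ℤ) (r : Fin 3) (k : Fin 5) :
    (cellPos d r k - cellRow d r) % 2 = 0 := by
  unfold cellPos cellRow
  fin_cases r <;> simp <;> omega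

theorem cell_injective {d e : ℤ × ℤ} {r s : Fin 3} {k l : Fin 5}
    (h1 : cellPos d r k = cellPos e s l) (h2 : cellRow d r = cellRow e s) : d = e := by
  obtain ⟨i, j⟩ := d
  obtain ⟨i', j'⟩ := e
  unfold cellPos at h1
  unfold cellRow at h2
  have hk := k.2
  have hl := l.2
  fin_cases r <;> fin_cases s <;> simp at h1 h2 <;> ext <;> simp <;> omega

theorem iUnion_superCell (v : Pt) : (⋃ d : ℤ × ℤ, superCell v d) = Set.univ := by
  refine eq_univ_of_forall fun p => ?_
  simp only [mem_iUnion, mem_superCell_iff]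
  suffices h : ∃ A R : ℤ, (A - R) % 2 = 0 ∧
      hexNorm (scaledX v p - A) (scaledY v p - 3 * R) ≤ 1 by
    obtain ⟨A, R, h1, h2⟩ := h
    obtain ⟨d, r, k, rfl, rfl⟩ := exists_cell A R h1
    exact ⟨d, r, k, h2⟩
  generalize scaledX v p = x
  generalize scaledY v p = y
  simp only [hexNorm_le_one_iff]
  -- The candidate is the centre nearest to the point in the row R just below it; its horizontal
  -- offset `a` is at most 1 in absolute value.
  set R := ⌊y / 3⌋ with hR
  have hy1 : 3 * (R : ℝ) ≤ y := by have := Int.floor_le (y / 3); linarith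
  have hy2 : y < 3 * (R : ℝ) + 3 := by have := Int.lt_floor_add_one (y / 3); linarith
  set m := round ((x - R) / 2) with hm
  have hx := abs_le.mp (abs_sub_round ((x - R) / 2))
  obtain ⟨a, ha⟩ : ∃ a : ℝ, x - ((R + 2 * m : ℤ) : ℝ) = a := ⟨_, rfl⟩
  have ha1 : |a| ≤ 1 := by
    rw [← ha]; push_cast
    rw [abs_le]; constructor <;> linarith [hx.1, hx.2]
  by_cases hc : |a| + (y - 3 * R) ≤ 2
  · refine ⟨R + 2 * m, R, by omega, by rw [ha]; exact ha1, ?_⟩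
    rw [ha, abs_of_nonneg (by linarith : 0 ≤ y - 3 * (R : ℝ))]
    exact hc
  · push Not at hc
    have hy3 : |y - 3 * ((R + 1 : ℤ) : ℝ)| = 3 - (y - 3 * R) := by
      push_cast
      rw [abs_of_nonpos (by linarith)]; ring
    -- The point is above the slanted upper sides of the candidate cell, so it belongs to the cell
    -- of the next row on the side given by the sign of `a`.
    rcases le_total 0 a with h0 | h0
    · refine ⟨R + 2 * m + 1, R + 1, by omega, ?_⟩
      have : x - ((R + 2 * m + 1 : ℤ) : ℝ) = a - 1 := by
        rw [← ha]; push_cast; ring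
      rw [this, hy3]
      rw [abs_of_nonneg h0] at *
      rw [abs_of_nonpos (by linarith)]
      constructor <;> linarith
    · refine ⟨R + 2 * m - 1, R + 1, by omega, ?_⟩
      have : x - ((R + 2 * m - 1 : ℤ) : ℝ) = a + 1 := by
        rw [← ha]; push_cast; ring
      rw [this, hy3]
      rw [abs_of_nonpos h0] at *
      rw [abs_of_nonneg (by linarith)]
      constructor <;> linarith

/-- If b = 0 then a is even and nonzero; if |b| = 1 then a is odd, so |a| + 3|b| ≥ 4; for larger |b|
there is room to spare. -/
theorem two_le_hexNorm {a b : ℤ} (h : (a - b) % 2 = 0) (h0 : ¬ (a = 0 ∧ b = 0)) :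
    2 ≤ hexNorm (a : ℝ) (3 * (b : ℝ)) := by
  unfold hexNorm
  have e1 : |(a : ℝ)| = ((|a| : ℤ) : ℝ) := by simp
  have e2 : |3 * (b : ℝ)| = ((3 * |b| : ℤ) : ℝ) := by simp [abs_mul]
  rw [e1, e2]
  have : 2 ≤ |a| ∨ 4 ≤ |a| + 3 * |b| := by
    rcases abs_cases a with ⟨ha, _⟩ | ⟨ha, _⟩ <;> rcases abs_cases b with ⟨hb, _⟩ | ⟨hb, _⟩ <;>
      omega
  rcases this with h | h
  · exact le_max_of_le_left (by exact_mod_cast h)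
  · refine le_max_of_le_right ?_
    rw [le_div_iff₀ (by norm_num)]
    norm_num
    exact_mod_cast h

theorem continuous_moveTo (z c : Pt) : Continuous fun ε : ℝ => z + ε • (c - z) := by
  fun_prop

theorem exists_move_mem {O : Set Pt} (hO : IsOpen O) {z : Pt} (hz : z ∈ O) (c : Pt) :
    ∃ ε : ℝ, 0 < ε ∧ ε < 1 ∧ z + ε • (c - z) ∈ O := by
  have h : ∀ᶠ ε in nhds (0 : ℝ), z + ε • (c - z) ∈ O := by
    refine (continuous_moveTo z c).continuousAt.eventually ?_
    simpa using hO.mem_nhds hz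
  obtain ⟨δ, hδ, hb⟩ := Metric.eventually_nhds_iff.mp h
  refine ⟨min (δ / 2) (1 / 2), by positivity, (min_le_right _ _).trans_lt (by norm_num), hb ?_⟩
  rw [Real.dist_eq, sub_zero, abs_of_pos (by positivity)]
  exact (min_le_left _ _).trans_lt (by linarith)

/-- A common interior point, pushed slightly towards the centre of a cell of `d` containing it, has
norm below 1 from that centre and at most 1 from the centre of some cell of `e`. By the triangle
inequality the two centres would be at norm below 2. -/
theorem disjoint_interior_superCell (v : Pt) {d e : ℤ × ℤ} (hde : d ≠ e) :
    Disjoint (interior (superCell v d)) (interior (superCell v e)) := by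
  rw [Set.disjoint_left]
  intro z hzd hze
  obtain ⟨r, k, hz⟩ := (mem_superCell_iff v d z).mp (interior_subset hzd)
  obtain ⟨ε, h0, h1, hz'⟩ :=
    exists_move_mem isOpen_interior hze (cellCentre v d r k)
  obtain ⟨s, l, he⟩ := (mem_superCell_iff v e _).mp (interior_subset hz')
  have hs3 : (0:ℝ) < √3 := by positivity
  have hX : scaledX v (z + ε • (cellCentre v d r k - z)) - cellPos d r k
      = (1 - ε) * (scaledX v z - cellPos d r k) := by
    simp only [scaledX, cellPos, cellCentre, PiLp.add_apply, PiLp.smul_apply, PiLp.sub_apply,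
      Matrix.cons_val_zero, smul_eq_mul]
    push_cast
    field_simp
    ring
  have hY : scaledY v (z + ε • (cellCentre v d r k - z)) - 3 * cellRow d r
      = (1 - ε) * (scaledY v z - 3 * cellRow d r) := by
    simp only [scaledY, cellRow, cellCentre, PiLp.add_apply, PiLp.smul_apply, PiLp.sub_apply,
      Matrix.cons_val_one, smul_eq_mul]
    push_cast
    ring
  set x' := scaledX v (z + ε • (cellCentre v d r k - z))
  set y' := scaledY v (z + ε • (cellCentre v d r k - z))
  have hlt : hexNorm (x' - cellPos d r k) (y' - 3 * cellRow d r) < 1 := by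
    have hh := hexNorm_le_one_iff.mp hz
    rw [hX, hY, hexNorm, abs_mul, abs_mul, abs_of_pos (by linarith : 0 < 1 - ε)]
    exact max_lt (by nlinarith [hh.1]) (by nlinarith [hh.2])
  have h2 := two_le_hexNorm (a := cellPos d r k - cellPos e s l)
    (b := cellRow d r - cellRow e s)
    (by have := cellPos_parity d r k; have := cellPos_parity e s l; omega)
    (fun h => hde (cell_injective (sub_eq_zero.mp h.1) (sub_eq_zero.mp h.2)))
  have h3 := hexNorm_add_le (x' - cellPos e s l) (y' - 3 * cellRow e s)
    (-(x' - cellPos d r k)) (-(y' - 3 * cellRow d r))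
  rw [hexNorm_neg] at h3
  have e1 : x' - cellPos e s l + -(x' - cellPos d r k)
    = ((cellPos d r k - cellPos e s l : ℤ) : ℝ) := by push_cast; ring
  have e2 : y' - 3 * cellRow e s + -(y' - 3 * cellRow d r)
    = 3 * ((cellRow d r - cellRow e s : ℤ) : ℝ) := by push_cast; ring
  rw [e1, e2] at h3
  linarith

/-! ### Distances between regions -/

/-- Two points of cells deviate from the offset (a, b) of the centres by (s, w) with |s| ≤ 2 and |s|
+ |w| ≤ 4. The value 64 = 16 · 2² means distance 2, and 75 = 3 · 5² leaves strict room. -/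
theorem scaledDist_le_of_hexNorm_le_one {x y x' y' a b : ℝ} (h : hexNorm x y ≤ 1) (h' : hexNorm x' y' ≤ 1) :
    (7 ≤ |a| → 75 ≤ 3 * ((x + a) - x') ^ 2 + ((y + b) - y') ^ 2) ∧
    (12 ≤ |b| → 64 ≤ 3 * ((x + a) - x') ^ 2 + ((y + b) - y') ^ 2) ∧
    (6 ≤ |a| → 6 ≤ |b| → 64 ≤ 3 * ((x + a) - x') ^ 2 + ((y + b) - y') ^ 2) := by
  rw [hexNorm_le_one_iff] at h h'
  have hs : |x - x'| ≤ 2 := by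
    have := abs_sub x x'; linarith [h.1, h'.1]
  have hw : |x - x'| + |y - y'| ≤ 4 := by
    have := abs_sub x x'; have := abs_sub y y'; linarith [h.2, h'.2]
  have hw2 : |y - y'| ≤ 4 := by have := abs_nonneg (x - x'); linarith
  have eX : |a| - |x - x'| ≤ |(x + a) - x'| := by
    have h := abs_sub_abs_le_abs_sub a (-(x - x'))
    rwa [abs_neg, show a - -(x - x') = x + a - x' by ring] at h
  have eY : |b| - |y - y'| ≤ |(y + b) - y'| := by
    have h := abs_sub_abs_le_abs_sub b (-(y - y'))
    rwa [abs_neg, show b - -(y - y') = y + b - y' by ring] at h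
  rw [← sq_abs ((x + a) - x'), ← sq_abs ((y + b) - y')]
  refine ⟨fun ha => ?_, fun hb => ?_, fun ha hb => ?_⟩
  · nlinarith [sq_nonneg |y + b - y'|]
  · nlinarith [sq_nonneg |x + a - x'|]
  -- The deviation costs at most 3 · 2 + 2 = 8 out of 18 + 6. Cauchy–Schwarz in the form (3p + q)² ≤
  -- 4(3p² + q²) then gives 64.
  · have : 16 ≤ 3 * |x + a - x'| + |y + b - y'| := by linarith
    nlinarith [sq_nonneg (|x + a - x'| - |y + b - y'|)]

theorem sixtyFour_le_of_cells {v p q : Pt} {d e : ℤ × ℤ} {r s : Fin 3} {k l : Fin 5}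
    (hp : p ∈ hexCell (cellCentre v d r k)) (hq : q ∈ hexCell (cellCentre v e s l)) :
    (7 ≤ |cellPos d r k - cellPos e s l| → 75 ≤ 16 * dist p q ^ 2) ∧
    (4 ≤ |cellRow d r - cellRow e s| → 64 ≤ 16 * dist p q ^ 2) ∧
    (6 ≤ |cellPos d r k - cellPos e s l| → 2 ≤ |cellRow d r - cellRow e s| →
      64 ≤ 16 * dist p q ^ 2) := by
  rw [mem_hexCell_iff] at hp hq
  have h := scaledDist_le_of_hexNorm_le_one (a := ((cellPos d r k - cellPos e s l : ℤ) : ℝ))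
    (b := 3 * ((cellRow d r - cellRow e s : ℤ) : ℝ)) hp hq
  rw [dist_sq_scaled v]
  have e1 : scaledX v p - cellPos d r k + ((cellPos d r k - cellPos e s l : ℤ) : ℝ) -
      (scaledX v q - cellPos e s l) = scaledX v p - scaledX v q := by push_cast; ring
  have e2 : scaledY v p - 3 * cellRow d r + 3 * ((cellRow d r - cellRow e s : ℤ) : ℝ) -
      (scaledY v q - 3 * cellRow e s) = scaledY v p - scaledY v q := by push_cast; ring
  rw [e1, e2, abs_mul, ← Int.cast_abs, ← Int.cast_abs, abs_of_pos (by norm_num : (0:ℝ) < 3)] at h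
  obtain ⟨h1, h2, h3⟩ := h
  refine ⟨fun ha => h1 (by exact_mod_cast ha), fun hb => h2 ?_, fun ha hb => h3 ?_ ?_⟩
  · have : (4:ℝ) ≤ ((|cellRow d r - cellRow e s| : ℤ) : ℝ) := by exact_mod_cast hb
    linarith
  · exact_mod_cast ha
  · have : (2:ℝ) ≤ ((|cellRow d r - cellRow e s| : ℤ) : ℝ) := by exact_mod_cast hb
    linarith

/-- First and last cells are 8 half-widths apart, up to 1 for the shifted row; the bound for an
offset of 7 applies. -/
theorem two_lt_dist_left_right (v : Pt) (d : ℤ × ℤ) {x y : Pt} (hx : x ∈ leftRegion v d)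
    (hy : y ∈ rightRegion v d) : 2 < dist x y := by
  simp only [leftRegion, rightRegion, mem_iUnion] at hx hy
  obtain ⟨r, hx⟩ := hx
  obtain ⟨s, hy⟩ := hy
  have h := (sixtyFour_le_of_cells hx hy).1 (by
    unfold cellPos
    rw [abs_sub_comm]
    refine le_trans ?_ (le_abs_self _)
    fin_cases r <;> fin_cases s <;> simp <;> omega)
  nlinarith [dist_nonneg (x := x) (y := y)]

theorem colour_eq_iff (d e : ℤ × ℤ) : colour d = colour e ↔ (d.1 - e.1) % 3 = 0 := by
  unfold colour
  rw [ZMod.intCast_eq_intCast_iff_dvd_sub]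
  omega

/-- With equal colour the first indices differ by a multiple of 3, and a finite check over rows
shows that any two cells fall under one of the three offset conditions. The inequality cannot be
strict here, as vertices of such closed super-cells can be at distance exactly 2. -/
theorem two_le_dist_of_colour_eq (v : Pt) {d e : ℤ × ℤ} (hde : d ≠ e)
    (hc : colour d = colour e) {x y : Pt} (hx : x ∈ superCell v d) (hy : y ∈ superCell v e) :
    2 ≤ dist x y := by
  rw [colour_eq_iff] at hc
  simp only [superCell, mem_iUnion] at hx hy
  obtain ⟨r, k, hx⟩ := hx
  obtain ⟨s, l, hy⟩ := hy
  obtain ⟨h1, h2, h3⟩ := sixtyFour_le_of_cells hx hy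
  have key : 7 ≤ |cellPos d r k - cellPos e s l| ∨ 4 ≤ |cellRow d r - cellRow e s| ∨
      (6 ≤ |cellPos d r k - cellPos e s l| ∧ 2 ≤ |cellRow d r - cellRow e s|) := by
    obtain ⟨i, j⟩ := d
    obtain ⟨i', j'⟩ := e
    have hij : i ≠ i' ∨ j ≠ j' := by
      by_contra! h; exact hde (by rw [h.1, h.2])
    simp only [cellPos, cellRow, le_abs] at hc ⊢
    have hk := k.2
    have hl := l.2
    fin_cases r <;> fin_cases s <;> simp <;> omega
  have hd := dist_nonneg (x := x) (y := y)
  have : 64 ≤ 16 * dist x y ^ 2 := by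
    rcases key with h | h | h
    · linarith [h1 h]
    · exact h2 h
    · exact h3 h.1 h.2
  nlinarith

/-- Strictness comes from interiority of `x` alone: at distance exactly 2, a small move of `x`
towards `y` would stay in the super-cell and violate the weak bound. -/
theorem two_lt_dist_of_colour_eq (v : Pt) {d e : ℤ × ℤ} (hde : d ≠ e)
    (hc : colour d = colour e) {x y : Pt} (hx : x ∈ interior (superCell v d))
    (hy : y ∈ superCell v e) : 2 < dist x y := by
  by_contra! h
  obtain ⟨ε, h0, h1, hz⟩ := exists_move_mem isOpen_interior hx y
  have h2 := two_le_dist_of_colour_eq v hde hc (interior_subset hz) hy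
  have h3 := two_le_dist_of_colour_eq v hde hc (interior_subset hx) hy
  have h4 : dist (x + ε • (y - x)) y = (1 - ε) * dist x y := by
    have : x + ε • (y - x) - y = (1 - ε) • (x - y) := by module
    rw [dist_eq_norm, this, norm_smul, Real.norm_of_nonneg (by linarith), dist_eq_norm]
  rw [h4] at h2
  nlinarith

end GeomMDS

namespace GeomMDS

/-! ### The 3-colouring scheme -/

theorem hexCell_eq_inter (c : Pt) : hexCell c =
    {p : Pt | |p 0 - c 0| ≤ √3 / 4} ∩ {p : Pt | |p 0 - c 0| / √3 + |p 1 - c 1| ≤ 1 / 2} := rfl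

theorem isClosed_hexCell (c : Pt) : IsClosed (hexCell c) := by
  rw [hexCell_eq_inter]
  exact (isClosed_le (by fun_prop) (by fun_prop)).inter (isClosed_le (by fun_prop) (by fun_prop))

/-- Needed because a convex set has a frontier of measure zero. -/
theorem convex_hexCell (c : Pt) : Convex ℝ (hexCell c) := by
  have h3 : (0:ℝ) < √3 := by positivity
  have key : ∀ (x y c a b : ℝ), 0 ≤ a → 0 ≤ b → a + b = 1 →
      |a * x + b * y - c| ≤ a * |x - c| + b * |y - c| := by
    intro x y c a b ha hb hab
    have : a * x + b * y - c = a * (x - c) + b * (y - c) := by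
      linear_combination c * hab
    rw [this]
    refine (abs_add_le _ _).trans ?_
    rw [abs_mul, abs_mul, abs_of_nonneg ha, abs_of_nonneg hb]
  intro p hp q hq a b ha hb hab
  obtain ⟨hp1, hp2⟩ := hp
  obtain ⟨hq1, hq2⟩ := hq
  have h0 := key (p 0) (q 0) (c 0) a b ha hb hab
  have h1 := key (p 1) (q 1) (c 1) a b ha hb hab
  refine ⟨?_, ?_⟩
  · simp only [PiLp.add_apply, PiLp.smul_apply, smul_eq_mul]
    nlinarith
  · simp only [PiLp.add_apply, PiLp.smul_apply, smul_eq_mul]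
    have h4 : |a * p 0 + b * q 0 - c 0| / √3 ≤ a * (|p 0 - c 0| / √3) + b * (|q 0 - c 0| / √3) := by
      rw [div_le_iff₀ h3]
      field_simp
      exact h0
    nlinarith

theorem isClosed_superCell (v : Pt) (d : ℤ × ℤ) : IsClosed (superCell v d) :=
  isClosed_iUnion_of_finite fun _ => isClosed_iUnion_of_finite fun _ => isClosed_hexCell _

theorem measure_frontier_iUnion_eq_zero {ι X : Type*} [Finite ι] [TopologicalSpace X]
    [MeasurableSpace X] (μ : MeasureTheory.Measure X) {A : ι → Set X} (hc : ∀ i, IsClosed (A i))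
    (h : ∀ i, μ (frontier (A i)) = 0) : μ (frontier (⋃ i, A i)) = 0 := by
  refine MeasureTheory.measure_mono_null ?_ (MeasureTheory.measure_iUnion_null h)
  intro x hx
  rw [(isClosed_iUnion_of_finite hc).frontier_eq] at hx
  obtain ⟨i, hi⟩ := mem_iUnion.mp hx.1
  refine mem_iUnion.mpr ⟨i, ?_⟩
  rw [(hc i).frontier_eq]
  exact ⟨hi, fun h' => hx.2 (interior_mono (subset_iUnion A i) h')⟩

theorem measure_frontier_superCell (v : Pt) (d : ℤ × ℤ) :
    MeasureTheory.volume (frontier (superCell v d)) = 0 :=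
  measure_frontier_iUnion_eq_zero _ (fun _ => isClosed_iUnion_of_finite fun _ => isClosed_hexCell _)
    fun _ => measure_frontier_iUnion_eq_zero _ (fun _ => isClosed_hexCell _)
      fun _ => (convex_hexCell _).addHaar_frontier _

theorem superCell_eq_preimage (v : Pt) (d : ℤ × ℤ) :
    superCell v d = Homeomorph.subRight v ⁻¹' superCell 0 d := by
  ext p
  simp only [mem_preimage, mem_superCell_iff, Homeomorph.coe_subRight, scaledX, scaledY,
    PiLp.sub_apply, PiLp.zero_apply, sub_zero]

/-- Almost every translation works: for one point and one super-cell the bad translations form a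
reflected translate of a null frontier, and there are only countably many such pairs. -/
theorem exists_offBoundary {S : Set Pt} (hS : S.Finite) : ∃ v : Pt, OffBoundary S v := by
  have h : ∀ᵐ v : Pt, ∀ s ∈ S, ∀ d : ℤ × ℤ, s ∉ frontier (superCell v d) := by
    refine (MeasureTheory.ae_ball_iff hS.countable).mpr fun s _ => ?_
    refine MeasureTheory.ae_all_iff.mpr fun d => ?_
    have h0 : ∀ᵐ w : Pt, w ∉ frontier (superCell 0 d) := by
      rw [MeasureTheory.ae_iff]
      simpa using measure_frontier_superCell 0 d
    have h1 := (MeasureTheory.Measure.measurePreserving_sub_left MeasureTheory.volume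
      s).quasiMeasurePreserving.ae h0
    filter_upwards [h1] with v hv
    rw [superCell_eq_preimage, ← Homeomorph.preimage_frontier]
    exact hv
  obtain ⟨v, hv⟩ := h.exists
  exact ⟨v, fun d => Set.disjoint_left.mpr fun s hs => hv s hs d⟩

theorem encard_biUnion_le_of_disjoint {ι α : Type*} [DecidableEq ι] {A N : ι → Set α} (F : Finset ι)
    (hA : ∀ d ∈ F, ∀ e ∈ F, d ≠ e → Disjoint (A d) (A e))
    (hN : ∀ d ∈ F, (N d).encard ≤ (A d).encard) :
    (⋃ d ∈ F, N d).encard ≤ (⋃ d ∈ F, A d).encard := by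
  induction F using Finset.induction_on with
  | empty => simp
  | insert a F ha ih =>
    have hdis : Disjoint (A a) (⋃ d ∈ F, A d) := by
      rw [disjoint_iUnion₂_right]
      exact fun d hd => hA a (by simp) d (by simp [hd]) (by rintro rfl; exact ha hd)
    rw [Finset.set_biUnion_insert, Finset.set_biUnion_insert, encard_union_eq hdis]
    refine (encard_union_le _ _).trans (add_le_add (hN a (by simp)) (ih ?_ ?_))
    · exact fun d hd e he => hA d (by simp [hd]) e (by simp [he])
    · exact fun d hd => hN d (by simp [hd])

theorem mem_interior_of_offBoundary {S : Set Pt} {v : Pt} (hv : OffBoundary S v) {s : Pt}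
    (hs : s ∈ S) {d : ℤ × ℤ} (h : s ∈ superCell v d) : s ∈ interior (superCell v d) := by
  by_contra hn
  refine Set.disjoint_left.mp (hv d) hs ?_
  rw [(isClosed_superCell v d).frontier_eq]
  exact ⟨h, hn⟩

theorem finite_occupied {S : Set Pt} (hS : S.Finite) {v : Pt} (hv : OffBoundary S v) :
    {d : ℤ × ℤ | (S ∩ superCell v d).Nonempty}.Finite := by
  have h : {d : ℤ × ℤ | (S ∩ superCell v d).Nonempty} ⊆ ⋃ s ∈ S, {d | s ∈ superCell v d} := by
    rintro d ⟨s, hs, hd⟩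
    exact mem_iUnion₂.mpr ⟨s, hs, hd⟩
  refine (hS.biUnion fun s hs => Set.Subsingleton.finite ?_).subset h
  intro d hd e he
  by_contra hde
  exact Set.disjoint_left.mp (disjoint_interior_superCell v hde)
    (mem_interior_of_offBoundary hv hs hd) (mem_interior_of_offBoundary hv hs he)

theorem isApproxMDS_three_of_isOptimalFor {S : Set Pt} (hS : S.Finite) {v : Pt}
    (hv : OffBoundary S v) {N : ℤ × ℤ → Set Pt}
    (hN : ∀ d, IsOptimalFor S (superCell v d) (N d)) : IsApproxMDS 3 S (⋃ d, N d) := by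
  classical
  refine ⟨⟨iUnion_subset fun d c hc => ((hN d).1.1 hc).1, fun s hs => ?_⟩, fun O hO => ?_⟩
  · obtain ⟨d, hd⟩ := mem_iUnion.mp ((iUnion_superCell v).ge (mem_univ s))
    obtain ⟨c, hc, h⟩ := (hN d).1.2 s ⟨hs, hd⟩
    exact ⟨c, mem_iUnion.mpr ⟨d, hc⟩, h⟩
  · obtain ⟨⟨hOS, hOcov⟩, -⟩ := hO
    set A : ℤ × ℤ → Set Pt := fun d => O ∩ chi (S ∩ superCell v d) S with hA
    -- The points of `O` relevant to a super-cell form a feasible solution there, so the optimal `N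
    -- d` is no larger.
    have hNA : ∀ d, (N d).encard ≤ (A d).encard := by
      refine fun d => (hN d).2 _ inter_subset_right fun s hs => ?_
      obtain ⟨c, hc, h⟩ := hOcov s hs.1
      exact ⟨c, ⟨hc, hOS hc, s, hs, h⟩, h⟩
    have hdis : ∀ d e : ℤ × ℤ, d ≠ e → colour d = colour e → Disjoint (A d) (A e) := by
      intro d e hde hc
      rw [Set.disjoint_left]
      rintro c ⟨-, -, u, hu, huc⟩ ⟨-, -, w, hw, hwc⟩
      have h := two_lt_dist_of_colour_eq v hde hc (mem_interior_of_offBoundary hv hu.1 hu.2) hw.2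
      have := dist_triangle_right u w c
      linarith
    -- Super-cells without points contribute nothing, so the union over all of them is a finite one.
    have hempty : ∀ d, ¬ (S ∩ superCell v d).Nonempty → N d = ∅ := by
      intro d hd
      rw [not_nonempty_iff_eq_empty] at hd
      refine subset_eq_empty (hN d).1.1 ?_
      rw [hd]
      simp [chi]
    set F := (finite_occupied hS hv).toFinset with hF
    have hcol : ∀ c : ZMod 3, (⋃ d ∈ F.filter (fun d => colour d = c), N d).encard ≤ O.encard := by
      intro c
      refine (encard_biUnion_le_of_disjoint (A := A) _ ?_ fun d _ => hNA d).trans ?_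
      · intro d hd e he hde
        exact hdis d e hde ((Finset.mem_filter.mp hd).2.trans (Finset.mem_filter.mp he).2.symm)
      · exact encard_le_encard (iUnion₂_subset fun d _ => inter_subset_left)
    have hsub : (⋃ d, N d) ⊆ (⋃ d ∈ F.filter (fun d => colour d = 0), N d) ∪
        ((⋃ d ∈ F.filter (fun d => colour d = 1), N d) ∪
          (⋃ d ∈ F.filter (fun d => colour d = 2), N d)) := by
      refine iUnion_subset fun d x hx => ?_
      have hd : d ∈ F := by
        rw [hF, Set.Finite.mem_toFinset]
        by_contra h
        rw [hempty d h] at hx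
        exact hx
      have h3 : ∀ c : ZMod 3, c = 0 ∨ c = 1 ∨ c = 2 := by decide
      rcases h3 (colour d) with h | h | h
      · exact Or.inl (mem_iUnion₂.mpr ⟨d, Finset.mem_filter.mpr ⟨hd, h⟩, hx⟩)
      · exact Or.inr (Or.inl (mem_iUnion₂.mpr ⟨d, Finset.mem_filter.mpr ⟨hd, h⟩, hx⟩))
      · exact Or.inr (Or.inr (mem_iUnion₂.mpr ⟨d, Finset.mem_filter.mpr ⟨hd, h⟩, hx⟩))
    calc (⋃ d, N d).encard ≤ _ := encard_le_encard hsub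
      _ ≤ _ := encard_union_le _ _
      _ ≤ O.encard + (O.encard + O.encard) :=
          add_le_add (hcol 0) ((encard_union_le _ _).trans (add_le_add (hcol 1) (hcol 2)))
      _ = ((3 : ℕ) : ℕ∞) * O.encard := by push_cast; ring

end GeomMDS

namespace GeomMDS

/-! ### A Hoare calculus with time bounds and frames -/

/-- `P`, started in `s`, halts after at most `T` steps in a state satisfying `Q`. -/
def Halts (P : Program) (s : State) (T : ℕ) (Q : State → Prop) : Prop :=
  ∃ t s', Runs P s t s' ∧ t ≤ T ∧ Q s'

/-- The natural number registers written by an instruction. -/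
def Instr.natWrites : Instr → List ℕ
  | .natConst a _ => [a]
  | .natAdd a _ _ => [a]
  | .natSub a _ _ => [a]
  | .natLoad a _ => [a]
  | _ => []

/-- The real registers written by an instruction. -/
def Instr.realWrites : Instr → List ℕ
  | .realConst a _ => [a]
  | .realAdd a _ _ => [a]
  | .realSub a _ _ => [a]
  | .realMul a _ _ => [a]
  | .realDiv a _ _ => [a]
  | .realSqrt a _ => [a]
  | .realLoad a _ => [a]
  | _ => []

/-- Whether an instruction writes to the natural number memory. -/
def Instr.storesNat : Instr → Bool
  | .natStore _ _ => true
  | _ => false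

/-- Whether an instruction writes to the real memory. -/
def Instr.storesReal : Instr → Bool
  | .realStore _ _ => true
  | _ => false

/-- The natural number registers which a program may write. -/
def Program.natWrites : Program → List ℕ
  | .skip => []
  | .instr i => i.natWrites
  | .seq P Q => P.natWrites ++ Q.natWrites
  | .ifThenElse _ P Q => P.natWrites ++ Q.natWrites
  | .whileDo _ P => P.natWrites

/-- The real registers which a program may write. -/
def Program.realWrites : Program → List ℕ
  | .skip => []
  | .instr i => i.realWrites
  | .seq P Q => P.realWrites ++ Q.realWrites
  | .ifThenElse _ P Q => P.realWrites ++ Q.realWrites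
  | .whileDo _ P => P.realWrites

/-- Whether a program may write to the natural number memory. -/
def Program.storesNat : Program → Bool
  | .skip => false
  | .instr i => i.storesNat
  | .seq P Q => P.storesNat || Q.storesNat
  | .ifThenElse _ P Q => P.storesNat || Q.storesNat
  | .whileDo _ P => P.storesNat

/-- Whether a program may write to the real memory. -/
def Program.storesReal : Program → Bool
  | .skip => false
  | .instr i => i.storesReal
  | .seq P Q => P.storesReal || Q.storesReal
  | .ifThenElse _ P Q => P.storesReal || Q.storesReal
  | .whileDo _ P => P.storesReal

/-- `s'` agrees with `s` in everything that `P` cannot write. -/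
structure Framed (P : Program) (s s' : State) : Prop where
  nat : ∀ r, r ∉ P.natWrites → s'.natReg r = s.natReg r
  real : ∀ r, r ∉ P.realWrites → s'.realReg r = s.realReg r
  natMem : P.storesNat = false → s'.natMem = s.natMem
  realMem : P.storesReal = false → s'.realMem = s.realMem

theorem Framed.refl (P : Program) (s : State) : Framed P s s :=
  ⟨fun _ _ => rfl, fun _ _ => rfl, fun _ => rfl, fun _ => rfl⟩

theorem Framed.trans {P : Program} {s s' s'' : State} (h : Framed P s s') (h' : Framed P s' s'') :
    Framed P s s'' :=
  ⟨fun r hr => (h'.nat r hr).trans (h.nat r hr), fun r hr => (h'.real r hr).trans (h.real r hr),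
    fun hs => (h'.natMem hs).trans (h.natMem hs), fun hs => (h'.realMem hs).trans (h.realMem hs)⟩

theorem Framed.mono {P Q : Program} {s s' : State} (h : Framed P s s')
    (h1 : P.natWrites ⊆ Q.natWrites) (h2 : P.realWrites ⊆ Q.realWrites)
    (h3 : Q.storesNat = false → P.storesNat = false)
    (h4 : Q.storesReal = false → P.storesReal = false) : Framed Q s s' :=
  ⟨fun r hr => h.nat r fun h => hr (h1 h), fun r hr => h.real r fun h => hr (h2 h),
    fun hs => h.natMem (h3 hs), fun hs => h.realMem (h4 hs)⟩

theorem framed_instr (i : Instr) (s : State) : Framed (.instr i) s (i.apply s) := by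
  constructor <;> cases i <;>
    simp_all [Program.natWrites, Program.realWrites, Program.storesNat, Program.storesReal,
      Instr.natWrites, Instr.realWrites, Instr.storesNat, Instr.storesReal, Instr.apply]

theorem Framed.seq_left {P Q : Program} {s s' : State} (h : Framed P s s') :
    Framed (.seq P Q) s s' :=
  h.mono (by simp [Program.natWrites]) (by simp [Program.realWrites])
    (by simp +contextual [Program.storesNat]) (by simp +contextual [Program.storesReal])

theorem Framed.seq_right {P Q : Program} {s s' : State} (h : Framed Q s s') :
    Framed (.seq P Q) s s' :=
  h.mono (by simp [Program.natWrites]) (by simp [Program.realWrites])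
    (by simp +contextual [Program.storesNat]) (by simp +contextual [Program.storesReal])

/-- The sets of written registers are computed from the program text, so later preservation facts
for concrete programs are settled by `decide`. -/
theorem Runs.framed {P : Program} {s s' : State} {t : ℕ} (h : Runs P s t s') : Framed P s s' := by
  induction h with
  | skip s => exact Framed.refl _ _
  | instr i s => exact framed_instr i s
  | seq _ _ h1 h2 => exact h1.seq_left.trans h2.seq_right
  | ifTrue _ _ h => exact ⟨h.seq_left.nat, h.seq_left.real, h.seq_left.natMem, h.seq_left.realMem⟩
  | ifFalse _ _ h =>
    exact ⟨h.seq_right.nat, h.seq_right.real, h.seq_right.natMem, h.seq_right.realMem⟩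
  | whileFalse _ => exact Framed.refl _ _
  | whileTrue _ _ _ h1 h2 =>
    exact Framed.trans ⟨h1.nat, h1.real, h1.natMem, h1.realMem⟩ h2

theorem Halts.mono {P : Program} {s : State} {T T' : ℕ} {Q Q' : State → Prop}
    (h : Halts P s T Q) (hT : T ≤ T') (hQ : ∀ s', Framed P s s' → Q s' → Q' s') :
    Halts P s T' Q' := by
  obtain ⟨t, s', hr, ht, hq⟩ := h
  exact ⟨t, s', hr, ht.trans hT, hQ s' hr.framed hq⟩

theorem Halts.skip {s : State} {Q : State → Prop} (h : Q s) : Halts .skip s 1 Q :=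
  ⟨1, s, .skip s, le_rfl, h⟩

theorem Halts.seq {P P' : Program} {s : State} {T T' : ℕ} {R Q : State → Prop}
    (h : Halts P s T R) (h' : ∀ s', Framed P s s' → R s' → Halts P' s' T' Q) :
    Halts (.seq P P') s (T + T') Q := by
  obtain ⟨t, s', hr, ht, hq⟩ := h
  obtain ⟨t', s'', hr', ht', hq'⟩ := h' s' hr.framed hq
  exact ⟨t + t', s'', .seq hr hr', by omega, hq'⟩

theorem Halts.ite {b : Test} {P P' : Program} {s : State} {T : ℕ} {Q : State → Prop}
    (h : b.Holds s → Halts P s T Q) (h' : ¬ b.Holds s → Halts P' s T Q) :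
    Halts (.ifThenElse b P P') s (1 + T) Q := by
  by_cases hb : b.Holds s
  · obtain ⟨t, s', hr, ht, hq⟩ := h hb
    exact ⟨1 + t, s', .ifTrue hb hr, by omega, hq⟩
  · obtain ⟨t, s', hr, ht, hq⟩ := h' hb
    exact ⟨1 + t, s', .ifFalse hb hr, by omega, hq⟩

/-- A straight-line program. -/
def block : List Instr → Program
  | [] => .skip
  | i :: l => .seq (.instr i) (block l)

/-- The effect of a straight-line program. -/
noncomputable def exec : List Instr → State → State
  | [], s => s
  | i :: l, s => exec l (i.apply s)

theorem Halts.block {l : List Instr} {s : State} {Q : State → Prop} (h : Q (exec l s)) :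
    Halts (block l) s (l.length + 1) Q := by
  induction l generalizing s with
  | nil => exact Halts.skip h
  | cons i l ih =>
    obtain ⟨t, s', hr, ht, hq⟩ := ih (s := i.apply s) h
    exact ⟨1 + t, s', .seq (.instr i s) hr, by simp; omega, hq⟩

/-- Increments the natural number register `i`, using register `99`. -/
def incr (i : ℕ) : List Instr := [.natConst 99 1, .natAdd i i 99]

/-- `for i := 0, …, natReg lim - 1 do P` -/
def forUpto (i lim : ℕ) (P : Program) : Program :=
  .seq (.instr (.natConst i 0)) (.whileDo (.natLt i lim) (.seq P (block (incr i))))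

theorem natWrites_forUpto (i lim : ℕ) (P : Program) :
    (forUpto i lim P).natWrites = i :: (P.natWrites ++ [99, i]) := rfl

theorem realWrites_forUpto (i lim : ℕ) (P : Program) :
    (forUpto i lim P).realWrites = P.realWrites := by
  simp [forUpto, Program.realWrites, block, incr, Instr.realWrites]

theorem storesNat_forUpto (i lim : ℕ) (P : Program) :
    (forUpto i lim P).storesNat = P.storesNat := by
  simp [forUpto, Program.storesNat, block, incr, Instr.storesNat]

theorem storesReal_forUpto (i lim : ℕ) (P : Program) :
    (forUpto i lim P).storesReal = P.storesReal := by
  simp [forUpto, Program.storesReal, block, incr, Instr.storesReal]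

/-- One round costs the body, 1 for the test and 3 for the increment block (two instructions and its
closing `skip`); the extra 2 pays for setting the counter and for the failing test. The invariant
for `k + 1` is required after the increment, and the body may use that everything outside the loop's
writes is as at the start. -/
theorem Halts.forUpto {i lim : ℕ} {P : Program} {s : State} {n c : ℕ} (I : ℕ → State → Prop)
    (hlim : s.natReg lim = n) (hi : i ≠ lim) (h99 : i ≠ 99) (h99' : lim ≠ 99)
    (hPi : i ∉ P.natWrites) (hPl : lim ∉ P.natWrites)
    (h0 : I 0 ((Instr.natConst i 0).apply s))
    (hb : ∀ k s', k < n → s'.natReg i = k → Framed (forUpto i lim P) s s' → I k s' →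
      Halts P s' c (fun s'' => I (k + 1) (exec (incr i) s''))) :
    Halts (forUpto i lim P) s (n * (c + 4) + 2) (I n) := by
  have hstep : ∀ s', Framed (GeomMDS.forUpto i lim P) s s' → s'.natReg lim = n := by
    intro s' h
    rw [h.nat lim ?_, hlim]
    rw [natWrites_forUpto]
    simp only [List.mem_cons, List.mem_append, List.not_mem_nil, or_false, not_or]
    exact ⟨hi.symm, hPl, h99', hi.symm⟩
  have main : ∀ m k s', k + m = n → s'.natReg i = k → Framed (GeomMDS.forUpto i lim P) s s' →
      I k s' → Halts (.whileDo (.natLt i lim) (.seq P (GeomMDS.block (incr i)))) s'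
        (m * (c + 4) + 1) (I n) := by
    intro m
    induction m with
    | zero =>
      intro k s' hk hik hf hI
      have : ¬ (Test.natLt i lim).Holds s' := by
        simp only [Test.Holds, hik, hstep s' hf]; omega
      obtain rfl : k = n := by omega
      exact ⟨1, s', .whileFalse this, by omega, hI⟩
    | succ m ih =>
      intro k s' hk hik hf hI
      have hlt : (Test.natLt i lim).Holds s' := by
        simp only [Test.Holds, hik, hstep s' hf]; omega
      obtain ⟨t, u, hr, ht, hq⟩ := hb k s' (by omega) hik hf hI
      obtain ⟨t', u', hr', ht', rfl⟩ := Halts.block (l := incr i) (s := u)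
        (Q := (· = exec (incr i) u))
        rfl
      have hrun : Runs (.seq P (GeomMDS.block (incr i))) s' (t + t') (exec (incr i) u) :=
        .seq hr hr'
      have hfr : Framed (GeomMDS.forUpto i lim P) s (exec (incr i) u) := by
        refine hf.trans (Framed.seq_right ?_)
        exact ⟨hrun.framed.nat, hrun.framed.real, hrun.framed.natMem, hrun.framed.realMem⟩
      have hui : (exec (incr i) u).natReg i = k + 1 := by
        have : u.natReg i = k := by rw [hr.framed.nat i hPi, hik]
        simp [exec, incr, Instr.apply, h99, this]
      obtain ⟨t'', u'', hr'', ht'', hq''⟩ := ih (k + 1) _ (by omega) hui hfr hq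
      refine ⟨1 + (t + t') + t'', u'', .whileTrue hlt hrun hr'', ?_, hq''⟩
      simp only [incr, List.length_cons, List.length_nil] at ht'
      rw [Nat.succ_mul]
      omega
  obtain ⟨t, s', hr, ht, hq⟩ := main n 0 ((Instr.natConst i 0).apply s) (by omega)
    (by simp [Instr.apply]) (Framed.seq_left (framed_instr _ s)) h0
  exact ⟨1 + t, s', .seq (.instr _ s) hr, by omega, hq⟩

end GeomMDS

namespace GeomMDS

/-! ### The dynamic program -/

/-- Data of the dynamic program: points `0, …, n - 1` with coordinates `X`, `Y` and keys `PK`,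
and items `1, …, 3 n` with centres `C` and keys `K`, sorted by their keys. Item `0` is a dummy. -/
structure StripData where
  /-- the number of points -/
  n : ℕ
  /-- abscissas -/
  X : ℕ → ℝ
  /-- ordinates -/
  Y : ℕ → ℝ
  /-- keys of the points -/
  PK : ℕ → ℝ
  /-- centres of the items -/
  C : ℕ → ℕ
  /-- keys of the items -/
  K : ℕ → ℝ

namespace StripData

variable (D : StripData)

/-- The radix of the encoding of sequences of items. -/
def B : ℕ := 3 * D.n + 1

/-- The unit disk around the point `c` contains the point `i`. -/
def Cov (c i : ℕ) : Prop := (D.X c - D.X i) ^ 2 + (D.Y c - D.Y i) ^ 2 ≤ 1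

/-- The `j`-th digit of the code `t` of ten consecutive items; the most recent is digit `0`. -/
def dig (t j : ℕ) : ℕ := t / D.B ^ j % D.B

/-- No item of the code `t` covers the point `i`. -/
def Unc (t i : ℕ) : Prop := ∀ j < 10, ¬ D.Cov (D.C (D.dig t j)) i

/-- All the points passed by the window when the item `a` is dropped are covered. -/
def Chk (a t : ℕ) : Prop :=
  ∀ i < D.n, D.Unc t i → D.PK i ≤ D.K (t / D.B ^ 9) + 1 → D.PK i ≤ D.K a + 1

/-- All the points to the right of the window are covered. -/
def Fin (t : ℕ) : Prop := ∀ i < D.n, D.Unc t i → D.PK i ≤ D.K (t / D.B ^ 9) + 1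

/-- The code preceding `t` with oldest item `a`. -/
def pred (a t : ℕ) : ℕ := a * D.B ^ 9 + t / D.B

/-- The state of the dynamic program after the codes below `t₀` have been processed. The score of
a code is `B` minus the least length of a sequence of items reaching it, and zero if there is
none. -/
structure Table (t₀ : ℕ) (sc pr : ℕ → ℕ) : Prop where
  zero : sc 0 = D.B
  le : ∀ t, sc t ≤ D.B
  undone : ∀ t, t₀ ≤ t → t ≠ 0 → sc t = 0
  back : ∀ t < t₀, t ≠ 0 → 0 < sc t → ∃ a < D.B, pr t = D.pred a t ∧ D.Chk a t ∧
    sc (pr t) = sc t + 1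
  best : ∀ t < t₀, ∀ a < D.B, D.Chk a t → D.pred a t < t → sc (D.pred a t) ≤ sc t + 1

variable {D}

theorem one_le_B : 1 ≤ D.B := by unfold B; omega

/-- Since score zero means unreachable, blank memory with the single entry `B` at code 0 is already
a valid table; no pass over all codes is needed to initialise it. -/
theorem Table.init : D.Table 0 (fun t => if t = 0 then D.B else 0) (fun _ => 0) where
  zero := by simp
  le t := by split_ifs <;> simp
  undone t _ h := by simp [h]
  back t h := by omega
  best t h := by omega

/-- Overwriting entry `t` spoils no pointer set earlier: an unprocessed nonzero code has score 0,
whereas the target of a pointer has positive score, and code 0 keeps its maximal score `B`. -/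
theorem Table.step {t : ℕ} {sc pr : ℕ → ℕ} (h : D.Table t sc pr) {v q : ℕ}
    (hv : v = sc t ∨
      (sc t < v ∧ ∃ a < D.B, D.Chk a t ∧ v + 1 = sc (D.pred a t) ∧ q = D.pred a t))
    (hbest : ∀ a < D.B, D.Chk a t → sc (D.pred a t) ≤ v + 1) :
    D.Table (t + 1) (Function.update sc t v) (Function.update pr t q) := by
  have hvB : v ≤ D.B := by
    rcases hv with rfl | ⟨-, a, -, -, hv, -⟩
    · exact h.le t
    · have := h.le (D.pred a t); omega
  have h0 : t = 0 → v = D.B := by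
    rintro rfl
    rcases hv with rfl | ⟨hlt, a, -, -, hv, -⟩
    · exact h.zero
    · have := h.le (D.pred a 0); have := h.zero; omega
  have hle : sc t ≤ v := by rcases hv with rfl | hv <;> omega
  refine ⟨?_, ?_, ?_, ?_, ?_⟩
  · by_cases ht : t = 0
    · subst ht; simp [h0 rfl]
    · rw [Function.update_of_ne (Ne.symm ht)]; exact h.zero
  · intro t'
    by_cases ht : t' = t
    · subst ht; simpa using hvB
    · rw [Function.update_of_ne ht]; exact h.le t'
  · intro t' ht' h0'
    rw [Function.update_of_ne (by omega)]
    exact h.undone t' (by omega) h0'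
  · intro t' ht' h0' hpos
    by_cases ht : t' = t
    · subst ht
      simp only [Function.update_self] at hpos ⊢
      have hsc : sc t' = 0 := h.undone t' le_rfl h0'
      rcases hv with hv | ⟨-, a, ha, hchk, hv, rfl⟩
      · omega
      · refine ⟨a, ha, rfl, hchk, ?_⟩
        rw [Function.update_of_ne, hv]
        intro he
        rw [he, hsc] at hv
        omega
    · rw [Function.update_of_ne ht] at hpos
      obtain ⟨a, ha, h1, h2, h3⟩ := h.back t' (by omega) h0' hpos
      rw [Function.update_of_ne ht, Function.update_of_ne ht]
      refine ⟨a, ha, h1, h2, ?_⟩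
      rw [Function.update_of_ne, h3]
      intro he
      rw [he] at h3
      by_cases h00 : t = 0
      · have := h.zero
        have := h.le t'
        subst h00
        have hB := h.undone t' (by omega) h0'
        omega
      · have := h.undone t le_rfl h00
        omega
  · intro t' ht' a ha hchk hlt
    by_cases ht : t' = t
    · subst ht
      rw [Function.update_self, Function.update_of_ne (by omega)]
      exact hbest a ha hchk
    · rw [Function.update_of_ne ht, Function.update_of_ne (by omega)]
      exact h.best t' (by omega) a ha hchk hlt

/-! ### Soundness of the dynamic program: tracing back pointers -/

/-- The centres found by following the pointers `pr` from `t`. -/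
def trace (D : StripData) (pr : ℕ → ℕ) : ℕ → ℕ → Finset ℕ
  | 0, _ => ∅
  | k + 1, t => insert (D.C (t % D.B)) (trace D pr k (pr t))

theorem card_trace_le (pr : ℕ → ℕ) (k t : ℕ) : (D.trace pr k t).card ≤ k := by
  induction k generalizing t with
  | zero => simp [trace]
  | succ k ih => exact (Finset.card_insert_le _ _).trans (Nat.succ_le_succ (ih _))

/-- Passing to a predecessor drops the newest digit, shifts the others down and puts `a` on top as
the oldest item. -/
theorem dig_pred_of_lt {a t j : ℕ} (hj : j < 9) :
    D.dig (D.pred a t) j = D.dig t (j + 1) := by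
  have hB := D.one_le_B
  have e : D.B ^ 9 = D.B ^ j * (D.B * D.B ^ (8 - j)) := by
    rw [← pow_succ', ← pow_add]; congr 1; omega
  unfold dig pred
  rw [e, pow_succ', ← Nat.div_div_eq_div_mul]
  have : a * (D.B ^ j * (D.B * D.B ^ (8 - j))) + t / D.B
      = t / D.B + D.B ^ j * (D.B * (a * D.B ^ (8 - j))) := by ring
  rw [this, Nat.add_mul_div_left _ _ (by positivity), Nat.add_mul_mod_self_left]

theorem pred_div {a t : ℕ} (ht : t < D.B ^ 10) : D.pred a t / D.B ^ 9 = a := by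
  have hB := D.one_le_B
  have : t / D.B < D.B ^ 9 := by
    rw [Nat.div_lt_iff_lt_mul (by omega), ← pow_succ]; exact ht
  unfold pred
  rw [mul_comm, Nat.mul_add_div (by positivity), Nat.div_eq_of_lt this, add_zero]

theorem dig_nine {t : ℕ} (ht : t < D.B ^ 10) : D.dig t 9 = t / D.B ^ 9 := by
  have hB := D.one_le_B
  unfold dig
  refine Nat.mod_eq_of_lt ?_
  rw [Nat.div_lt_iff_lt_mul (by positivity), ← pow_succ']
  exact ht

theorem dig_lt (t j : ℕ) : D.dig t j < D.B := Nat.mod_lt _ D.one_le_B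

/-- Following the pointers from a code with positive score yields centres which cover everything
to the left of its window. -/
theorem Table.trace_covers {t₀ : ℕ} {sc pr : ℕ → ℕ} (h : D.Table t₀ sc pr) (ht₀ : t₀ ≤ D.B ^ 10)
    (hK : ∀ i < D.n, D.K 0 + 1 < D.PK i) {k t : ℕ} (ht : t < t₀) (hpos : 0 < sc t)
    (hk : sc t + k = D.B) :
    (∀ j < 10, D.dig t j ≠ 0 → D.C (D.dig t j) ∈ D.trace pr k t) ∧
    (∀ i < D.n, D.PK i ≤ D.K (t / D.B ^ 9) + 1 → ¬ D.Cov (D.C 0) i →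
      ∃ c ∈ D.trace pr k t, D.Cov c i) := by
  induction k generalizing t with
  | zero =>
    -- A nonzero code of score `B` would have a predecessor of score `B + 1`.
    have : t = 0 := by
      by_contra h0
      obtain ⟨a, ha, -, -, h3⟩ := h.back t ht h0 hpos
      have := h.le (pr t)
      omega
    subst this
    refine ⟨fun j _ h0 => absurd (by simp [dig]) h0, fun i hi hle => ?_⟩
    rw [Nat.zero_div] at hle
    linarith [hK i hi]
  | succ k ih =>
    have h0 : t ≠ 0 := by
      rintro rfl
      have := h.zero
      omega
    obtain ⟨a, ha, h1, h2, h3⟩ := h.back t ht h0 hpos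
    have htB : t < D.B ^ 10 := ht.trans_le ht₀
    have hpt : pr t < t₀ := by
      by_contra hcon
      have hp0 : pr t ≠ 0 := by
        intro h; rw [h] at hcon; omega
      have := h.undone (pr t) (by omega) hp0
      omega
    obtain ⟨ih1, ih2⟩ := ih hpt (by omega) (by omega)
    have hdig : ∀ j < 10, D.dig t j ≠ 0 → D.C (D.dig t j) ∈ D.trace pr (k + 1) t := by
      intro j hj hne
      rcases j with _ | j
      · simp [trace, dig]
      · refine Finset.mem_insert_of_mem ?_
        have e := dig_pred_of_lt (D := D) (a := a) (t := t) (j := j) (by omega)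
        rw [← h1] at e
        rw [← e] at hne ⊢
        exact ih1 j (by omega) hne
    refine ⟨hdig, fun i hi hle hC0 => ?_⟩
    by_cases hu : D.Unc t i
    -- The check made on entering `t` moves the point to the left of the predecessor's window, where
    -- the induction hypothesis covers it.
    · have := h2 i hi hu hle
      rw [h1, pred_div htB] at ih2
      obtain ⟨c, hc, hcov⟩ := ih2 i hi this hC0
      exact ⟨c, Finset.mem_insert_of_mem (by rw [h1]; exact hc), hcov⟩
    · unfold Unc at hu
      push Not at hu
      obtain ⟨j, hj, hcov⟩ := hu
      refine ⟨_, hdig j hj fun h => ?_, hcov⟩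
      rw [h] at hcov
      exact hC0 hcov

/-- For an accepted code, a point is covered by the last ten items or lies to the left of the
threshold and is covered by the trace. The dummy covers nothing, so the covering digit is a genuine
item. -/
theorem Table.trace_covers_of_fin {sc pr : ℕ → ℕ} (h : D.Table (D.B ^ 10) sc pr)
    (hK : ∀ i < D.n, D.K 0 + 1 < D.PK i) (hC : ∀ i < D.n, ¬ D.Cov (D.C 0) i) {k t : ℕ}
    (ht : t < D.B ^ 10) (hpos : 0 < sc t) (hk : sc t + k = D.B) (hfin : D.Fin t) :
    ∀ i < D.n, ∃ c ∈ D.trace pr k t, D.Cov c i := by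
  intro i hi
  obtain ⟨h1, h2⟩ := h.trace_covers le_rfl hK ht hpos hk
  by_cases hu : D.Unc t i
  · exact h2 i hi (hfin i hi hu) (hC i hi)
  · unfold Unc at hu
    push Not at hu
    obtain ⟨j, hj, hcov⟩ := hu
    refine ⟨_, h1 j hj fun h => ?_, hcov⟩
    rw [h] at hcov
    exact hC i hi hcov

theorem trace_le (hC : ∀ r < D.B, D.C r ≤ D.n) (pr : ℕ → ℕ) (k t : ℕ) :
    ∀ c ∈ D.trace pr k t, c ≤ D.n := by
  induction k generalizing t with
  | zero => simp [trace]
  | succ k ih =>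
    intro c hc
    rcases Finset.mem_insert.mp hc with rfl | hc
    · exact hC _ (Nat.mod_lt _ D.one_le_B)
    · exact ih _ c hc

/-! ### Completeness of the dynamic program -/

/-- The code of `k` consecutive terms of the sequence `c`, beginning with the `i`-th. -/
def code (D : StripData) (c : ℕ → ℕ) (i : ℕ) : ℕ → ℕ
  | 0 => 0
  | k + 1 => code D c i k * D.B + c (i + k)

theorem code_succ' (c : ℕ → ℕ) (i k : ℕ) :
    D.code c i (k + 1) = c i * D.B ^ k + D.code c (i + 1) k := by
  induction k with
  | zero => simp [code]
  | succ k ih =>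
    rw [code, ih, code, show i + 1 + k = i + (k + 1) by ring]
    ring

theorem code_lt {c : ℕ → ℕ} {i k : ℕ} (hc : ∀ j < k, c (i + j) < D.B) : D.code c i k < D.B ^ k := by
  induction k with
  | zero => simp [code]
  | succ k ih =>
    have h1 := ih fun j hj => hc j (by omega)
    have h2 := hc k (by omega)
    have : (D.code c i k + 1) * D.B ≤ D.B ^ k * D.B := Nat.mul_le_mul_right _ h1
    rw [code, pow_succ]
    rw [add_mul, one_mul] at this
    omega

theorem dig_code {c : ℕ → ℕ} {i k j : ℕ} (hc : ∀ l < k, c (i + l) < D.B) (hj : j < k) :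
    D.dig (D.code c i k) j = c (i + (k - 1 - j)) := by
  induction k generalizing j with
  | zero => omega
  | succ k ih =>
    have h2 := hc k (by omega)
    unfold dig
    rcases j with _ | j
    · rw [pow_zero, Nat.div_one, code, mul_comm, Nat.mul_add_mod, Nat.mod_eq_of_lt h2]
      simp
    · rw [pow_succ', ← Nat.div_div_eq_div_mul, code, mul_comm, Nat.mul_add_div D.one_le_B,
        Nat.div_eq_of_lt h2, add_zero]
      have := ih (fun l hl => hc l (by omega)) (j := j) (by omega)
      unfold dig at this
      rw [this]
      congr 2
      omega

theorem code_le_code {c : ℕ → ℕ} {i k : ℕ} (hc : ∀ j < k, c (i + j) ≤ c (i + 1 + j)) :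
    D.code c i k ≤ D.code c (i + 1) k := by
  induction k with
  | zero => simp [code]
  | succ k ih =>
    exact Nat.add_le_add (Nat.mul_le_mul_right _ (ih fun j hj => hc j (by omega))) (hc k (by omega))

/-- A sequence of `m` items in increasing order, preceded by ten dummies, which covers all points
and has at most ten items in every window. -/
structure Chain (D : StripData) (m : ℕ) (c : ℕ → ℕ) : Prop where
  dummy : ∀ j < 10, c j = 0
  lt : ∀ j < m + 10, c j < D.B
  strict : ∀ j, 9 ≤ j → j + 1 < m + 10 → c j < c (j + 1)
  window : ∀ j < m, D.K (c j) + 2 < D.K (c (j + 10))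
  covers : ∀ i < D.n, ∃ j, 10 ≤ j ∧ j < m + 10 ∧ D.Cov (D.C (c j)) i ∧ |D.K (c j) - D.PK i| ≤ 1

theorem Chain.mono {m : ℕ} {c : ℕ → ℕ} (h : D.Chain m c) {j l : ℕ} (hjl : j ≤ l)
    (hl : l < m + 10) : c j ≤ c l := by
  induction l, hjl using Nat.le_induction with
  | base => exact le_rfl
  | succ l hjl ih =>
    refine (ih (by omega)).trans ?_
    by_cases h9 : 9 ≤ l
    · exact (h.strict l h9 hl).le
    · rw [h.dummy l (by omega)]; omega

/-- A point missed by the ten items from position i on is covered by an earlier item, whose key is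
within 1, or by one from position i + 10 on, whose key exceeds that of item i by more than 2. So the
threshold K(c i) + 1 separates the points covered in the past from those left to the future. -/
theorem Chain.unc {m : ℕ} {c : ℕ → ℕ} (h : D.Chain m c)
    (hK : ∀ r s, r ≤ s → s < D.B → D.K r ≤ D.K s) {i p : ℕ} (hi : i ≤ m) (hp : p < D.n)
    (hu : D.Unc (D.code c i 10) p) :
    (∃ j < i, D.PK p ≤ D.K (c j) + 1) ∨
      (i < m ∧ D.K (c i) + 1 < D.PK p) := by
  obtain ⟨j, h10, hj, hcov, habs⟩ := h.covers p hp
  have hd : ∀ l < 10, ¬ D.Cov (D.C (c (i + l))) p := by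
    intro l hl
    have := hu (9 - l) (by omega)
    rw [dig_code (fun l hl => h.lt _ (by omega)) (by omega)] at this
    rwa [show i + (10 - 1 - (9 - l)) = i + l by omega] at this
  rw [abs_le] at habs
  rcases lt_or_ge j i with hji | hji
  · exact Or.inl ⟨j, hji, by linarith [habs.1]⟩
  · rcases lt_or_ge j (i + 10) with hji' | hji'
    · refine absurd hcov ?_
      have := hd (j - i) (by omega)
      rwa [show i + (j - i) = j by omega] at this
    · refine Or.inr ⟨by omega, ?_⟩
      have h1 := h.window i (by omega)
      have h2 := hK _ _ (h.mono hji' hj) (h.lt _ hj)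
      linarith [habs.2]

theorem Chain.code_div {m : ℕ} {c : ℕ → ℕ} (h : D.Chain m c) {i : ℕ} (hi : i ≤ m) :
    D.code c i 10 / D.B ^ 9 = c i := by
  rw [← dig_nine (code_lt fun j hj => h.lt _ (by omega)),
    dig_code (fun l hl => h.lt _ (by omega)) (by omega)]
  simp

theorem Chain.fin {m : ℕ} {c : ℕ → ℕ} (h : D.Chain m c)
    (hK : ∀ r s, r ≤ s → s < D.B → D.K r ≤ D.K s) : D.Fin (D.code c m 10) := by
  intro p hp hu
  rw [h.code_div le_rfl]
  rcases h.unc hK le_rfl hp hu with ⟨j, hj, hle⟩ | ⟨hlt, -⟩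
  · have := hK _ _ (h.mono hj.le (by omega)) (h.lt m (by omega))
    linarith
  · omega

/-- The windows of the chain form a path from code 0 in which every step passes the check, and each
step lowers the best score by at most 1. -/
theorem Chain.score {m : ℕ} {c : ℕ → ℕ} (h : D.Chain m c)
    (hK : ∀ r s, r ≤ s → s < D.B → D.K r ≤ D.K s) {sc pr : ℕ → ℕ}
    (hT : D.Table (D.B ^ 10) sc pr) {i : ℕ} (hi : i ≤ m) : D.B ≤ sc (D.code c i 10) + i := by
  induction i with
  | zero =>
    have h0 : ∀ k ≤ 10, D.code c 0 k = 0 := by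
      intro k hk
      induction k with
      | zero => rfl
      | succ k ih => rw [code, ih (by omega), h.dummy _ (by omega), zero_mul]
    rw [h0 10 le_rfl, hT.zero, add_zero]
  | succ i ih =>
    have hpred : D.pred (c i) (D.code c (i + 1) 10) = D.code c i 10 := by
      have hlt := h.lt (i + 1 + 9) (by omega)
      have e : D.code c (i + 1) 10 / D.B = D.code c (i + 1) 9 := by
        change (D.code c (i + 1) 9 * D.B + c (i + 1 + 9)) / D.B = _
        rw [mul_comm, Nat.mul_add_div D.one_le_B, Nat.div_eq_of_lt hlt, add_zero]
      rw [pred, e]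
      exact (code_succ' c i 9).symm
    -- Sliding the window raises every digit weakly and the newest one strictly, so numerical order
    -- treats each window before its successor.
    have hlt : D.code c i 10 < D.code c (i + 1) 10 := by
      have h1 : D.code c i 9 ≤ D.code c (i + 1) 9 :=
        code_le_code fun j hj => h.mono (by omega) (by omega)
      have h2 := h.strict (i + 9) (by omega) (by omega)
      rw [show i + 9 + 1 = i + 1 + 9 by ring] at h2
      exact Nat.add_lt_add_of_le_of_lt (Nat.mul_le_mul_right _ h1) h2
    have hchk : D.Chk (c i) (D.code c (i + 1) 10) := by
      intro p hp hu hle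
      rw [h.code_div hi] at hle
      rcases h.unc hK hi hp hu with ⟨j, hj, hle'⟩ | ⟨-, hgt⟩
      · have := hK _ _ (h.mono (show j ≤ i by omega) (by omega)) (h.lt i (by omega))
        linarith
      · linarith
    have := hT.best _ (code_lt fun j hj => h.lt _ (by omega)) (c i) (h.lt i (by omega)) hchk
      (by rw [hpred]; exact hlt)
    rw [hpred] at this
    have := ih (by omega)
    omega

end StripData

end GeomMDS

namespace GeomMDS

namespace StripData

variable {D : StripData}

/-! ### Existence of a short chain -/

/-- The points lie in strips of height `1` with bases `b`, their keys are sorted by strips first,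
and the items are the pairs of a point and a strip met by its unit disk. -/
structure Valid (D : StripData) (b : ℕ → ℝ) (Z : ℝ) : Prop where
  absX : ∀ i < D.n, |D.X i| + 10 ≤ Z
  base_le : ∀ i < D.n, b i ≤ D.Y i
  lt_base : ∀ i < D.n, D.Y i < b i + 1
  sep : ∀ i < D.n, ∀ j < D.n, |b i - b j| < 1 → b i = b j
  key : ∀ i < D.n, D.PK i = D.X i + 2 * Z * b i
  centre : ∀ r, 1 ≤ r → r < D.B → D.C r < D.n
  mono : ∀ r s, 1 ≤ r → r ≤ s → s < D.B → D.K r ≤ D.K s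
  dummy : ∀ r, 1 ≤ r → r < D.B → D.K 0 + 3 ≤ D.K r
  item : ∀ c < D.n, ∀ i < D.n, D.Cov c i →
    ∃ r, 1 ≤ r ∧ r < D.B ∧ D.C r = c ∧ D.K r = D.X c + 2 * Z * b i

theorem Valid.mono' {b : ℕ → ℝ} {Z : ℝ} (h : D.Valid b Z) (r s : ℕ) (hrs : r ≤ s) (hs : s < D.B) :
    D.K r ≤ D.K s := by
  rcases Nat.eq_zero_or_pos r with rfl | hr
  · rcases Nat.eq_zero_or_pos s with rfl | hs'
    · exact le_rfl
    · linarith [h.dummy s hs' hs]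
  · exact h.mono r s hr hrs hs

theorem Cov.abs_X_le {c i : ℕ} (h : D.Cov c i) : |D.X c - D.X i| ≤ 1 := by
  unfold Cov at h
  rw [← sq_le_one_iff_abs_le_one]
  nlinarith [sq_nonneg (D.Y c - D.Y i)]

theorem Cov.abs_Y_le {c i : ℕ} (h : D.Cov c i) : |D.Y c - D.Y i| ≤ 1 := by
  unfold Cov at h
  rw [← sq_le_one_iff_abs_le_one]
  nlinarith [sq_nonneg (D.X c - D.X i)]

/-- A set of items which covers every point within its strip. -/
def StripCover (D : StripData) (b : ℕ → ℝ) (Z : ℝ) (U : Finset ℕ) : Prop :=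
  U ⊆ Finset.Icc 1 (3 * D.n) ∧
    ∀ i < D.n, ∃ r ∈ U, D.Cov (D.C r) i ∧ D.K r = D.X (D.C r) + 2 * Z * b i

open Classical in
/-- The item of the centre `c` in the strip with base `β`. -/
noncomputable def itemOf (D : StripData) (Z : ℝ) (c : ℕ) (β : ℝ) : ℕ :=
  if h : ∃ r, 1 ≤ r ∧ r < D.B ∧ D.C r = c ∧ D.K r = D.X c + 2 * Z * β then h.choose else 0

theorem Valid.itemOf_spec {b : ℕ → ℝ} {Z : ℝ} (h : D.Valid b Z) {c i : ℕ} (hc : c < D.n)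
    (hi : i < D.n) (hcov : D.Cov c i) :
    D.itemOf Z c (b i) ∈ Finset.Icc 1 (3 * D.n) ∧ D.C (D.itemOf Z c (b i)) = c ∧
      D.K (D.itemOf Z c (b i)) = D.X c + 2 * Z * b i := by
  have he := h.item c hc i hi hcov
  obtain ⟨h1, h2, h3, h4⟩ := he.choose_spec
  rw [itemOf, dif_pos he]
  refine ⟨Finset.mem_Icc.mpr ⟨h1, ?_⟩, h3, h4⟩
  exact Nat.lt_succ_iff.mp h2

/-- The source of the factor 3: the bases of strips with a point in the disk of `o` lie in the
half-open interval (Y o − 2, Y o + 1] of length 3 and are at least 1 apart. Rounding up the distance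
to its left end injects them into {1, 2, 3}. -/
theorem Valid.card_bases_le {b : ℕ → ℝ} {Z : ℝ} (h : D.Valid b Z) (o : ℕ) (T : Finset ℝ)
    (hT : ∀ β ∈ T, ∃ i < D.n, β = b i ∧ D.Cov o i) : T.card ≤ 3 := by
  have hb : ∀ β ∈ T, D.Y o - 2 < β ∧ β ≤ D.Y o + 1 := by
    intro β hβ
    obtain ⟨i, hi, rfl, hcov⟩ := hT β hβ
    have h1 := abs_le.mp hcov.abs_Y_le
    have h2 := h.base_le i hi
    have h3 := h.lt_base i hi
    constructor <;> linarith [h1.1, h1.2]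
  refine (Finset.card_le_card_of_injOn (t := Finset.Icc (1 : ℤ) 3)
    (fun β => ⌈β - (D.Y o - 2)⌉) ?_ ?_).trans (by simp)
  · intro β hβ
    have := hb β hβ
    rw [Finset.mem_coe, Finset.mem_Icc]
    constructor
    · rw [Int.one_le_ceil_iff]; linarith
    · rw [Int.ceil_le]; push_cast; linarith
  · intro β hβ γ hγ he
    obtain ⟨i, hi, rfl, -⟩ := hT β hβ
    obtain ⟨j, hj, rfl, -⟩ := hT γ hγ
    refine h.sep i hi j hj ?_
    have h1 := Int.ceil_lt_add_one (b i - (D.Y o - 2))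
    have h2 := Int.le_ceil (b i - (D.Y o - 2))
    have h3 := Int.ceil_lt_add_one (b j - (D.Y o - 2))
    have h4 := Int.le_ceil (b j - (D.Y o - 2))
    simp only at he
    rw [he] at h1 h2
    rw [abs_lt]
    constructor <;> linarith

/-- Choose a dominator for every point and take the pairs of this dominator and the strip of the
point; each dominator occurs with at most three strips. -/
theorem Valid.exists_stripCover {b : ℕ → ℝ} {Z : ℝ} (h : D.Valid b Z) (O : Finset ℕ)
    (hO : ∀ o ∈ O, o < D.n) (hcov : ∀ i < D.n, ∃ o ∈ O, D.Cov o i) :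
    ∃ U, D.StripCover b Z U ∧ U.card ≤ 3 * O.card := by
  classical
  choose! o ho hoc using hcov
  set P := (Finset.range D.n).image fun i => (o i, b i) with hP
  refine ⟨P.image fun q => D.itemOf Z q.1 q.2, ⟨?_, ?_⟩, Finset.card_image_le.trans ?_⟩
  · intro r hr
    simp only [hP, Finset.mem_image, Finset.mem_range] at hr
    obtain ⟨q, ⟨i, hi, rfl⟩, rfl⟩ := hr
    exact (h.itemOf_spec (hO _ (ho i hi)) hi (hoc i hi)).1
  · intro i hi
    obtain ⟨h1, h2, h3⟩ := h.itemOf_spec (hO _ (ho i hi)) hi (hoc i hi)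
    refine ⟨D.itemOf Z (o i) (b i), Finset.mem_image.mpr ⟨(o i, b i), Finset.mem_image.mpr
      ⟨i, Finset.mem_range.mpr hi, rfl⟩, rfl⟩, ?_, ?_⟩
    · rw [h2]; exact hoc i hi
    · rw [h3, h2]
  · have hfib : ∀ a ∈ P.image Prod.fst, (P.filter fun q => q.1 = a).card ≤ 3 := by
      intro a _
      rw [← Finset.card_image_of_injOn (f := Prod.snd) (s := P.filter fun q => q.1 = a)]
      · refine h.card_bases_le a _ ?_
        intro β hβ
        simp only [hP, Finset.mem_image, Finset.mem_filter, Finset.mem_range] at hβ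
        obtain ⟨q, ⟨⟨i, hi, rfl⟩, rfl⟩, rfl⟩ := hβ
        exact ⟨i, hi, rfl, hoc i hi⟩
      · intro q hq q' hq' he
        simp only [Finset.coe_filter, mem_ofPred_eq] at hq hq'
        exact Prod.ext (hq.2.trans hq'.2.symm) he
    refine (Finset.card_le_mul_card_image (f := Prod.fst) P 3 hfib).trans ?_
    refine Nat.mul_le_mul_left _ (Finset.card_le_card ?_)
    intro a ha
    simp only [hP, Finset.mem_image, Finset.mem_range] at ha
    obtain ⟨q, ⟨i, hi, rfl⟩, rfl⟩ := ha
    exact ho i hi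

/-- The minimum with 4 puts the right end 5 into the last of the five unit intervals instead of a
sixth one. -/
theorem abs_sub_le_of_cell_eq {u u' : ℝ} (h5 : u ≤ 5) (h5' : u' ≤ 5)
    (h : min 4 ⌊u⌋ = min 4 ⌊u'⌋) : |u - u'| ≤ 1 := by
  have h1 := Int.floor_le u
  have h2 := Int.lt_floor_add_one u
  have h3 := Int.floor_le u'
  have h4 := Int.lt_floor_add_one u'
  rw [abs_le]
  rcases lt_or_ge ⌊u⌋ 4 with hu | hu
  · have he : ⌊u⌋ = ⌊u'⌋ := by omega
    rw [he] at h1 h2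
    constructor <;> linarith
  · have hu' : 4 ≤ ⌊u'⌋ := by omega
    have e1 : (4 : ℝ) ≤ ⌊u⌋ := by exact_mod_cast hu
    have e2 : (4 : ℝ) ≤ ⌊u'⌋ := by exact_mod_cast hu'
    constructor <;> linarith

/-- In a minimum cardinality strip cover, at most ten items have their centres in a window of
length `2`: the part of the strip they reach is the union of ten rectangles of diameter less
than `1`. -/
theorem Valid.card_window_le {b : ℕ → ℝ} {Z : ℝ} (h : D.Valid b Z) {U : Finset ℕ}
    (hU : D.StripCover b Z U) (hmin : ∀ V, D.StripCover b Z V → U.card ≤ V.card) (a : ℝ) :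
    (U.filter fun r => a ≤ D.K r ∧ D.K r ≤ a + 2).card ≤ 10 := by
  classical
  by_contra! hcon
  set A := U.filter fun r => a ≤ D.K r ∧ D.K r ≤ a + 2 with hA
  have hcl : ∀ r ∈ U, D.C r < D.n := by
    intro r hr
    have := Finset.mem_Icc.mp (hU.1 hr)
    exact h.centre r this.1 (by unfold B; omega)
  set I := (Finset.range D.n).filter fun i =>
    ∃ r ∈ A, D.Cov (D.C r) i ∧ D.K r = D.X (D.C r) + 2 * Z * b i with hI
  have hIn : ∀ i ∈ I, i < D.n := fun i hi => Finset.mem_range.mp (Finset.mem_filter.mp hi).1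
  -- Keys in a window differ by at most 2 and abscissas by at most 2Z − 20, so 2Z times the
  -- difference of the bases is below 2Z in absolute value; bases closer than 1 are equal.
  have hsame : ∀ i ∈ I, ∀ j ∈ I, b i = b j := by
    intro i hi j hj
    obtain ⟨r, hr, -, hr2⟩ := (Finset.mem_filter.mp hi).2
    obtain ⟨s, hs, -, hs2⟩ := (Finset.mem_filter.mp hj).2
    obtain ⟨hrU, hr3, hr4⟩ := Finset.mem_filter.mp hr
    obtain ⟨hsU, hs3, hs4⟩ := Finset.mem_filter.mp hs
    have e1 := h.absX _ (hcl r hrU)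
    have e2 := h.absX _ (hcl s hsU)
    have e3 := abs_nonneg (D.X (D.C r))
    have e4 := neg_abs_le (D.X (D.C r))
    have e5 := le_abs_self (D.X (D.C r))
    have e6 := neg_abs_le (D.X (D.C s))
    have e7 := le_abs_self (D.X (D.C s))
    refine h.sep i (hIn i hi) j (hIn j hj) ?_
    have hZ : 0 < 2 * Z := by linarith
    have h1 : 2 * Z * (b i - b j) < 2 * Z * 1 := by nlinarith
    have h2 : 2 * Z * (-1) < 2 * Z * (b i - b j) := by nlinarith
    rw [abs_lt]
    exact ⟨lt_of_mul_lt_mul_left h2 hZ.le, lt_of_mul_lt_mul_left h1 hZ.le⟩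
  obtain ⟨β, hβ⟩ : ∃ β, ∀ i ∈ I, b i = β := by
    rcases I.eq_empty_or_nonempty with he | ⟨i, hi⟩
    · exact ⟨0, by simp [he]⟩
    · exact ⟨b i, fun j hj => hsame j hj i hi⟩
  -- The centres have abscissas in an interval of length 2, so what they cover extends over length
  -- 4, starting at `x₀`.
  set x₀ := a - 2 * Z * β - 1 with hx₀
  have hXI : ∀ i ∈ I, x₀ ≤ D.X i ∧ D.X i ≤ x₀ + 4 := by
    intro i hi
    obtain ⟨r, hr, hr1, hr2⟩ := (Finset.mem_filter.mp hi).2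
    obtain ⟨hrU, hr3, hr4⟩ := Finset.mem_filter.mp hr
    have := abs_le.mp hr1.abs_X_le
    rw [hβ i hi] at hr2
    constructor <;> linarith [this.1, this.2]
  -- A 5 × 2 grid of rectangles of sides 4/5 and 1/2, whose squared diagonal is 0.89.
  set g : ℕ → ℤ × ℤ := fun i => (min 4 ⌊(D.X i - x₀) * (5 / 4)⌋, ⌊2 * (D.Y i - β)⌋) with hg
  have hgI : (I.image g).card ≤ 10 := by
    refine (Finset.card_le_card (t := Finset.Icc (0 : ℤ) 4 ×ˢ Finset.Icc (0 : ℤ) 1) ?_).trans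
      (by simp)
    intro q hq
    obtain ⟨i, hi, rfl⟩ := Finset.mem_image.mp hq
    have h1 := hXI i hi
    have h2 := h.base_le i (hIn i hi)
    have h3 := h.lt_base i (hIn i hi)
    rw [hβ i hi] at h2 h3
    rw [hg, Finset.mem_product, Finset.mem_Icc, Finset.mem_Icc]
    refine ⟨⟨le_min (by norm_num) (Int.floor_nonneg.mpr (by nlinarith)), min_le_left _ _⟩,
      Int.floor_nonneg.mpr (by linarith), ?_⟩
    rw [← Int.lt_add_one_iff, Int.floor_lt]
    push_cast
    linarith
  have hgcov : ∀ i ∈ I, ∀ j ∈ I, g i = g j → D.Cov i j := by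
    intro i hi j hj he
    rw [hg] at he
    simp only [Prod.mk.injEq] at he
    have h1 := hXI i hi
    have h2 := hXI j hj
    have h3 := abs_le.mp (abs_sub_le_of_cell_eq (by linarith) (by linarith) he.1)
    have h4 := Int.abs_sub_lt_one_of_floor_eq_floor he.2
    rw [abs_lt] at h4
    have e1 : (D.X i - D.X j) ^ 2 ≤ (4 / 5) ^ 2 := sq_le_sq' (by linarith) (by linarith)
    have e2 : (D.Y i - D.Y j) ^ 2 ≤ (1 / 2) ^ 2 := sq_le_sq' (by linarith) (by linarith)
    unfold Cov
    linarith
  have hrep : ∀ q ∈ I.image g, ∃ i ∈ I, g i = q := fun q hq => Finset.mem_image.mp hq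
  choose! rep hrepI hrepg using hrep
  have hspec : ∀ q ∈ I.image g, D.itemOf Z (rep q) β ∈ Finset.Icc 1 (3 * D.n) ∧
      D.C (D.itemOf Z (rep q) β) = rep q ∧
      D.K (D.itemOf Z (rep q) β) = D.X (rep q) + 2 * Z * β := by
    intro q hq
    have := h.itemOf_spec (hIn _ (hrepI q hq)) (hIn _ (hrepI q hq))
      (by unfold Cov; simp)
    rwa [hβ _ (hrepI q hq)] at this
  -- Exchange: one representative point per occupied rectangle replaces all items of the window.
  set V := (U \ A) ∪ (I.image g).image fun q => D.itemOf Z (rep q) β with hV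
  have hVc : D.StripCover b Z V := by
    refine ⟨Finset.union_subset (Finset.sdiff_subset.trans hU.1) ?_, ?_⟩
    · intro r hr
      obtain ⟨q, hq, rfl⟩ := Finset.mem_image.mp hr
      exact (hspec q hq).1
    · intro i hi
      obtain ⟨r, hr, hr1, hr2⟩ := hU.2 i hi
      by_cases hrA : r ∈ A
      · have hiI : i ∈ I := Finset.mem_filter.mpr ⟨Finset.mem_range.mpr hi, r, hrA, hr1, hr2⟩
        have hq : g i ∈ I.image g := Finset.mem_image_of_mem g hiI
        obtain ⟨h1, h2, h3⟩ := hspec _ hq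
        refine ⟨_, Finset.mem_union_right _ (Finset.mem_image_of_mem _ hq), ?_, ?_⟩
        · rw [h2]
          exact hgcov _ (hrepI _ hq) _ hiI (hrepg _ hq)
        · rw [h2, h3, hβ i hiI]
      · exact ⟨r, Finset.mem_union_left _ (Finset.mem_sdiff.mpr ⟨hr, hrA⟩), hr1, hr2⟩
  have h1 := hmin V hVc
  have h2 : V.card ≤ (U \ A).card + 10 :=
    (Finset.card_union_le _ _).trans (Nat.add_le_add_left (Finset.card_image_le.trans hgI) _)
  have h3 : (U \ A).card + A.card = U.card :=
    Finset.card_sdiff_add_card_eq_card (Finset.filter_subset _ U : A ⊆ U)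
  omega

/-- The chain lists a minimum strip cover in increasing order after ten dummies. A violation of the
window condition among genuine items would put eleven of them into an interval of length 2. -/
theorem Valid.exists_chain {b : ℕ → ℝ} {Z : ℝ} (h : D.Valid b Z) (O : Finset ℕ)
    (hO : ∀ o ∈ O, o < D.n) (hcov : ∀ i < D.n, ∃ o ∈ O, D.Cov o i) :
    ∃ m c, D.Chain m c ∧ m ≤ 3 * O.card ∧ m < D.B := by
  classical
  obtain ⟨U₀, hU₀, hcard⟩ := h.exists_stripCover O hO hcov
  obtain ⟨U, hU, hmin⟩ : ∃ U, D.StripCover b Z U ∧ ∀ V, D.StripCover b Z V → U.card ≤ V.card := by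
    have hex : ∃ k, ∃ U, D.StripCover b Z U ∧ U.card = k := ⟨_, U₀, hU₀, rfl⟩
    obtain ⟨U, hU, hk⟩ := Nat.find_spec hex
    exact ⟨U, hU, fun V hV => hk.trans_le (Nat.find_min' hex ⟨V, hV, rfl⟩)⟩
  set m := U.card with hm
  let c : ℕ → ℕ := fun j => if hj : 10 ≤ j ∧ j < m + 10 then
    U.orderEmbOfFin hm.symm ⟨j - 10, by omega⟩ else 0
  have hc : ∀ j (hj : 10 ≤ j ∧ j < m + 10), c j = U.orderEmbOfFin hm.symm ⟨j - 10, by omega⟩ :=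
    fun j hj => dif_pos hj
  have hcU : ∀ j, 10 ≤ j → j < m + 10 → c j ∈ U := by
    intro j h1 h2
    rw [hc j ⟨h1, h2⟩]
    exact Finset.orderEmbOfFin_mem _ _ _
  have hcI : ∀ j, 10 ≤ j → j < m + 10 → 1 ≤ c j ∧ c j < D.B := by
    intro j h1 h2
    have := Finset.mem_Icc.mp (hU.1 (hcU j h1 h2))
    unfold B
    omega
  have hc0 : ∀ j < 10, c j = 0 := fun j hj => dif_neg (by omega)
  have hlt : ∀ j l, 10 ≤ j → j < l → l < m + 10 → c j < c l := by
    intro j l h1 h2 h3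
    rw [hc j ⟨h1, by omega⟩, hc l ⟨by omega, h3⟩]
    refine (U.orderEmbOfFin hm.symm).strictMono ?_
    rw [Fin.mk_lt_mk]
    omega
  refine ⟨m, c, ⟨hc0, ?_, ?_, ?_, ?_⟩, (hmin _ hU₀).trans hcard, ?_⟩
  · intro j hj
    by_cases h10 : 10 ≤ j
    · exact (hcI j h10 hj).2
    · rw [hc0 j (by omega)]; exact one_le_B
  · intro j h9 hj
    rcases Nat.eq_or_lt_of_le h9 with rfl | h9
    · rw [hc0 9 (by norm_num)]
      exact (hcI 10 le_rfl hj).1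
    · exact hlt j (j + 1) h9 (by omega) hj
  · intro j hj
    by_cases h10 : 10 ≤ j
    · by_contra! hcon
      have hA := h.card_window_le hU hmin (D.K (c j))
      have hle : ((Finset.range 11).image fun l => c (j + l)).card ≤ 10 := by
        refine (Finset.card_le_card ?_).trans hA
        intro r hr
        obtain ⟨l, hl, rfl⟩ := Finset.mem_image.mp hr
        rw [Finset.mem_range] at hl
        refine Finset.mem_filter.mpr ⟨hcU _ (by omega) (by omega), ?_, ?_⟩
        · refine h.mono' _ _ ?_ (hcI _ (by omega) (by omega)).2
          rcases Nat.eq_zero_or_pos l with rfl | h0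
          · exact le_rfl
          · exact (hlt j (j + l) h10 (by omega) (by omega)).le
        · refine (h.mono' _ _ ?_ (hcI (j + 10) (by omega) (by omega)).2).trans hcon
          rcases Nat.eq_or_lt_of_le (show l ≤ 10 by omega) with rfl | h0
          · exact le_rfl
          · exact (hlt (j + l) (j + 10) (by omega) (by omega) (by omega)).le
      rw [Finset.card_image_of_injOn] at hle
      · simp at hle
      · intro l hl l' hl' he
        simp only [Finset.coe_range, mem_Iio] at hl hl'
        simp only at he
        by_contra hne
        rcases Nat.lt_or_gt_of_ne hne with h' | h'
        · have := hlt (j + l) (j + l') (by omega) (by omega) (by omega); omega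
        · have := hlt (j + l') (j + l) (by omega) (by omega) (by omega); omega
    -- A window that starts with a dummy is long enough because the dummy's key is at least 3 below
    -- every other.
    · rw [hc0 j (by omega)]
      have := hcI (j + 10) (by omega) (by omega)
      linarith [h.dummy _ this.1 this.2]
  · intro i hi
    obtain ⟨r, hr, hr1, hr2⟩ := hU.2 i hi
    have : r ∈ Set.range (U.orderEmbOfFin hm.symm) := by
      rw [Finset.range_orderEmbOfFin]; exact hr
    obtain ⟨k, rfl⟩ := this
    have hk := k.2
    refine ⟨k + 10, by omega, by omega, ?_, ?_⟩
    all_goals rw [hc (k + 10) ⟨by omega, by omega⟩]; simp only [Nat.add_sub_cancel, Fin.eta]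
    · exact hr1
    · rw [hr2, h.key i hi]
      have := hr1.abs_X_le
      rwa [add_sub_add_right_eq_sub]
  · have := Finset.card_le_card hU.1
    rw [Nat.card_Icc] at this
    unfold B
    omega

end StripData

end GeomMDS

namespace GeomMDS

/-! ### Constants -/

/-- Computes a bound for all coordinates. -/
def boundProg : Program :=
  .seq (block [.realConst 0 10, .realConst 2 1, .natConst 1 1])
    (forUpto 10 0 (block [.natAdd 11 10 10, .realLoad 3 11, .realMul 3 3 3, .realAdd 0 0 3,
      .realAdd 0 0 2, .natAdd 11 11 1, .realLoad 3 11, .realMul 3 3 3, .realAdd 0 0 3,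
      .realAdd 0 0 2]))

/-- A bound for all coordinates can thus be had by summation: 10 plus the sum of x² + 1 over all
coordinates. -/
theorem abs_le_sq_add_one (x : ℝ) : |x| ≤ x * x + 1 := by
  rw [← abs_mul_abs_self x]
  nlinarith [sq_nonneg (|x| - 1)]

theorem boundProg_spec {n : ℕ} {x y : ℕ → ℝ} {s : State} (hn : s.natReg 0 = n)
    (hx : ∀ i < n, s.realMem (i + i) = x i) (hy : ∀ i < n, s.realMem (i + i + 1) = y i) :
    Halts boundProg s (n * 15 + 6) fun s' => s'.natReg 1 = 1 ∧ s'.realReg 2 = 1 ∧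
      10 ≤ s'.realReg 0 ∧
      ∀ i < n, |x i| + 10 ≤ s'.realReg 0 ∧ |y i| + 10 ≤ s'.realReg 0 := by
  refine (Halts.seq (T' := n * 15 + 2) (Halts.block (Q := fun s' => s'.natReg 0 = n ∧
    s'.natReg 1 = 1 ∧ s'.realReg 2 = 1 ∧ s'.realReg 0 = 10 ∧ s'.realMem = s.realMem) ?_)
    fun s₁ hf₁ h₁ => ?_).mono (by simp; omega) fun _ _ h => h
  · simp [exec, Instr.apply, hn]
  obtain ⟨h0, h1, h2, h3, hm⟩ := h₁
  refine Halts.forUpto (c := 11) (fun k s' => s'.natReg 1 = 1 ∧ s'.realReg 2 = 1 ∧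
    10 ≤ s'.realReg 0 ∧
    ∀ i < k, |x i| + 10 ≤ s'.realReg 0 ∧ |y i| + 10 ≤ s'.realReg 0) h0 (by decide) (by decide)
    (by decide) (by decide) (by decide) ?_ ?_
  · simp [Instr.apply, h1, h2, h3]
  · rintro k s₂ hk hik hf ⟨g1, g2, g3, g4⟩
    have hmem : s₂.realMem = s.realMem := by rw [hf.realMem (by decide), hm]
    refine Halts.block ?_
    simp only [incr, exec, Instr.apply, Function.update_apply, hik, hmem, g1, g2]
    norm_num
    rw [hx k hk, hy k hk]
    have e1 := abs_le_sq_add_one (x k)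
    have e2 := abs_le_sq_add_one (y k)
    have e3 := mul_self_nonneg (x k)
    have e4 := mul_self_nonneg (y k)
    refine ⟨by linarith, fun i hi => ?_⟩
    rcases Nat.le_iff_lt_or_eq.mp hi with h | rfl
    · have := g4 i h
      exact ⟨by linarith [this.1], by linarith [this.2]⟩
    · have := abs_nonneg (x i)
      constructor <;> linarith

/-- Computes the constants used by the later phases and stores the dummy point. -/
def constProg : Program :=
  block [.realAdd 1 0 0, .natAdd 11 0 0, .natAdd 11 11 1, .realStore 11 0, .natAdd 2 11 1,
    .natAdd 3 0 0, .natAdd 3 3 0, .natAdd 4 3 1, .natAdd 5 2 0, .natAdd 6 5 3, .natAdd 7 6 3,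
    .natAdd 7 7 1, .natConst 9 3]

/-- The values of the constant registers. -/
structure Consts (n : ℕ) (Z : ℝ) (s : State) : Prop where
  r0 : s.natReg 0 = n
  r1 : s.natReg 1 = 1
  r2 : s.natReg 2 = 2 * n + 2
  r3 : s.natReg 3 = 3 * n
  r4 : s.natReg 4 = 3 * n + 1
  r5 : s.natReg 5 = 3 * n + 2
  r6 : s.natReg 6 = 6 * n + 2
  r7 : s.natReg 7 = 9 * n + 3
  r9 : s.natReg 9 = 3
  z0 : s.realReg 0 = Z
  z1 : s.realReg 1 = 2 * Z
  z2 : s.realReg 2 = 1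

/-- Register 8 is exempt because it is filled later, with 3B⁹, the step between the table addresses
of consecutive predecessors. -/
theorem Consts.congr {n : ℕ} {Z : ℝ} {s s' : State} (h : Consts n Z s)
    (h1 : ∀ r < 10, r ≠ 8 → s'.natReg r = s.natReg r) (h2 : ∀ r < 3, s'.realReg r = s.realReg r) :
    Consts n Z s' := by
  refine ⟨?_, ?_, ?_, ?_, ?_, ?_, ?_, ?_, ?_, ?_, ?_, ?_⟩
  · rw [h1 0 (by norm_num) (by norm_num), h.r0]
  · rw [h1 1 (by norm_num) (by norm_num), h.r1]
  · rw [h1 2 (by norm_num) (by norm_num), h.r2]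
  · rw [h1 3 (by norm_num) (by norm_num), h.r3]
  · rw [h1 4 (by norm_num) (by norm_num), h.r4]
  · rw [h1 5 (by norm_num) (by norm_num), h.r5]
  · rw [h1 6 (by norm_num) (by norm_num), h.r6]
  · rw [h1 7 (by norm_num) (by norm_num), h.r7]
  · rw [h1 9 (by norm_num) (by norm_num), h.r9]
  · rw [h2 0 (by norm_num), h.z0]
  · rw [h2 1 (by norm_num), h.z1]
  · rw [h2 2 (by norm_num), h.z2]

/-- A program which does not change the constants. -/
def KeepsConsts (P : Program) : Prop :=
  (∀ r < 10, r ≠ 8 → r ∉ P.natWrites) ∧ ∀ r < 3, r ∉ P.realWrites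

theorem Consts.framed {n : ℕ} {Z : ℝ} {P : Program} {s s' : State} (h : Consts n Z s)
    (hf : Framed P s s') (hP : KeepsConsts P) : Consts n Z s' :=
  h.congr (fun r hr h8 => hf.nat r (hP.1 r hr h8)) (fun r hr => hf.real r (hP.2 r hr))

theorem constProg_spec {n : ℕ} {s : State} (h0 : s.natReg 0 = n) (h1 : s.natReg 1 = 1)
    (h2 : s.realReg 2 = 1) :
    Halts constProg s 14 fun s' => Consts n (s.realReg 0) s' ∧ s'.natMem = s.natMem ∧
      s'.realMem = Function.update s.realMem (n + n + 1) (s.realReg 0) := by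
  refine Halts.block ⟨⟨?_, ?_, ?_, ?_, ?_, ?_, ?_, ?_, ?_, ?_, ?_, ?_⟩, ?_, ?_⟩ <;>
    simp [exec, Instr.apply, h0, h1, h2] <;> first | omega | ring

/-! ### Strips -/

/-- The bases of the strips found when all points below `cur` have been treated. -/
structure BaseInv (n : ℕ) (y b : ℕ → ℝ) (cur : ℝ) (k : ℕ) : Prop where
  base : ∀ p < n, y p < cur → b p ≤ y p ∧ y p < b p + 1 ∧ b p + 1 ≤ cur
  sep : ∀ p < n, ∀ q < n, y p < cur → y q < cur → |b p - b q| < 1 → b p = b q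
  count : k ≤ ((Finset.range n).filter fun p => y p < cur).card ∨ ∀ p < n, y p < cur

/-- One greedy round: the lowest ordinate not below `cur` becomes a base for everything above it,
subject to revision by later rounds for points at height m + 1 or more. The value `Z` is a sentinel
for the case that no point is left. -/
theorem BaseInv.step {n : ℕ} {y b : ℕ → ℝ} {cur m Z : ℝ} {k : ℕ} (h : BaseInv n y b cur k)
    (hyZ : ∀ p < n, y p < Z) (h1 : ∀ p < n, cur ≤ y p → m ≤ y p)
    (h2 : m = Z ∨ ∃ p < n, y p = m ∧ cur ≤ m) (hcZ : m = Z → cur ≤ m + 1) :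
    BaseInv n y (fun p => if m ≤ y p then m else b p) (m + 1) (k + 1) := by
  have hnew : ∀ p < n, m ≤ y p → m = y p ∨ m < y p := fun p _ hp => hp.eq_or_lt
  have hcm : cur ≤ m + 1 := by
    rcases h2 with h2 | ⟨p, -, -, hp⟩
    · exact hcZ h2
    · linarith
  have hcm' : ∀ p < n, m ≤ y p → cur ≤ m := by
    intro p hp hmp
    rcases h2 with h2 | ⟨q, -, -, hq⟩
    · linarith [hyZ p hp]
    · exact hq
  have hold : ∀ p < n, ¬ m ≤ y p → y p < cur := by
    intro p hp hmp
    by_contra! hc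
    exact hmp (h1 p hp hc)
  refine ⟨?_, ?_, ?_⟩
  · intro p hp hlt
    split_ifs with hm
    · exact ⟨hm, hlt, le_rfl⟩
    · obtain ⟨e1, e2, e3⟩ := h.base p hp (hold p hp hm)
      exact ⟨e1, e2, by linarith⟩
  · intro p hp q hq hpl hql hab
    rw [abs_lt] at hab
    split_ifs at hab ⊢ with hmp hmq hmq
    · rfl
    · have := (h.base q hq (hold q hq hmq)).2.2
      have := hcm' p hp hmp
      linarith [hab.2]
    · have := (h.base p hp (hold p hp hmp)).2.2
      have := hcm' q hq hmq
      linarith [hab.1]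
    · exact h.sep p hp q hq (hold p hp hmp) (hold q hq hmq) (abs_lt.mpr hab)
  -- Either the sentinel was met and all points lie below it, or the point that supplied the base is
  -- newly below the threshold and the count grows. Hence `n` rounds suffice.
  · rcases h2 with h2 | ⟨q, hq, hqm, hcq⟩
    · right
      intro p hp
      linarith [hyZ p hp]
    · rcases h.count with hc | hc
      · left
        refine Nat.succ_le_of_lt (hc.trans_lt (Finset.card_lt_card ?_))
        rw [Finset.ssubset_iff_of_subset]
        · refine ⟨q, Finset.mem_filter.mpr ⟨Finset.mem_range.mpr hq, by linarith⟩, ?_⟩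
          intro hcon
          linarith [(Finset.mem_filter.mp hcon).2]
        · intro p hp
          obtain ⟨hp1, hp2⟩ := Finset.mem_filter.mp hp
          exact Finset.mem_filter.mpr ⟨hp1, by linarith⟩
      · right
        intro p hp
        linarith [hc p hp]

theorem BaseInv.lt_of_count {n : ℕ} {y b : ℕ → ℝ} {cur : ℝ} (h : BaseInv n y b cur n) :
    ∀ p < n, y p < cur := by
  rcases h.count with hc | hc
  · intro p hp
    have he : (Finset.range n).filter (fun p => y p < cur) = Finset.range n :=
      Finset.eq_of_subset_of_card_le (Finset.filter_subset _ _) (by simpa using hc)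
    have := Finset.mem_range.mpr hp
    rw [← he] at this
    exact (Finset.mem_filter.mp this).2
  · exact hc

/-- Finds the least ordinate that is at least real register `10`. -/
def lowestProg : Program :=
  .seq (block [.realConst 12 0, .realAdd 11 0 12])
    (forUpto 11 0 (.seq (block [.natAdd 12 11 11, .natAdd 12 12 1, .realLoad 13 12])
      (.ifThenElse (.realLe 10 13) (.ifThenElse (.realLt 13 11) (block [.realAdd 11 13 12]) .skip)
        .skip)))

/-- Assigns the base in real register `11` to all points above it. -/
def assignProg : Program :=
  forUpto 11 0 (.seq (block [.natAdd 12 11 11, .natAdd 12 12 1, .realLoad 13 12])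
    (.ifThenElse (.realLe 11 13) (block [.natAdd 13 2 11, .realStore 13 11]) .skip))

/-- Computes the bases of the strips. -/
def baseProg : Program :=
  .seq (block [.realConst 10 0, .realSub 10 10 0])
    (forUpto 10 0 (.seq lowestProg (.seq assignProg (block [.realAdd 10 11 2]))))

theorem lowestProg_spec {n : ℕ} {Z : ℝ} {y : ℕ → ℝ} {s : State} (hc : Consts n Z s)
    (hy : ∀ i < n, s.realMem (i + i + 1) = y i) :
    Halts lowestProg s (n * 12 + 5) fun s' =>
      (∀ p < n, s.realReg 10 ≤ y p → s'.realReg 11 ≤ y p) ∧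
      (s'.realReg 11 = Z ∨ ∃ p < n, y p = s'.realReg 11 ∧ s.realReg 10 ≤ s'.realReg 11) := by
  refine (Halts.seq (T' := n * 12 + 2) (Halts.block (Q := fun s' => s'.natReg 0 = n ∧
    s'.natReg 1 = 1 ∧ s'.realReg 11 = Z ∧ s'.realReg 12 = 0) ?_)
    fun s₁ hf₁ h₁ => ?_).mono (by simp; omega) fun _ _ h => h
  · simp [exec, Instr.apply, hc.r0, hc.r1, hc.z0]
  obtain ⟨h0, h1, h2, h3⟩ := h₁
  refine Halts.forUpto (c := 8) (fun k s' =>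
      (∀ p < k, s.realReg 10 ≤ y p → s'.realReg 11 ≤ y p) ∧
      (s'.realReg 11 = Z ∨ ∃ p < n, y p = s'.realReg 11 ∧ s.realReg 10 ≤ s'.realReg 11))
    h0 (by decide) (by decide)
    (by decide) (by decide) (by decide) ?_ ?_
  · simp [Instr.apply, h2]
  · rintro k s₂ hk hik hf ⟨g1, g2⟩
    have hmem : s₂.realMem = s.realMem := by rw [hf.realMem (by decide), hf₁.realMem (by decide)]
    have e1 : s₂.natReg 1 = 1 := by rw [hf.nat 1 (by decide), h1]
    have e2 : s₂.realReg 10 = s.realReg 10 := by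
      rw [hf.real 10 (by decide), hf₁.real 10 (by decide)]
    have e3 : s₂.realReg 12 = 0 := by rw [hf.real 12 (by decide), h3]
    refine (Halts.seq (T' := 4) (Halts.block (Q := fun s' => s'.realReg 13 = y k ∧
      s'.realReg 10 = s.realReg 10 ∧ s'.realReg 11 = s₂.realReg 11 ∧ s'.realReg 12 = 0 ) ?_)
      fun s₃ hf₃ h₃ => ?_).mono le_rfl fun _ _ h => h
    · simp [exec, Instr.apply, hik, e1, hmem, hy k hk, e2, e3]
    obtain ⟨f1, f2, f3, f4⟩ := h₃
    refine Halts.ite (T := 3) (fun hb => Halts.ite (T := 2) (fun hb' => Halts.block ?_)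
      (fun hb' => (Halts.skip ?_).mono (by norm_num) fun _ _ h => h))
      (fun hb => (Halts.skip ?_).mono (by norm_num) fun _ _ h => h)
    all_goals simp only [Test.Holds, f1, f2] at hb
    all_goals try simp only [Test.Holds, f1, f3] at hb'
    all_goals simp [incr, exec, Instr.apply, f1, f3, f4]
    · refine ⟨fun p hp hle => ?_, Or.inr ⟨k, hk, rfl, hb⟩⟩
      rcases Nat.le_iff_lt_or_eq.mp hp with h | rfl
      · exact hb'.le.trans (g1 p h hle)
      · exact le_rfl
    · refine ⟨fun p hp hle => ?_, g2⟩
      rcases Nat.le_iff_lt_or_eq.mp hp with h | rfl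
      · exact g1 p h hle
      · exact not_lt.mp hb'
    · refine ⟨fun p hp hle => ?_, g2⟩
      rcases Nat.le_iff_lt_or_eq.mp hp with h | rfl
      · exact g1 p h hle
      · exact absurd hle hb

theorem assignProg_spec {n : ℕ} {Z : ℝ} {y : ℕ → ℝ} {s : State} (hc : Consts n Z s)
    (hy : ∀ i < n, s.realMem (i + i + 1) = y i) :
    Halts assignProg s (n * 12 + 2) fun s' =>
      (∀ a < 2 * n + 2, s'.realMem a = s.realMem a) ∧
      (∀ p < n, s'.realMem (2 * n + 2 + p) =
        if s.realReg 11 ≤ y p then s.realReg 11 else s.realMem (2 * n + 2 + p)) := by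
  refine (Halts.forUpto (c := 8) (fun k s' =>
      (∀ a < 2 * n + 2, s'.realMem a = s.realMem a) ∧
      (∀ p < n, s'.realMem (2 * n + 2 + p) =
        if p < k ∧ s.realReg 11 ≤ y p then s.realReg 11 else s.realMem (2 * n + 2 + p)))
    hc.r0 (by decide) (by decide)
    (by decide) (by decide) (by decide) ?_ ?_).mono le_rfl ?_
  · simp [Instr.apply]
  · rintro k s₂ hk hik hf ⟨g1, g2⟩
    have e1 : s₂.natReg 1 = 1 := by rw [hf.nat 1 (by decide), hc.r1]
    have e2 : s₂.natReg 2 = 2 * n + 2 := by rw [hf.nat 2 (by decide), hc.r2]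
    have e3 : s₂.realReg 11 = s.realReg 11 := by rw [hf.real 11 (by decide)]
    have e4 : s₂.realMem (k + k + 1) = y k := by rw [g1 _ (by omega), hy k hk]
    refine (Halts.seq (T' := 4) (Halts.block (Q := fun s' => s'.realReg 13 = y k ∧
      s'.realReg 11 = s.realReg 11 ∧ s'.natReg 2 = 2 * n + 2 ∧ s'.natReg 11 = k ∧
      s'.realMem = s₂.realMem) ?_)
      fun s₃ hf₃ h₃ => ?_).mono le_rfl fun _ _ h => h
    · simp [exec, Instr.apply, hik, e1, e2, e3, e4]
    obtain ⟨f1, f2, f3, f4, f5⟩ := h₃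
    refine Halts.ite (T := 3) (fun hb => Halts.block ?_)
      (fun hb => (Halts.skip ?_).mono (by norm_num) fun _ _ h => h) <;>
    simp only [Test.Holds, f1, f2] at hb <;>
    simp only [incr, exec, Instr.apply, f2, f3, f4, f5, Function.update_apply] <;>
    norm_num
    · refine ⟨fun a ha => ?_, fun p hp => ?_⟩
      · rw [if_neg (by omega), g1 a ha]
      · by_cases hpk : p = k
        · subst hpk; simp [hb]
        · rw [if_neg hpk, g2 p hp]
          congr 1
          simp only [eq_iff_iff, and_congr_left_iff]
          intro; omega
    · refine ⟨g1, fun p hp => ?_⟩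
      rw [g2 p hp]
      by_cases hpk : p = k
      · subst hpk; simp [hb]
      · congr 1
        simp only [eq_iff_iff, and_congr_left_iff]
        intro; omega
  · rintro s' - ⟨h1, h2⟩
    refine ⟨h1, fun p hp => ?_⟩
    rw [h2 p hp]
    simp [hp]

theorem baseProg_spec {n : ℕ} {Z : ℝ} {y : ℕ → ℝ} {s : State} (hc : Consts n Z s)
    (hy : ∀ i < n, s.realMem (i + i + 1) = y i) (hyZ : ∀ i < n, |y i| + 10 ≤ Z) (hZ : 0 ≤ Z) :
    Halts baseProg s (n * (n * 24 + 20) + 10) fun s' =>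
      (∀ a < 2 * n + 2, s'.realMem a = s.realMem a) ∧
      ∃ cur, (∀ i < n, y i < cur) ∧ BaseInv n y (fun p => s'.realMem (2 * n + 2 + p)) cur n := by
  have hKC : KeepsConsts baseProg := by unfold KeepsConsts; decide
  refine (Halts.seq (T' := n * ((n * 24 + 10) + 4) + 2) (Halts.block (Q := fun s' =>
    s'.realReg 10 = - Z ∧ s'.natReg 0 = n) ?_)
    fun s₁ hf₁ h₁ => ?_).mono (by simp; nlinarith) fun _ _ h => h
  · simp [exec, Instr.apply, hc.z0, hc.r0]
  obtain ⟨h0, h1⟩ := h₁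
  have hf₁' : Framed baseProg s s₁ := hf₁.seq_left
  have hmem₁ : s₁.realMem = s.realMem := hf₁.realMem (by decide)
  refine (Halts.forUpto (c := n * 24 + 10) (fun k s' =>
      (∀ a < 2 * n + 2, s'.realMem a = s.realMem a) ∧ (s'.realReg 10 ≤ Z + 1) ∧
      BaseInv n y (fun p => s'.realMem (2 * n + 2 + p)) (s'.realReg 10) k)
    h1 (by decide) (by decide)
    (by decide) (by decide) (by decide) ?_ ?_).mono le_rfl ?_
  · simp only [Instr.apply]
    refine ⟨fun a _ => by rw [hmem₁], by rw [h0]; linarith, ?_⟩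
    have hno : ∀ p < n, ¬ y p < s₁.realReg 10 := by
      intro p hp
      rw [h0, not_lt]
      have := hyZ p hp
      have := neg_abs_le (y p)
      linarith
    exact ⟨fun p hp h => absurd h (hno p hp), fun p hp _ _ h => absurd h (hno p hp),
      Or.inl (Nat.zero_le _)⟩
  · rintro k s₂ hk hik hf ⟨g1, g2, g3⟩
    have hc₂ : Consts n Z s₂ := hc.framed (hf₁'.trans hf.seq_right) hKC
    have hy₂ : ∀ i < n, s₂.realMem (i + i + 1) = y i := fun i hi => by
      rw [g1 _ (by omega), hy i hi]
    refine (Halts.seq (T' := n * 12 + 5) (lowestProg_spec hc₂ hy₂)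
      fun s₃ hf₃ h₃ => ?_).mono (by omega) fun _ _ h => h
    obtain ⟨f1, f2⟩ := h₃
    have hc₃ : Consts n Z s₃ := hc₂.framed hf₃ (by unfold KeepsConsts; decide)
    have hmem₃ : s₃.realMem = s₂.realMem := hf₃.realMem (by decide)
    refine (Halts.seq (T' := 2) (assignProg_spec (y := y) hc₃ (by rw [hmem₃]; exact hy₂))
      fun s₄ hf₄ h₄ => ?_).mono (by omega) fun _ _ h => h
    obtain ⟨e1, e2⟩ := h₄
    have e3 : s₄.realReg 11 = s₃.realReg 11 := hf₄.real 11 (by decide)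
    have e4 : s₄.realReg 2 = 1 := (hc₃.framed hf₄ (by unfold KeepsConsts; decide)).z2
    refine Halts.block ?_
    have hr : (exec (incr 10) (exec [.realAdd 10 11 2] s₄)).realReg 10 = s₃.realReg 11 + 1 := by
      simp [exec, incr, Instr.apply, e3, e4]
    have hm : (exec (incr 10) (exec [.realAdd 10 11 2] s₄)).realMem = s₄.realMem := by
      simp [exec, incr, Instr.apply]
    have hmZ : s₃.realReg 11 ≤ Z := by
      rcases f2 with f2 | ⟨p, hp, f2, -⟩
      · exact f2.le
      · rw [← f2]
        have := hyZ p hp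
        have := le_abs_self (y p)
        linarith
    rw [hr, hm]
    refine ⟨fun a ha => by rw [e1 a ha, hmem₃, g1 a ha], by linarith, ?_⟩
    have hstep := g3.step (m := s₃.realReg 11) (Z := Z)
      (fun p hp => by have := hyZ p hp; have := le_abs_self (y p); linarith) f1 f2
      (fun h => by rw [h]; exact g2)
    refine ⟨fun p hp => ?_, fun p hp q hq => ?_, hstep.count⟩
    · have := hstep.base p hp
      rwa [e2 p hp, hmem₃]
    · have := hstep.sep p hp q hq
      rwa [e2 p hp, e2 q hq, hmem₃]
  · rintro s' - ⟨h1, -, h3⟩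
    exact ⟨h1, _, h3.lt_of_count, h3⟩

end GeomMDS

namespace GeomMDS

/-! ### Items -/

/-- The points with ordinates `y` lie in the strips of height `1` with bases `b`. -/
structure Bases (n : ℕ) (y b : ℕ → ℝ) (Z : ℝ) : Prop where
  absY : ∀ i < n, |y i| + 10 ≤ Z
  base_le : ∀ i < n, b i ≤ y i
  lt_base : ∀ i < n, y i < b i + 1
  sep : ∀ i < n, ∀ j < n, |b i - b j| < 1 → b i = b j

/-- `u` and `v` are the bases of the strips next to the one with base `β`, if there are any. -/
structure Neighbours (n : ℕ) (b : ℕ → ℝ) (Z β u v : ℝ) : Prop where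
  le_of_lt : ∀ p < n, β < b p → u ≤ b p
  next : u = Z ∨ ∃ p < n, b p = u ∧ β < u
  ge_of_lt : ∀ p < n, b p < β → b p ≤ v
  prev : v = -Z ∨ ∃ p < n, b p = v ∧ v < β

theorem Bases.abs_base_lt {n : ℕ} {y b : ℕ → ℝ} {Z : ℝ} (h : Bases n y b Z) {i : ℕ} (hi : i < n) :
    |b i| < Z := by
  have h1 := abs_le.mp (le_sub_iff_add_le.mpr (h.absY i hi))
  have h2 := h.base_le i hi
  have h3 := h.lt_base i hi
  rw [abs_lt]
  constructor <;> linarith [h1.1, h1.2]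

/-- Distinct bases are at least 1 apart. A strip beyond the next one has its base 2 or more away
from that of `i`, too far for a vertical distance of at most 1; so three items per point are enough.
-/
theorem Bases.eq_or_eq_of_abs_le {n : ℕ} {y b : ℕ → ℝ} {Z u v : ℝ} (h : Bases n y b Z) {i p : ℕ}
    (hi : i < n) (hp : p < n) (hN : Neighbours n b Z (b i) u v) (hip : |y i - y p| ≤ 1) :
    b p = b i ∨ b p = u ∨ b p = v := by
  have hgap : ∀ j < n, ∀ l < n, b j < b l → b j + 1 ≤ b l := by
    intro j hj l hl hlt
    by_contra! hcon
    exact hlt.ne (h.sep j hj l hl (abs_lt.mpr ⟨by linarith, by linarith⟩))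
  have hi' := abs_le.mp hip
  have hbi := h.base_le i hi
  have hbi' := h.lt_base i hi
  have hbp := h.base_le p hp
  have hbp' := h.lt_base p hp
  have hZp := abs_lt.mp (h.abs_base_lt hp)
  rcases lt_trichotomy (b p) (b i) with hlt | he | hgt
  · refine Or.inr (Or.inr ?_)
    have h1 := hN.ge_of_lt p hp hlt
    rcases hN.prev with h2 | ⟨q, hq, rfl, h2⟩
    · linarith [hZp.1]
    · by_contra hne
      have h3 := hgap p hp q hq (lt_of_le_of_ne h1 hne)
      have h4 := hgap q hq i hi h2
      linarith [hi'.2]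
  · exact Or.inl he
  · refine Or.inr (Or.inl ?_)
    have h1 := hN.le_of_lt p hp hgt
    rcases hN.next with h2 | ⟨q, hq, rfl, h2⟩
    · linarith [hZp.2]
    · by_contra hne
      have h3 := hgap q hq p hp (lt_of_le_of_ne h1 (Ne.symm hne))
      have h4 := hgap i hi q hq h2
      linarith [hi'.1]

/-- Finds the bases of the strips next to the one with base in real register `14`. -/
def neighbourProg : Program :=
  .seq (block [.realConst 12 0, .realAdd 15 0 12, .realSub 16 12 0])
    (forUpto 11 0 (.seq (block [.natAdd 12 2 11, .realLoad 17 12])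
      (.seq (.ifThenElse (.realLt 14 17)
          (.ifThenElse (.realLt 17 15) (block [.realAdd 15 17 12]) .skip) .skip)
        (.ifThenElse (.realLt 17 14)
          (.ifThenElse (.realLt 16 17) (block [.realAdd 16 17 12]) .skip) .skip))))

theorem neighbourProg_spec {n : ℕ} {Z : ℝ} {b : ℕ → ℝ} {s : State} (hc : Consts n Z s)
    (hb : ∀ i < n, s.realMem (2 * n + 2 + i) = b i) :
    Halts neighbourProg s (n * 20 + 6) fun s' =>
      Neighbours n b Z (s.realReg 14) (s'.realReg 15) (s'.realReg 16) := by
  refine (Halts.seq (T' := n * 15 + 2) (Halts.block (Q := fun s' => s'.natReg 0 = n ∧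
    s'.natReg 2 = 2 * n + 2 ∧ s'.realReg 15 = Z ∧ s'.realReg 16 = -Z ∧ s'.realReg 12 = 0) ?_)
    fun s₁ hf₁ h₁ => ?_).mono (by simp; omega) fun _ _ h => h
  · simp [exec, Instr.apply, hc.r0, hc.r2, hc.z0]
  obtain ⟨h0, h1, h2, h3, h4⟩ := h₁
  refine (Halts.forUpto (c := 11) (fun k s' =>
      ((∀ p < k, s.realReg 14 < b p → s'.realReg 15 ≤ b p) ∧
        (s'.realReg 15 = Z ∨ ∃ p < n, b p = s'.realReg 15 ∧ s.realReg 14 < s'.realReg 15)) ∧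
      ((∀ p < k, b p < s.realReg 14 → b p ≤ s'.realReg 16) ∧
        (s'.realReg 16 = -Z ∨ ∃ p < n, b p = s'.realReg 16 ∧ s'.realReg 16 < s.realReg 14)))
    h0 (by decide) (by decide)
    (by decide) (by decide) (by decide) ?_ ?_).mono le_rfl ?_
  · simp [Instr.apply, h2, h3]
  · rintro k s₂ hk hik hf ⟨⟨g1, g2⟩, ⟨g3, g4⟩⟩
    have hmem : s₂.realMem = s.realMem := by rw [hf.realMem (by decide), hf₁.realMem (by decide)]
    have e1 : s₂.natReg 2 = 2 * n + 2 := by rw [hf.nat 2 (by decide), h1]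
    have e2 : s₂.realReg 14 = s.realReg 14 := by
      rw [hf.real 14 (by decide), hf₁.real 14 (by decide)]
    have e3 : s₂.realReg 12 = 0 := by rw [hf.real 12 (by decide), h4]
    refine Halts.seq (T := 3) (T' := 8) (Halts.block (l := [_, _]) (Q := fun s' =>
      s'.realReg 17 = b k ∧ s'.realReg 14 = s.realReg 14 ∧ s'.realReg 15 = s₂.realReg 15 ∧
      s'.realReg 16 = s₂.realReg 16 ∧ s'.realReg 12 = 0) ?_)
      fun s₃ hf₃ h₃ => ?_
    · simp [exec, Instr.apply, hik, e1, hmem, hb k hk, e2, e3]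
    obtain ⟨f1, f2, f3, f4, f5⟩ := h₃
    refine Halts.seq (T := 4) (T' := 4) (R := fun s' =>
      (∀ p < k + 1, s.realReg 14 < b p → s'.realReg 15 ≤ b p) ∧
        (s'.realReg 15 = Z ∨ ∃ p < n, b p = s'.realReg 15 ∧ s.realReg 14 < s'.realReg 15))
      (Halts.ite (T := 3) (fun hb => Halts.ite (T := 2) (fun hb' => Halts.block (l := [_]) ?_)
        (fun hb' => (Halts.skip ?_).mono (by norm_num) fun _ _ h => h))
        (fun hb => (Halts.skip ?_).mono (by norm_num) fun _ _ h => h)) ?_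
    · simp only [Test.Holds, f1, f2, f3] at hb hb'
      simp [exec, Instr.apply, f1, f5]
      refine ⟨fun p hp hle => ?_, Or.inr ⟨k, hk, rfl, hb⟩⟩
      rcases Nat.le_iff_lt_or_eq.mp hp with h | rfl
      · exact hb'.le.trans (g1 p h hle)
      · exact le_rfl
    · simp only [Test.Holds, f1, f2, f3] at hb hb'
      rw [f3]
      refine ⟨fun p hp hle => ?_, g2⟩
      rcases Nat.lt_succ_iff_lt_or_eq.mp hp with h | rfl
      · exact g1 p h hle
      · exact not_lt.mp hb'
    · simp only [Test.Holds, f1, f2] at hb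
      rw [f3]
      refine ⟨fun p hp hle => ?_, g2⟩
      rcases Nat.lt_succ_iff_lt_or_eq.mp hp with h | rfl
      · exact g1 p h hle
      · exact absurd hle hb
    · intro s₄ hf₄ h₄
      have k1 : s₄.realReg 17 = b k := by rw [hf₄.real 17 (by decide), f1]
      have k2 : s₄.realReg 14 = s.realReg 14 := by rw [hf₄.real 14 (by decide), f2]
      have k3 : s₄.realReg 16 = s₂.realReg 16 := by rw [hf₄.real 16 (by decide), f4]
      have k4 : s₄.realReg 12 = 0 := by rw [hf₄.real 12 (by decide), f5]
      refine Halts.ite (T := 3) (fun hb => Halts.ite (T := 2)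
        (fun hb' => Halts.block (l := [_]) ⟨?_, ?_⟩)
        (fun hb' => (Halts.skip ⟨?_, ?_⟩).mono (by norm_num) fun _ _ h => h))
        (fun hb => (Halts.skip ⟨?_, ?_⟩).mono (by norm_num) fun _ _ h => h)
      · simpa [exec, incr, Instr.apply] using h₄
      · simp only [Test.Holds, k1, k2, k3] at hb hb'
        simp [exec, incr, Instr.apply, k1, k4]
        refine ⟨fun p hp hle => ?_, Or.inr ⟨k, hk, rfl, hb⟩⟩
        rcases Nat.le_iff_lt_or_eq.mp hp with h | rfl
        · exact (g3 p h hle).trans hb'.le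
        · exact le_rfl
      · simpa [exec, incr, Instr.apply] using h₄
      · simp only [Test.Holds, k1, k2, k3] at hb hb'
        simp only [exec, incr, Instr.apply, k3]
        refine ⟨fun p hp hle => ?_, g4⟩
        rcases Nat.lt_succ_iff_lt_or_eq.mp hp with h | rfl
        · exact g3 p h hle
        · exact not_lt.mp hb'
      · simpa [exec, incr, Instr.apply] using h₄
      · simp only [Test.Holds, k1, k2] at hb
        simp only [exec, incr, Instr.apply, k3]
        refine ⟨fun p hp hle => ?_, g4⟩
        rcases Nat.lt_succ_iff_lt_or_eq.mp hp with h | rfl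
        · exact g3 p h hle
        · exact absurd hle hb
  · rintro s' - ⟨⟨h1, h2⟩, ⟨h3, h4⟩⟩
    exact ⟨h1, h2, h3, h4⟩

/-- The items of the first `k` points have been stored from address `3 n + 2` on. -/
structure ItemInv (n : ℕ) (x y b : ℕ → ℝ) (Z : ℝ) (k : ℕ) (s : State) : Prop where
  centre : ∀ e < 3 * k, s.natMem (3 * n + 2 + e) < n
  bound : ∀ e < 3 * k, -(2 * Z * Z) - Z ≤ s.realMem (3 * n + 2 + e)
  own : ∀ i < k, s.realMem (3 * n + 2 + 3 * i) = x i + 2 * Z * b i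
  item : ∀ i < k, ∀ p < n, |y i - y p| ≤ 1 → ∃ e < 3 * k, s.natMem (3 * n + 2 + e) = i ∧
    s.realMem (3 * n + 2 + e) = x i + 2 * Z * b p

/-- Stores the item whose centre is in register `10` and whose strip has the base in real
register `ρ`. -/
def emit (ρ : ℕ) : List Instr :=
  [.realMul 18 1 ρ, .realAdd 18 13 18, .realStore 14 18, .natStore 14 10, .natAdd 14 14 1]

/-- Stores all items. -/
def itemProg : Program :=
  .seq (block [.natConst 15 0, .natAdd 14 5 15])
    (forUpto 10 0 (.seq (block [.natAdd 12 10 10, .realLoad 13 12, .natAdd 12 2 10,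
        .realLoad 14 12])
      (.seq neighbourProg (block (emit 14 ++ emit 15 ++ emit 16)))))

/-- The first item of every triple has the key of its own point, so this area also serves as the
list of point keys. If a neighbouring strip is missing, its item has the sentinel ±Z as base; this
is harmless, since its centre is still an input point and its key obeys the lower bound. -/
theorem itemProg_spec {n : ℕ} {Z : ℝ} {x y b : ℕ → ℝ} {s : State} (hc : Consts n Z s)
    (hB : Bases n y b Z) (hxZ : ∀ i < n, |x i| + 10 ≤ Z)
    (hx : ∀ i < n, s.realMem (i + i) = x i)
    (hb : ∀ i < n, s.realMem (2 * n + 2 + i) = b i) :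
    Halts itemProg s (n * (n * 20 + 31) + 5) fun s' =>
      (∀ a < 3 * n + 2, s'.realMem a = s.realMem a) ∧
      (∀ a < 3 * n + 2, s'.natMem a = s.natMem a) ∧
      (∀ a, 6 * n + 2 ≤ a → s'.natMem a = s.natMem a) ∧ ItemInv n x y b Z n s' := by
  refine (Halts.seq (T' := n * ((n * 20 + 27) + 4) + 2) (Halts.block (Q := fun s' =>
    s'.natReg 14 = 3 * n + 2 ∧ s'.natReg 0 = n) ?_)
    fun s₁ hf₁ h₁ => ?_).mono (by simp; nlinarith) fun _ _ h => h
  · simp [exec, Instr.apply, hc.r5, hc.r0]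
  obtain ⟨h0, h1⟩ := h₁
  have hc₁ : Consts n Z s₁ := hc.framed hf₁ (by unfold KeepsConsts; decide)
  have hmem₁ : s₁.realMem = s.realMem := hf₁.realMem (by decide)
  have hnmem₁ : s₁.natMem = s.natMem := hf₁.natMem (by decide)
  refine (Halts.forUpto (c := n * 20 + 27) (fun k s' => s'.natReg 14 = 3 * n + 2 + 3 * k ∧
      (∀ a < 3 * n + 2, s'.realMem a = s.realMem a) ∧
      (∀ a < 3 * n + 2, s'.natMem a = s.natMem a) ∧
      (∀ a, 6 * n + 2 ≤ a → s'.natMem a = s.natMem a) ∧ ItemInv n x y b Z k s')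
    h1 (by decide) (by decide)
    (by decide) (by decide) (by decide) ?_ ?_).mono le_rfl ?_
  · simp only [Instr.apply]
    refine ⟨by simp [h0], fun a _ => by rw [hmem₁], fun a _ => by rw [hnmem₁],
      fun a _ => by rw [hnmem₁], ?_⟩
    constructor <;> intro e he <;> omega
  · rintro k s₂ hk hik hf ⟨g1, g2, g3, g5, g4⟩
    have hc₂ : Consts n Z s₂ := hc₁.framed hf (by unfold KeepsConsts; decide)
    have ex : s₂.realMem (k + k) = x k := by rw [g2 _ (by omega), hx k hk]
    have eb : s₂.realMem (2 * n + 2 + k) = b k := by rw [g2 _ (by omega), hb k hk]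
    refine (Halts.seq (T := 5) (T' := n * 20 + 22) (Halts.block (l := [_, _, _, _]) (Q := fun s' =>
      s'.realReg 13 = x k ∧ s'.realReg 14 = b k) ?_)
      fun s₃ hf₃ h₃ => ?_).mono (by omega) fun _ _ h => h
    · simp [exec, Instr.apply, hik, ex, eb, hc₂.r2]
    obtain ⟨e1, e2⟩ := h₃
    have hc₃ : Consts n Z s₃ := hc₂.framed hf₃ (by unfold KeepsConsts; decide)
    have hmem₃ : s₃.realMem = s₂.realMem := hf₃.realMem (by decide)
    refine (Halts.seq (T := n * 20 + 6) (T' := 16) (neighbourProg_spec (b := b) hc₃ ?_)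
      fun s₄ hf₄ hN => ?_).mono (by omega) fun _ _ h => h
    · intro i hi
      rw [hmem₃, g2 _ (by omega), hb i hi]
    rw [e2] at hN
    have hc₄ : Consts n Z s₄ := hc₃.framed hf₄ (by unfold KeepsConsts; decide)
    have f1 : s₄.realReg 13 = x k := by rw [hf₄.real 13 (by decide), e1]
    have f2 : s₄.realReg 14 = b k := by rw [hf₄.real 14 (by decide), e2]
    have f3 : s₄.natReg 14 = 3 * n + 2 + 3 * k := by
      rw [hf₄.nat 14 (by decide), hf₃.nat 14 (by decide), g1]
    have f4 : s₄.natReg 10 = k := by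
      rw [hf₄.nat 10 (by decide), hf₃.nat 10 (by decide), hik]
    have f5 : s₄.realMem = s₂.realMem := by rw [hf₄.realMem (by decide), hmem₃]
    have f6 : s₄.natMem = s₂.natMem := by
      rw [hf₄.natMem (by decide), hf₃.natMem (by decide)]
    set u := s₄.realReg 15 with hu
    set v := s₄.realReg 16 with hv
    refine Halts.block (l := emit 14 ++ emit 15 ++ emit 16) ?_
    obtain ⟨s₅, hs₅⟩ : ∃ s₅, exec (incr 10) (exec (emit 14 ++ emit 15 ++ emit 16) s₄) = s₅ :=
      ⟨_, rfl⟩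
    have hnat : s₅.natReg 14 = 3 * n + 2 + 3 * (k + 1) := by
      rw [← hs₅]
      simp [exec, incr, emit, Instr.apply, f3, hc₄.r1]
      ring
    have hreal : s₅.realMem = Function.update (Function.update (Function.update s₂.realMem
        (3 * n + 2 + 3 * k) (x k + 2 * Z * b k)) (3 * n + 2 + 3 * k + 1) (x k + 2 * Z * u))
        (3 * n + 2 + 3 * k + 1 + 1) (x k + 2 * Z * v) := by
      rw [← hs₅]
      simp [exec, incr, emit, Instr.apply, f1, f2, f3, f5, hc₄.r1, hc₄.z1, hu, hv]
    have hmem : s₅.natMem = Function.update (Function.update (Function.update s₂.natMem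
        (3 * n + 2 + 3 * k) k) (3 * n + 2 + 3 * k + 1) k)
        (3 * n + 2 + 3 * k + 1 + 1) k := by
      rw [← hs₅]
      simp [exec, incr, emit, Instr.apply, f3, f4, f6, hc₄.r1]
    rw [hs₅]
    clear_value u v
    have old_real : ∀ a < 3 * n + 2 + 3 * k, s₅.realMem a = s₂.realMem a := by
      intro a ha
      rw [hreal, Function.update_of_ne (by omega), Function.update_of_ne (by omega),
        Function.update_of_ne (by omega)]
    have old_nat : ∀ a < 3 * n + 2 + 3 * k, s₅.natMem a = s₂.natMem a := by
      intro a ha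
      rw [hmem, Function.update_of_ne (by omega), Function.update_of_ne (by omega),
        Function.update_of_ne (by omega)]
    have n0 : s₅.natMem (3 * n + 2 + 3 * k) = k := by
      rw [hmem, Function.update_of_ne (by omega), Function.update_of_ne (by omega),
        Function.update_self]
    have n1 : s₅.natMem (3 * n + 2 + (3 * k + 1)) = k := by
      rw [hmem, Function.update_of_ne (by omega), ← add_assoc, Function.update_self]
    have n2 : s₅.natMem (3 * n + 2 + (3 * k + 2)) = k := by
      rw [hmem, show 3 * n + 2 + (3 * k + 2) = 3 * n + 2 + 3 * k + 1 + 1 by ring,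
        Function.update_self]
    have r0 : s₅.realMem (3 * n + 2 + 3 * k) = x k + 2 * Z * b k := by
      rw [hreal, Function.update_of_ne (by omega), Function.update_of_ne (by omega),
        Function.update_self]
    have r1 : s₅.realMem (3 * n + 2 + (3 * k + 1)) = x k + 2 * Z * u := by
      rw [hreal, Function.update_of_ne (by omega), ← add_assoc, Function.update_self]
    have r2 : s₅.realMem (3 * n + 2 + (3 * k + 2)) = x k + 2 * Z * v := by
      rw [hreal, show 3 * n + 2 + (3 * k + 2) = 3 * n + 2 + 3 * k + 1 + 1 by ring,
        Function.update_self]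
    have hZ : 0 < Z := by have := hxZ k hk; have := abs_nonneg (x k); linarith
    have hbound : ∀ β, -Z ≤ β → -(2 * Z * Z) - Z ≤ x k + 2 * Z * β := by
      intro β hβ
      have h1 := hxZ k hk
      have h2 := neg_abs_le (x k)
      nlinarith
    have hbZ : ∀ p < n, -Z ≤ b p := fun p hp => (abs_lt.mp (hB.abs_base_lt hp)).1.le
    have huZ : -Z ≤ u := by
      rcases hN.next with h | ⟨p, hp, h, -⟩
      · rw [h]; linarith
      · rw [← h]; exact hbZ p hp
    have hvZ : -Z ≤ v := by
      rcases hN.prev with h | ⟨p, hp, h, -⟩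
      · exact h.ge
      · rw [← h]; exact hbZ p hp
    have cases3 : ∀ e < 3 * (k + 1), e < 3 * k ∨ e = 3 * k ∨ e = 3 * k + 1 ∨ e = 3 * k + 2 := by
      intro e he; omega
    refine ⟨hnat, fun a ha => by rw [old_real a (by omega), g2 a ha],
      fun a ha => by rw [old_nat a (by omega), g3 a ha], fun a ha => ?_, ?_, ?_, ?_, ?_⟩
    · rw [hmem, Function.update_of_ne (by omega), Function.update_of_ne (by omega),
        Function.update_of_ne (by omega), g5 a ha]
    · intro e he
      rcases cases3 e he with h | rfl | rfl | rfl
      · rw [old_nat _ (by omega)]; exact g4.centre e h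
      · rwa [n0]
      · rwa [n1]
      · rwa [n2]
    · intro e he
      rcases cases3 e he with h | rfl | rfl | rfl
      · rw [old_real _ (by omega)]; exact g4.bound e h
      · rw [r0]; exact hbound _ (hbZ k hk)
      · rw [r1]; exact hbound _ huZ
      · rw [r2]; exact hbound _ hvZ
    · intro i hi
      rcases Nat.lt_succ_iff_lt_or_eq.mp hi with h | rfl
      · rw [old_real _ (by omega)]; exact g4.own i h
      · exact r0
    · intro i hi p hp hip
      rcases Nat.lt_succ_iff_lt_or_eq.mp hi with h | rfl
      · obtain ⟨e, he, q1, q2⟩ := g4.item i h p hp hip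
        exact ⟨e, by omega, by rw [old_nat _ (by omega), q1], by rw [old_real _ (by omega), q2]⟩
      · rcases hB.eq_or_eq_of_abs_le hk hp hN hip with h | h | h
        · exact ⟨3 * i, by omega, n0, by rw [r0, h]⟩
        · exact ⟨3 * i + 1, by omega, n1, by rw [r1, h]⟩
        · exact ⟨3 * i + 2, by omega, n2, by rw [r2, h]⟩
  · rintro s' - ⟨-, h1, h2, h3, h4⟩
    exact ⟨h1, h2, h3, h4⟩

end GeomMDS

namespace GeomMDS

/-! ### Sorting -/

/-- The comparison of the keys `k` which prefers the smaller index in the case of a tie. -/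
def Before (k : ℕ → ℝ) (e f : ℕ) : Prop := k e < k f ∨ (k e = k f ∧ e < f)

theorem Before.trans {k : ℕ → ℝ} {e f g : ℕ} (h : Before k e f) (h' : Before k f g) :
    Before k e g := by
  unfold Before at *
  rcases h with h | ⟨h, h1⟩ <;> rcases h' with h' | ⟨h', h1'⟩
  · exact Or.inl (h.trans h')
  · exact Or.inl (h.trans_eq h')
  · exact Or.inl (h.trans_lt h')
  · exact Or.inr ⟨h.trans h', h1.trans h1'⟩

theorem Before.irrefl (k : ℕ → ℝ) (e : ℕ) : ¬ Before k e e := by simp [Before]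

theorem Before.total (k : ℕ → ℝ) (e f : ℕ) : Before k e f ∨ e = f ∨ Before k f e := by
  unfold Before
  rcases lt_trichotomy (k e) (k f) with h | h | h
  · exact Or.inl (Or.inl h)
  · rcases lt_trichotomy e f with h' | h' | h'
    · exact Or.inl (Or.inr ⟨h, h'⟩)
    · exact Or.inr (Or.inl h')
    · exact Or.inr (Or.inr (Or.inr ⟨h.symm, h'⟩))
  · exact Or.inr (Or.inr (Or.inl h))

theorem before_iff_of_lt {k : ℕ → ℝ} {e f : ℕ} (h : e < f) : Before k e f ↔ k e ≤ k f := by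
  unfold Before
  rw [le_iff_lt_or_eq]
  tauto

theorem before_iff_of_not_lt {k : ℕ → ℝ} {e f : ℕ} (h : ¬ e < f) : Before k e f ↔ k e < k f := by
  unfold Before
  tauto

open Classical in
/-- The number of keys among the first `N` before the key of `e`. -/
noncomputable def rankOf (k : ℕ → ℝ) (N e : ℕ) : ℕ :=
  ((Finset.range N).filter fun f => Before k f e).card

theorem rankOf_succ_of_before {k : ℕ → ℝ} {N e : ℕ} (h : Before k N e) :
    rankOf k (N + 1) e = rankOf k N e + 1 := by
  unfold rankOf
  rw [Finset.range_add_one, Finset.filter_insert, if_pos h, Finset.card_insert_of_notMem (by simp)]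

theorem rankOf_succ_of_not_before {k : ℕ → ℝ} {N e : ℕ} (h : ¬ Before k N e) :
    rankOf k (N + 1) e = rankOf k N e := by
  unfold rankOf
  rw [Finset.range_add_one, Finset.filter_insert, if_neg h]

/-- Breaking ties by the index makes the order strict and total, so ranks are distinct and may be
used as storage places. -/
theorem rankOf_lt_of_before {k : ℕ → ℝ} {N e f : ℕ} (he : e < N) (h : Before k e f) :
    rankOf k N e < rankOf k N f := by
  classical
  unfold rankOf
  refine Finset.card_lt_card ?_
  rw [Finset.ssubset_iff_of_subset]
  · exact ⟨e, Finset.mem_filter.mpr ⟨Finset.mem_range.mpr he, h⟩,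
      fun hcon => Before.irrefl k e (Finset.mem_filter.mp hcon).2⟩
  · intro g hg
    obtain ⟨h1, h2⟩ := Finset.mem_filter.mp hg
    exact Finset.mem_filter.mpr ⟨h1, h2.trans h⟩

theorem rankOf_injOn (k : ℕ → ℝ) {N e f : ℕ} (he : e < N) (hf : f < N)
    (h : rankOf k N e = rankOf k N f) : e = f := by
  rcases Before.total k e f with h' | h' | h'
  · exact absurd h (rankOf_lt_of_before he h').ne
  · exact h'
  · exact absurd h.symm (rankOf_lt_of_before hf h').ne

theorem rankOf_lt (k : ℕ → ℝ) {N e : ℕ} (he : e < N) : rankOf k N e < N := by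
  classical
  have : rankOf k N e < (Finset.range N).card := by
    unfold rankOf
    refine Finset.card_lt_card ?_
    rw [Finset.ssubset_iff_of_subset (Finset.filter_subset _ _)]
    exact ⟨e, Finset.mem_range.mpr he, fun hcon => Before.irrefl k e (Finset.mem_filter.mp hcon).2⟩
  simpa using this

theorem le_of_rankOf_le {k : ℕ → ℝ} {N e f : ℕ} (hf : f < N)
    (h : rankOf k N e ≤ rankOf k N f) : k e ≤ k f := by
  by_contra! hcon
  have := rankOf_lt_of_before (k := k) (N := N) hf (Or.inl hcon : Before k f e)
  omega

theorem exists_rankOf_eq (k : ℕ → ℝ) {N r : ℕ} (hr : r < N) : ∃ e < N, rankOf k N e = r := by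
  have h := Finset.surj_on_of_inj_on_of_card_le (s := Finset.range N) (t := Finset.range N)
    (fun e _ => rankOf k N e) (fun e he =>
      Finset.mem_range.mpr (rankOf_lt k (Finset.mem_range.mp he)))
    (fun e f he hf h => rankOf_injOn k (Finset.mem_range.mp he) (Finset.mem_range.mp hf) h) le_rfl r
    (Finset.mem_range.mpr hr)
  obtain ⟨e, he, h⟩ := h
  exact ⟨e, Finset.mem_range.mp he, h.symm⟩

/-- Computes in register `14` the place of the item in register `10`, with key in real
register `13`. -/
def placeProg : Program :=
  forUpto 11 3 (.seq (block [.natAdd 12 5 11, .realLoad 14 12])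
    (.ifThenElse (.natLt 11 10)
      (.ifThenElse (.realLe 14 13) (block [.natAdd 14 14 1]) .skip)
      (.ifThenElse (.realLt 14 13) (block [.natAdd 14 14 1]) .skip)))

/-- Sorts the items by their keys; the sorted list begins with a dummy. -/
def sortProg : Program :=
  .seq (block [.realConst 12 2, .realAdd 12 12 1, .realMul 12 12 0, .realConst 13 0,
      .realSub 12 13 12, .realStore 6 12, .natStore 6 0])
    (forUpto 10 3 (.seq (block [.natAdd 12 5 10, .realLoad 13 12, .natLoad 15 12, .natAdd 14 6 1])
      (.seq placeProg (block [.natStore 14 15, .realStore 14 13]))))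

theorem placeProg_spec {n e : ℕ} {Z : ℝ} {k : ℕ → ℝ} {s : State} (hc : Consts n Z s)
    (hk : ∀ f < 3 * n, s.realMem (3 * n + 2 + f) = k f) (he : s.natReg 10 = e)
    (hke : s.realReg 13 = k e) :
    Halts placeProg s (3 * n * 11 + 2) fun s' =>
      s'.natReg 14 = s.natReg 14 + rankOf k (3 * n) e := by
  refine Halts.forUpto (c := 7) (fun i s' => s'.natReg 14 = s.natReg 14 + rankOf k i e)
    hc.r3 (by decide) (by decide) (by decide) (by decide) (by decide) ?_ ?_
  · simp [Instr.apply, rankOf]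
  · rintro i s₂ hi hik hf g1
    have e1 : s₂.natReg 5 = 3 * n + 2 := by rw [hf.nat 5 (by decide), hc.r5]
    have e2 : s₂.natReg 1 = 1 := by rw [hf.nat 1 (by decide), hc.r1]
    have e3 : s₂.natReg 10 = e := by rw [hf.nat 10 (by decide), he]
    have e4 : s₂.realReg 13 = k e := by rw [hf.real 13 (by decide), hke]
    have e5 : s₂.realMem (3 * n + 2 + i) = k i := by rw [hf.realMem (by decide), hk i hi]
    refine Halts.seq (T := 3) (T' := 4) (Halts.block (l := [_, _]) (Q := fun s' =>
      s'.realReg 14 = k i ∧ s'.realReg 13 = k e ∧ s'.natReg 11 = i ∧ s'.natReg 10 = e ∧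
      s'.natReg 14 = s.natReg 14 + rankOf k i e ∧ s'.natReg 1 = 1) ?_)
      fun s₃ hf₃ h₃ => ?_
    · simp [exec, Instr.apply, hik, e1, e2, e3, e4, e5, g1]
    obtain ⟨f1, f2, f3, f4, f5, f6⟩ := h₃
    refine Halts.ite (T := 3) (fun hb => Halts.ite (T := 2)
        (fun hb' => Halts.block (l := [_]) ?_)
        (fun hb' => (Halts.skip ?_).mono (by norm_num) fun _ _ h => h))
      (fun hb => Halts.ite (T := 2) (fun hb' => Halts.block (l := [_]) ?_)
        (fun hb' => (Halts.skip ?_).mono (by norm_num) fun _ _ h => h))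
    all_goals
      simp only [Test.Holds, f1, f2, f3, f4] at hb hb'
      simp only [exec, incr, Instr.apply]
    · rw [rankOf_succ_of_before ((before_iff_of_lt hb).mpr hb')]
      simp [f5, f6, add_assoc]
    · rw [rankOf_succ_of_not_before (mt (before_iff_of_lt hb).mp hb')]
      simp [f5]
    · rw [rankOf_succ_of_before ((before_iff_of_not_lt hb).mpr hb')]
      simp [f5, f6, add_assoc]
    · rw [rankOf_succ_of_not_before (mt (before_iff_of_not_lt hb).mp hb')]
      simp [f5]

/-- Sorting by counting ranks takes quadratic time, negligible here. Places are shifted by 1 to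
leave room for the dummy, with centre `n` and key −2Z² − 2Z, which is below the lower bound −2Z² − Z
of the other keys by `Z`. -/
theorem sortProg_spec {n : ℕ} {Z : ℝ} {k : ℕ → ℝ} {c : ℕ → ℕ} {s : State} (hc : Consts n Z s)
    (hk : ∀ f < 3 * n, s.realMem (3 * n + 2 + f) = k f)
    (hcen : ∀ f < 3 * n, s.natMem (3 * n + 2 + f) = c f) :
    Halts sortProg s (3 * n * (3 * n * 11 + 14) + 10) fun s' =>
      (∀ a < 6 * n + 2, s'.realMem a = s.realMem a) ∧
      (∀ a < 6 * n + 2, s'.natMem a = s.natMem a) ∧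
      (∀ a, 9 * n + 3 ≤ a → s'.natMem a = s.natMem a) ∧
      s'.realMem (6 * n + 2) = -((2 * Z + 2) * Z) ∧ s'.natMem (6 * n + 2) = n ∧
      ∀ e < 3 * n, s'.realMem (6 * n + 2 + (rankOf k (3 * n) e + 1)) = k e ∧
        s'.natMem (6 * n + 2 + (rankOf k (3 * n) e + 1)) = c e := by
  refine (Halts.seq (T := 8) (T' := 3 * n * ((3 * n * 11 + 10) + 4) + 2)
    (Halts.block (l := [_, _, _, _, _, _, _]) (Q := fun s' =>
    s'.realMem = Function.update s.realMem (6 * n + 2) (-((2 * Z + 2) * Z)) ∧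
    s'.natMem = Function.update s.natMem (6 * n + 2) n) ?_)
    fun s₁ hf₁ h₁ => ?_).mono (by rw [show 3 * n * 11 + 10 + 4 = 3 * n * 11 + 14 from rfl]; omega)
      fun _ _ h => h
  · simp [exec, Instr.apply, hc.r6, hc.r0, hc.z0, hc.z1]
    congr 1
    ring
  obtain ⟨h0, h1⟩ := h₁
  have hc₁ : Consts n Z s₁ := hc.framed hf₁ (by unfold KeepsConsts; decide)
  refine (Halts.forUpto (c := 3 * n * 11 + 10) (fun i s' =>
      (∀ a < 6 * n + 3, s'.realMem a = s₁.realMem a) ∧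
      (∀ a < 6 * n + 3, s'.natMem a = s₁.natMem a) ∧
      (∀ a, 9 * n + 3 ≤ a → s'.natMem a = s₁.natMem a) ∧
      ∀ e < i, s'.realMem (6 * n + 2 + (rankOf k (3 * n) e + 1)) = k e ∧
        s'.natMem (6 * n + 2 + (rankOf k (3 * n) e + 1)) = c e)
    hc₁.r3 (by decide) (by decide)
    (by decide) (by decide) (by decide) ?_ ?_).mono le_rfl ?_
  · simp [Instr.apply]
  · rintro i s₂ hi hik hf ⟨g1, g2, g4, g3⟩
    have hc₂ : Consts n Z s₂ := hc₁.framed hf (by unfold KeepsConsts; decide)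
    have hk₂ : ∀ f < 3 * n, s₂.realMem (3 * n + 2 + f) = k f := by
      intro f hf
      rw [g1 _ (by omega), h0, Function.update_of_ne (by omega), hk f hf]
    have hcen₂ : s₂.natMem (3 * n + 2 + i) = c i := by
      rw [g2 _ (by omega), h1, Function.update_of_ne (by omega), hcen i hi]
    refine (Halts.seq (T := 5) (T' := 3 * n * 11 + 5) (Halts.block (l := [_, _, _, _])
      (Q := fun s' => s'.realReg 13 = k i ∧ s'.natReg 15 = c i ∧ s'.natReg 14 = 6 * n + 2 + 1) ?_)
      fun s₃ hf₃ h₃ => ?_).mono (by omega) fun _ _ h => h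
    · simp [exec, Instr.apply, hik, hk₂ i hi, hcen₂, hc₂.r5, hc₂.r6, hc₂.r1]
    obtain ⟨e1, e2, e3⟩ := h₃
    have hc₃ : Consts n Z s₃ := hc₂.framed hf₃ (by unfold KeepsConsts; decide)
    have hmem₃ : s₃.realMem = s₂.realMem := hf₃.realMem (by decide)
    refine (Halts.seq (T := 3 * n * 11 + 2) (T' := 3) (placeProg_spec (k := k) (e := i) hc₃
      (by rw [hmem₃]; exact hk₂) (by rw [hf₃.nat 10 (by decide), hik]) e1)
      fun s₄ hf₄ h₄ => ?_).mono (by omega) fun _ _ h => h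
    rw [e3] at h₄
    have f1 : s₄.realReg 13 = k i := by rw [hf₄.real 13 (by decide), e1]
    have f2 : s₄.natReg 15 = c i := by rw [hf₄.nat 15 (by decide), e2]
    have f5 : s₄.realMem = s₂.realMem := by rw [hf₄.realMem (by decide), hmem₃]
    have f6 : s₄.natMem = s₂.natMem := by
      rw [hf₄.natMem (by decide), hf₃.natMem (by decide)]
    refine Halts.block (l := [_, _]) ?_
    obtain ⟨s₅, hs₅⟩ : ∃ s₅, exec (incr 10) (exec [.natStore 14 15, .realStore 14 13] s₄) = s₅ :=
      ⟨_, rfl⟩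
    have hreal : s₅.realMem = Function.update s₂.realMem
        (6 * n + 2 + (rankOf k (3 * n) i + 1)) (k i) := by
      rw [← hs₅]
      simp [exec, incr, Instr.apply, f1, f5, h₄]
      congr 1
      ring
    have hmem : s₅.natMem = Function.update s₂.natMem
        (6 * n + 2 + (rankOf k (3 * n) i + 1)) (c i) := by
      rw [← hs₅]
      simp [exec, incr, Instr.apply, f2, f6, h₄]
      congr 1
      ring
    rw [hs₅]
    have hrank := rankOf_lt k hi
    refine ⟨fun a ha => ?_, fun a ha => ?_, fun a ha => ?_, fun e he => ?_⟩
    · rw [hreal, Function.update_of_ne (by omega), g1 a ha]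
    · rw [hmem, Function.update_of_ne (by omega), g2 a ha]
    · rw [hmem, Function.update_of_ne (by omega), g4 a ha]
    · rcases Nat.lt_succ_iff_lt_or_eq.mp he with h | rfl
      · have hne : rankOf k (3 * n) e ≠ rankOf k (3 * n) i := by
          intro hcon
          have := rankOf_injOn k (show e < 3 * n by omega) hi hcon
          omega
        rw [hreal, hmem, Function.update_of_ne (by omega), Function.update_of_ne (by omega)]
        exact g3 e h
      · rw [hreal, hmem, Function.update_self, Function.update_self]
        exact ⟨rfl, rfl⟩
  · rintro s' - ⟨k1, k2, k4, k3⟩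
    refine ⟨fun a ha => ?_, fun a ha => ?_, fun a ha => ?_, ?_, ?_, k3⟩
    · rw [k1 a (by omega), h0, Function.update_of_ne (by omega)]
    · rw [k2 a (by omega), h1, Function.update_of_ne (by omega)]
    · rw [k4 a ha, h1, Function.update_of_ne (by omega)]
    · rw [k1 _ (by omega), h0, Function.update_self]
    · rw [k2 _ (by omega), h1, Function.update_self]

end GeomMDS

namespace GeomMDS

/-! ### The preprocessing as a whole -/

/-- The state `s` holds the data `D`. -/
structure Loaded (D : StripData) (Z : ℝ) (s : State) : Prop where
  consts : Consts D.n Z s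
  memX : ∀ c ≤ D.n, s.realMem (c + c) = D.X c
  memY : ∀ c ≤ D.n, s.realMem (c + c + 1) = D.Y c
  memPK : ∀ i < D.n, s.realMem (3 * D.n + 2 + i + i + i) = D.PK i
  memC : ∀ r < D.B, s.natMem (6 * D.n + 2 + r) = D.C r
  memK : ∀ r < D.B, s.realMem (6 * D.n + 2 + r) = D.K r

theorem Loaded.congr {D : StripData} {Z : ℝ} {s s' : State} (h : Loaded D Z s)
    (hc : Consts D.n Z s') (h1 : s'.realMem = s.realMem)
    (h2 : ∀ a < 9 * D.n + 3, s'.natMem a = s.natMem a) : Loaded D Z s' := by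
  refine ⟨hc, ?_, ?_, ?_, ?_, ?_⟩
  · rw [h1]; exact h.memX
  · rw [h1]; exact h.memY
  · rw [h1]; exact h.memPK
  · intro r hr
    rw [h2 _ (by unfold StripData.B at hr; omega), h.memC r hr]
  · rw [h1]; exact h.memK

/-- The properties of the data that the dynamic program relies on. -/
structure Ready (D : StripData) (Z : ℝ) : Prop where
  valid : ∃ b, D.Valid b Z
  centre_zero : D.C 0 = D.n
  not_cov : ∀ i < D.n, ¬ D.Cov D.n i
  lt_key : ∀ i < D.n, D.K 0 + 1 < D.PK i

/-- Everything that precedes the dynamic program. -/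
def prepProg : Program :=
  .seq boundProg (.seq constProg (.seq baseProg (.seq itemProg sortProg)))

theorem prepProg_spec {n : ℕ} {x y : ℕ → ℝ} {s : State} (hn : s.natReg 0 = n)
    (hx : ∀ i < n, s.realMem (i + i) = x i) (hy : ∀ i < n, s.realMem (i + i + 1) = y i)
    (h0 : s.realMem (n + n) = 0) (hnat : s.natMem = fun _ => 0) :
    Halts prepProg s (500 * (3 * n + 1) ^ 2) fun s' => ∃ D Z, D.n = n ∧
      (∀ i < n, D.X i = x i ∧ D.Y i = y i) ∧ Loaded D Z s' ∧ Ready D Z ∧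
      (∀ a < n, s'.natMem a = 0) ∧ ∀ a, 9 * n + 3 ≤ a → s'.natMem a = 0 := by
  have htime : n * 15 + 6 + (14 + (n * (n * 24 + 20) + 10 + (n * (n * 20 + 31) + 5 +
      (3 * n * (3 * n * 11 + 14) + 10)))) ≤ 500 * (3 * n + 1) ^ 2 := by
    have e1 : n * (n * 24 + 20) = 24 * (n * n) + 20 * n := by ring
    have e2 : n * (n * 20 + 31) = 20 * (n * n) + 31 * n := by ring
    have e3 : 3 * n * (3 * n * 11 + 14) = 99 * (n * n) + 42 * n := by ring
    have e4 : (3 * n + 1) ^ 2 = 9 * (n * n) + 6 * n + 1 := by ring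
    rw [e1, e2, e3, e4]
    generalize n * n = q
    omega
  refine (Halts.seq (T := n * 15 + 6) (T' := 14 + (n * (n * 24 + 20) + 10 +
    (n * (n * 20 + 31) + 5 + (3 * n * (3 * n * 11 + 14) + 10)))) (boundProg_spec hn hx hy)
    fun s₁ hf₁ h₁ => ?_).mono htime fun _ _ h => h
  obtain ⟨a1, a2, a3, a4⟩ := h₁
  have hn₁ : s₁.natReg 0 = n := by rw [hf₁.nat 0 (by decide), hn]
  have hnm₁ : s₁.natMem = fun _ => 0 := by rw [hf₁.natMem (by decide), hnat]
  have hrm₁ : s₁.realMem = s.realMem := hf₁.realMem (by decide)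
  obtain ⟨Z, hZ⟩ : ∃ Z, s₁.realReg 0 = Z := ⟨_, rfl⟩
  rw [hZ] at a3 a4
  refine Halts.seq (constProg_spec hn₁ a1 a2) fun s₂ hf₂ h₂ => ?_
  rw [hZ, hrm₁, hnm₁] at h₂
  obtain ⟨hc₂, hnm₂, hrm₂⟩ := h₂
  have hx₂ : ∀ i < n, s₂.realMem (i + i) = x i := by
    intro i hi
    rw [hrm₂, Function.update_of_ne (by omega), hx i hi]
  have hy₂ : ∀ i < n, s₂.realMem (i + i + 1) = y i := by
    intro i hi
    rw [hrm₂, Function.update_of_ne (by omega), hy i hi]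
  have hd₂ : s₂.realMem (n + n) = 0 := by rw [hrm₂, Function.update_of_ne (by omega), h0]
  have hd₂' : s₂.realMem (n + n + 1) = Z := by rw [hrm₂, Function.update_self]
  refine Halts.seq (baseProg_spec hc₂ hy₂ (fun i hi => (a4 i hi).2) (by linarith))
    fun s₃ hf₃ h₃ => ?_
  obtain ⟨b1, cur, hcur, hbase⟩ := h₃
  have hc₃ : Consts n Z s₃ := hc₂.framed hf₃ (by unfold KeepsConsts; decide)
  have hnm₃ : s₃.natMem = fun _ => 0 := by rw [hf₃.natMem (by decide), hnm₂]
  obtain ⟨b, hb⟩ : ∃ b, b = fun p => s₃.realMem (2 * n + 2 + p) := ⟨_, rfl⟩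
  rw [← hb] at hbase
  have hB : Bases n y b Z := by
    refine ⟨fun i hi => (a4 i hi).2, fun i hi => (hbase.base i hi (hcur i hi)).1,
      fun i hi => (hbase.base i hi (hcur i hi)).2.1, fun i hi j hj => ?_⟩
    exact hbase.sep i hi j hj (hcur i hi) (hcur j hj)
  refine Halts.seq (itemProg_spec (x := x) hc₃ hB (fun i hi => (a4 i hi).1)
    (fun i hi => by rw [b1 _ (by omega), hx₂ i hi]) (fun i hi => by rw [hb]))
    fun s₄ hf₄ h₄ => ?_
  obtain ⟨c1, c2, c3, c4⟩ := h₄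
  have hc₄ : Consts n Z s₄ := hc₃.framed hf₄ (by unfold KeepsConsts; decide)
  obtain ⟨k, hk⟩ : ∃ k, k = fun f => s₄.realMem (3 * n + 2 + f) := ⟨_, rfl⟩
  obtain ⟨c, hcc⟩ : ∃ c, c = fun f => s₄.natMem (3 * n + 2 + f) := ⟨_, rfl⟩
  refine (sortProg_spec (k := k) (c := c) hc₄ (by simp [hk]) (by simp [hcc])).mono le_rfl ?_
  rintro s₅ hf₅ ⟨d1, d2, d3, d4, d5, d6⟩
  have hc₅ : Consts n Z s₅ := hc₄.framed hf₅ (by unfold KeepsConsts; decide)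
  have hcoord : ∀ a < 2 * n + 2, s₅.realMem a = s₂.realMem a := by
    intro a ha
    rw [d1 a (by omega), c1 a (by omega), b1 a ha]
  -- Point `n` is the dummy centre (0, Z); as `Z` exceeds every ordinate by at least 10, it covers
  -- no input point.
  set D : StripData := ⟨n, fun c => if c < n then x c else 0, fun c => if c < n then y c else Z,
    fun i => x i + 2 * Z * b i, fun r => s₅.natMem (6 * n + 2 + r),
    fun r => s₅.realMem (6 * n + 2 + r)⟩ with hD
  have hDX : ∀ c < n, D.X c = x c := fun c hc => if_pos hc
  have hDY : ∀ c < n, D.Y c = y c := fun c hc => if_pos hc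
  have hDXn : D.X n = 0 := if_neg (lt_irrefl n)
  have hDYn : D.Y n = Z := if_neg (lt_irrefl n)
  have hrank : ∀ r, 1 ≤ r → r < D.B → ∃ e < 3 * n, r = rankOf k (3 * n) e + 1 ∧
      D.K r = k e ∧ D.C r = c e := by
    intro r h1 hr
    have hr' : r < 3 * n + 1 := hr
    obtain ⟨e, he, hre⟩ := exists_rankOf_eq k (N := 3 * n) (r := r - 1) (by omega)
    obtain rfl : r = rankOf k (3 * n) e + 1 := by omega
    exact ⟨e, he, rfl, (d6 e he).1, (d6 e he).2⟩
  have hkb : ∀ e < 3 * n, -(2 * Z * Z) - Z ≤ k e := by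
    intro e he
    rw [hk]
    exact c4.bound e he
  have hK0 : D.K 0 = -((2 * Z + 2) * Z) := d4
  have hkey : ∀ i < n, D.PK i = k (3 * i) := by
    intro i hi
    rw [hk]
    exact (c4.own i hi).symm
  refine ⟨D, Z, rfl, fun i hi => ⟨hDX i hi, hDY i hi⟩, ⟨hc₅, ?_, ?_, ?_, ?_, ?_⟩,
    ⟨⟨b, ?_, ?_, ?_, ?_, ?_, ?_, ?_, ?_, ?_⟩, d5, ?_, ?_⟩, ?_, ?_⟩
  · intro c hc
    have hc' : c ≤ n := hc
    rw [hcoord _ (by omega)]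
    rcases hc'.lt_or_eq with h | rfl
    · rw [hx₂ c h, hDX c h]
    · rw [hd₂, hDXn]
  · intro c hc
    have hc' : c ≤ n := hc
    rw [hcoord _ (by omega)]
    rcases hc'.lt_or_eq with h | rfl
    · rw [hy₂ c h, hDY c h]
    · rw [hd₂', hDYn]
  · intro i hi
    have hi' : i < n := hi
    rw [hkey i hi', hk]
    change s₅.realMem (3 * n + 2 + i + i + i) = _
    rw [d1 _ (by omega)]
    congr 1
    ring
  · exact fun r _ => rfl
  · exact fun r _ => rfl
  · intro i hi
    rw [hDX i hi]
    exact (a4 i hi).1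
  · intro i hi
    rw [hDY i hi]
    exact hB.base_le i hi
  · intro i hi
    rw [hDY i hi]
    exact hB.lt_base i hi
  · exact hB.sep
  · intro i hi
    rw [hDX i hi]
  · intro r h1 hr
    obtain ⟨e, he, -, -, h⟩ := hrank r h1 hr
    rw [h, hcc]
    exact c4.centre e he
  · intro r r' h1 hrr hr
    obtain ⟨e, he, h2, h3, -⟩ := hrank r h1 (by omega)
    obtain ⟨e', he', h2', h3', -⟩ := hrank r' (by omega) hr
    rw [h3, h3']
    exact le_of_rankOf_le he' (by omega)
  · intro r h1 hr
    obtain ⟨e, he, -, h, -⟩ := hrank r h1 hr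
    rw [h, hK0]
    nlinarith [hkb e he]
  · intro i hi p hp hcov
    have hip := hcov.abs_Y_le
    rw [hDY i hi, hDY p hp] at hip
    obtain ⟨e, he, q1, q2⟩ := c4.item i hi p hp hip
    refine ⟨rankOf k (3 * n) e + 1, by omega, Nat.succ_lt_succ (rankOf_lt k he), ?_, ?_⟩
    · exact ((d6 e he).2.trans (by rw [hcc])).trans q1
    · rw [hDX i hi]
      exact ((d6 e he).1.trans (by rw [hk])).trans q2
  · intro i hi hcov
    change D.Cov n i at hcov
    have h1 := abs_le.mp hcov.abs_Y_le
    have h2 := (a4 i hi).2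
    have h3 := le_abs_self (y i)
    rw [hDYn, hDY i hi] at h1
    linarith [h1.2]
  · intro i hi
    have hi' : i < n := hi
    rw [hK0, hkey i hi]
    nlinarith [hkb (3 * i) (by omega)]
  · intro a ha
    rw [d2 a (by omega), c2 a (by omega), hnm₃]
  · intro a ha
    rw [d3 a ha, c3 a (by omega), hnm₃]

end GeomMDS

namespace GeomMDS

/-! ### Implementing the dynamic program -/

/-- Sets register `25` to `1` if one of the items in the registers `30, …, 30 + k - 1` covers the
point in the real registers `3` and `4`. -/
def covProg : ℕ → Program
  | 0 => .skip
  | k + 1 => .seq (covProg k) (.seq (block [.natAdd 12 6 (30 + k), .natLoad 12 12, .natAdd 12 12 12,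
      .realLoad 6 12, .natAdd 12 12 1, .realLoad 7 12, .realSub 6 6 3, .realMul 6 6 6,
      .realSub 7 7 4, .realMul 7 7 7, .realAdd 6 6 7])
      (.ifThenElse (.realLe 6 2) (block [.natConst 25 1]) .skip))

theorem natWrites_covProg {k r : ℕ} (h : r ∈ (covProg k).natWrites) : r = 12 ∨ r = 25 := by
  induction k with
  | zero => simp [covProg, Program.natWrites] at h
  | succ k ih =>
    simp only [covProg, Program.natWrites, block, Instr.natWrites, List.mem_append] at h
    rcases h with h | h
    · exact ih h
    · simp at h
      omega

theorem realWrites_covProg {k r : ℕ} (h : r ∈ (covProg k).realWrites) : r = 6 ∨ r = 7 := by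
  induction k with
  | zero => simp [covProg, Program.realWrites] at h
  | succ k ih =>
    simp only [covProg, Program.realWrites, block, Instr.realWrites, List.mem_append] at h
    rcases h with h | h
    · exact ih h
    · simp at h
      omega

theorem storesNat_covProg (k : ℕ) : (covProg k).storesNat = false := by
  induction k with
  | zero => rfl
  | succ k ih => simp [covProg, Program.storesNat, ih, block, Instr.storesNat]

theorem storesReal_covProg (k : ℕ) : (covProg k).storesReal = false := by
  induction k with
  | zero => rfl
  | succ k ih => simp [covProg, Program.storesReal, ih, block, Instr.storesReal]

theorem covProg_spec {D : StripData} {Z : ℝ} {s : State} (hL : Loaded D Z s)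
    (hC : ∀ r < D.B, D.C r ≤ D.n) {g : ℕ → ℕ} (hg : ∀ j < 10, s.natReg (30 + j) = g j ∧ g j < D.B)
    {i : ℕ} (hx : s.realReg 3 = D.X i) (hy : s.realReg 4 = D.Y i) (h25 : s.natReg 25 = 0)
    {k : ℕ} (hk : k ≤ 10) :
    Halts (covProg k) s (15 * k + 1) fun s' =>
      (s'.natReg 25 = 0 ↔ ∀ j < k, ¬ D.Cov (D.C (g j)) i) := by
  induction k with
  | zero => exact Halts.skip (by simp [h25])
  | succ k ih =>
    refine Halts.mono (T := (15 * k + 1) + 15) (Halts.seq (ih (by omega)) fun s₁ hf₁ h₁ => ?_)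
      (by omega) fun _ _ h => h
    have n6 : s₁.natReg 6 = 6 * D.n + 2 := by
      rw [hf₁.nat 6 (fun h => by have := natWrites_covProg h; omega), hL.consts.r6]
    have n1 : s₁.natReg 1 = 1 := by
      rw [hf₁.nat 1 (fun h => by have := natWrites_covProg h; omega), hL.consts.r1]
    have nk : s₁.natReg (30 + k) = g k := by
      rw [hf₁.nat _ (fun h => by have := natWrites_covProg h; omega), (hg k (by omega)).1]
    have x2 : s₁.realReg 2 = 1 := by
      rw [hf₁.real 2 (fun h => by have := realWrites_covProg h; omega), hL.consts.z2]
    have x3 : s₁.realReg 3 = D.X i := by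
      rw [hf₁.real 3 (fun h => by have := realWrites_covProg h; omega), hx]
    have x4 : s₁.realReg 4 = D.Y i := by
      rw [hf₁.real 4 (fun h => by have := realWrites_covProg h; omega), hy]
    have rm : s₁.realMem = s.realMem := hf₁.realMem (storesReal_covProg k)
    have nm : s₁.natMem = s.natMem := hf₁.natMem (storesNat_covProg k)
    have hgk := (hg k (by omega)).2
    refine Halts.seq (T := 12) (T' := 3) (Halts.block (l := [_, _, _, _, _, _, _, _, _, _, _])
      (Q := fun s' => s'.realReg 6 = (D.X (D.C (g k)) - D.X i) * (D.X (D.C (g k)) - D.X i) +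
        (D.Y (D.C (g k)) - D.Y i) * (D.Y (D.C (g k)) - D.Y i) ∧ s'.realReg 2 = 1 ∧
        s'.natReg 25 = s₁.natReg 25) ?_) fun s₂ hf₂ h₂ => ?_
    · simp [exec, Instr.apply, n6, n1, nk, x2, x3, x4, rm, nm, hL.memC _ hgk,
        hL.memX _ (hC _ hgk), hL.memY _ (hC _ hgk)]
    obtain ⟨e1, e2, e3⟩ := h₂
    refine Halts.ite (T := 2) (fun hb => Halts.block (l := [_]) ?_)
      (fun hb => (Halts.skip ?_).mono (by norm_num) fun _ _ h => h)
    all_goals simp only [Test.Holds, e1, e2, ← pow_two] at hb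
    · simp only [exec, Instr.apply, Function.update_self, one_ne_zero, false_iff]
      exact fun hcon => hcon k (by omega) hb
    · rw [e3, h₁]
      constructor
      · intro h j hj
        rcases Nat.lt_succ_iff_lt_or_eq.mp hj with h' | rfl
        · exact h j h'
        · exact hb
      · exact fun h j hj => h j (by omega)

/-- Finds the last uncovered point inside the window and tests whether there is one to its
right. -/
def windowProg : Program :=
  .seq (block [.natAdd 12 6 39, .realLoad 20 12, .realAdd 20 20 2, .realLoad 21 6, .natConst 24 1])
    (forUpto 10 0 (.seq (block [.natAdd 12 10 10, .realLoad 3 12, .natAdd 12 12 1, .realLoad 4 12,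
        .natConst 25 0])
      (.seq (covProg 10)
        (.ifThenElse (.natLt 25 1)
          (.seq (block [.natAdd 12 5 10, .natAdd 12 12 10, .natAdd 12 12 10, .realLoad 5 12])
            (.ifThenElse (.realLe 5 20)
              (.ifThenElse (.realLt 21 5) (block [.realConst 21 0, .realAdd 21 21 5]) .skip)
              (block [.natConst 24 0])))
          .skip))))

/-- The check for the dropped item `a` depends on the uncovered points only through their greatest
key not exceeding the window's threshold. Computing it once per code makes every predecessor cost
constant time, which saves a factor `n`. -/
theorem windowProg_spec {D : StripData} {Z : ℝ} {s : State} (hL : Loaded D Z s)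
    (hC : ∀ r < D.B, D.C r ≤ D.n) (hK : ∀ r < D.B, D.K 0 ≤ D.K r) {t : ℕ} (ht : t < D.B ^ 10)
    (hg : ∀ j < 10, s.natReg (30 + j) = D.dig t j) :
    Halts windowProg s (D.n * 172 + 8) fun s' =>
      (∀ a < D.B, D.Chk a t ↔ s'.realReg 21 ≤ D.K a + 1) ∧ (s'.natReg 24 = 1 ↔ D.Fin t) := by
  have h39 : s.natReg 39 = t / D.B ^ 9 := by
    rw [← StripData.dig_nine ht]
    exact hg 9 (by norm_num)
  have h39' : t / D.B ^ 9 < D.B := by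
    rw [← StripData.dig_nine ht]; exact StripData.dig_lt _ _
  have hB0 : 0 < D.B := StripData.one_le_B
  refine (Halts.seq (T := 6) (T' := D.n * 172 + 2) (Halts.block
    (l := [_, _, _, _, _]) (Q := fun s' => s'.realReg 20 = D.K (t / D.B ^ 9) + 1 ∧ s'.realReg 21 = D.K 0 ∧ s'.natReg 24 = 1) ?_)
    fun s₁ hf₁ h₁ => ?_).mono (by omega) fun _ _ h => h
  · have := hL.memK 0 hB0
    simp only [add_zero] at this
    simp [exec, Instr.apply, hL.consts.r6, hL.consts.z2, h39, hL.memK _ h39', this]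
  obtain ⟨a1, a2, a3⟩ := h₁
  have hL₁ : Loaded D Z s₁ := hL.congr (hL.consts.framed hf₁ (by unfold KeepsConsts; decide))
    (hf₁.realMem (by decide)) (by rw [hf₁.natMem (by decide)]; exact fun _ _ => rfl)
  have hg₁ : ∀ j < 10, s₁.natReg (30 + j) = D.dig t j ∧ D.dig t j < D.B := by
    intro j hj
    refine ⟨?_, StripData.dig_lt _ _⟩
    rw [hf₁.nat, hg j hj]
    simp [Program.natWrites, block, Instr.natWrites]
    omega
  refine (Halts.forUpto (c := 168) (fun k s' =>
      (∀ i < k, D.Unc t i → D.PK i ≤ D.K (t / D.B ^ 9) + 1 → D.PK i ≤ s'.realReg 21) ∧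
      (s'.realReg 21 = D.K 0 ∨ ∃ i < D.n, D.Unc t i ∧ D.PK i ≤ D.K (t / D.B ^ 9) + 1 ∧
        D.PK i = s'.realReg 21) ∧
      (s'.natReg 24 = 1 ↔ ∀ i < k, D.Unc t i → D.PK i ≤ D.K (t / D.B ^ 9) + 1))
    hL₁.consts.r0 (by decide) (by decide)
    (by decide) (by decide) (by decide) ?_ ?_).mono le_rfl ?_
  · simp [Instr.apply, a2, a3]
  · rintro k s₂ hk hik hf ⟨g1, g2, g3⟩
    have hL₂ : Loaded D Z s₂ := hL₁.congr (hL₁.consts.framed hf (by unfold KeepsConsts; decide))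
      (hf.realMem (by decide)) (by rw [hf.natMem (by decide)]; exact fun _ _ => rfl)
    have hg₂ : ∀ j < 10, s₂.natReg (30 + j) = D.dig t j := by
      intro j hj
      rw [hf.nat, (hg₁ j hj).1]
      interval_cases j <;> decide
    have e20 : s₂.realReg 20 = D.K (t / D.B ^ 9) + 1 := by rw [hf.real 20 (by decide), a1]
    refine Halts.seq (T := 6) (T' := 162) (Halts.block (l := [_, _, _, _, _]) (Q := fun s' =>
      s'.realReg 3 = D.X k ∧ s'.realReg 4 = D.Y k ∧ s'.natReg 25 = 0) ?_)
      fun s₃ hf₃ h₃ => ?_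
    · simp [exec, Instr.apply, hik, hL₂.memX k hk.le, hL₂.memY k hk.le, hL₂.consts.r1]
    obtain ⟨b1, b2, b3⟩ := h₃
    have hL₃ : Loaded D Z s₃ := hL₂.congr (hL₂.consts.framed hf₃ (by unfold KeepsConsts; decide))
      (hf₃.realMem (by decide)) (by rw [hf₃.natMem (by decide)]; exact fun _ _ => rfl)
    refine Halts.seq (T := 151) (T' := 11) (covProg_spec hL₃ hC (g := D.dig t) (fun j hj =>
      ⟨?_, StripData.dig_lt _ _⟩) b1 b2 b3 (le_refl 10)) fun s₄ hf₄ h₄ => ?_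
    · rw [hf₃.nat, hg₂ j hj]
      interval_cases j <;> decide
    have hun : s₄.natReg 25 = 0 ↔ D.Unc t k := h₄
    have hL₄ : Loaded D Z s₄ := hL₃.congr (hL₃.consts.framed hf₄ (by unfold KeepsConsts; decide))
      (hf₄.realMem (by decide)) (by rw [hf₄.natMem (by decide)]; exact fun _ _ => rfl)
    have c1 : s₄.realReg 20 = D.K (t / D.B ^ 9) + 1 := by
      rw [hf₄.real 20 (by decide), hf₃.real 20 (by decide), e20]
    have c2 : s₄.realReg 21 = s₂.realReg 21 := by
      rw [hf₄.real 21 (by decide), hf₃.real 21 (by decide)]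
    have c3 : s₄.natReg 24 = s₂.natReg 24 := by
      rw [hf₄.nat 24 (by decide), hf₃.nat 24 (by decide)]
    have c4 : s₄.natReg 10 = k := by
      rw [hf₄.nat 10 (by decide), hf₃.nat 10 (by decide), hik]
    have split : ∀ P : ℕ → Prop, (∀ i < k + 1, P i) ↔ (∀ i < k, P i) ∧ P k := by
      intro P
      constructor
      · exact fun h => ⟨fun i hi => h i (by omega), h k (by omega)⟩
      · rintro ⟨h, h'⟩ i hi
        rcases Nat.lt_succ_iff_lt_or_eq.mp hi with h1 | rfl
        · exact h i h1
        · exact h'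
    simp only [split]
    refine Halts.ite (T := 10) (fun hb => ?_)
      (fun hb => (Halts.skip ?_).mono (by norm_num) fun _ _ h => h)
    all_goals
      simp only [Test.Holds, hL₄.consts.r1, Nat.lt_one_iff, hun] at hb
    · refine Halts.seq (T := 5) (T' := 5) (Halts.block (l := [_, _, _, _]) (Q := fun s' =>
        s'.realReg 5 = D.PK k ∧ s'.realReg 20 = D.K (t / D.B ^ 9) + 1 ∧
        s'.realReg 21 = s₂.realReg 21 ∧ s'.natReg 24 = s₂.natReg 24) ?_) fun s₅ hf₅ h₅ => ?_
      · simp [exec, Instr.apply, c1, c2, c3, c4, hL₄.consts.r5, hL₄.memPK k hk]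
      obtain ⟨d1, d2, d3, d4⟩ := h₅
      refine Halts.ite (T := 4) (fun hb1 => Halts.ite (T := 3) (fun hb2 =>
        Halts.block (l := [_, _]) ?_)
        (fun hb2 => (Halts.skip ?_).mono (by norm_num) fun _ _ h => h))
        (fun hb1 => (Halts.block (l := [_]) ?_).mono (by simp) fun _ _ h => h)
      all_goals simp only [Test.Holds, d1, d2] at hb1
      all_goals try simp only [Test.Holds, d1, d3] at hb2
      · have e1 : (exec (incr 10) (exec [.realConst 21 0, .realAdd 21 21 5] s₅)).realReg 21
            = D.PK k := by simp [exec, incr, Instr.apply, d1]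
        have e2 : (exec (incr 10) (exec [.realConst 21 0, .realAdd 21 21 5] s₅)).natReg 24
            = s₂.natReg 24 := by simp [exec, incr, Instr.apply, d4]
        rw [e1, e2, g3]
        exact ⟨⟨fun i hi hu hle => (g1 i hi hu hle).trans hb2.le, fun _ _ => le_rfl⟩,
          Or.inr ⟨k, hk, hb, hb1, rfl⟩, by simp [hb1]⟩
      · have e1 : (exec (incr 10) s₅).realReg 21 = s₂.realReg 21 := by
          simp [exec, incr, Instr.apply, d3]
        have e2 : (exec (incr 10) s₅).natReg 24 = s₂.natReg 24 := by
          simp [exec, incr, Instr.apply, d4]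
        rw [e1, e2, g3]
        exact ⟨⟨g1, fun _ _ => not_lt.mp hb2⟩, g2, by simp [hb1]⟩
      · have e1 : (exec (incr 10) (exec [.natConst 24 0] s₅)).realReg 21 = s₂.realReg 21 := by
          simp [exec, incr, Instr.apply, d3]
        have e2 : (exec (incr 10) (exec [.natConst 24 0] s₅)).natReg 24 = 0 := by
          simp [exec, incr, Instr.apply]
        rw [e1, e2]
        exact ⟨⟨g1, fun _ h => absurd h hb1⟩, g2, iff_of_false zero_ne_one
          fun h => hb1 (h.2 hb)⟩
    · have e1 : (exec (incr 10) s₄).realReg 21 = s₂.realReg 21 := by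
        simp [exec, incr, Instr.apply, c2]
      have e2 : (exec (incr 10) s₄).natReg 24 = s₂.natReg 24 := by
        simp [exec, incr, Instr.apply, c3]
      rw [e1, e2, g3]
      exact ⟨⟨g1, fun h => absurd h hb⟩, g2, by simp [hb]⟩
  · rintro s' - ⟨h1, h2, h3⟩
    refine ⟨fun a ha => ⟨fun h => ?_, fun h i hi hu hle => (h1 i hi hu hle).trans h⟩, h3⟩
    rcases h2 with h2 | ⟨i, hi, hu, hle, he⟩
    -- The initial value K 0 stands for having found no such point; it passes every comparison
    -- because K 0 is the least key.
    · rw [h2]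
      linarith [hK a ha]
    · rw [← he]
      exact h i hi hu hle

/-- Finds the best predecessor. -/
def predProg : Program :=
  .seq (block [.natLoad 26 20, .natConst 12 0, .natAdd 27 7 12, .natAdd 28 21 12])
    (forUpto 11 4 (.seq (block [.natLoad 29 28, .natSub 29 29 1, .natAdd 12 6 11, .realLoad 22 12,
        .realAdd 22 22 2])
      (.seq (.ifThenElse (.natLt 26 29) (.ifThenElse (.realLe 21 22)
          (block [.natConst 12 0, .natAdd 26 29 12, .natAdd 27 28 12]) .skip) .skip)
        (block [.natAdd 28 28 8]))))

/-- A maximum search over the `B` choices of the oldest item, whose table addresses advance by 3B⁹.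
Truncated subtraction makes an unreachable predecessor offer 0, which never beats the current value.
-/
theorem predProg_spec {D : StripData} {Z : ℝ} {s : State} (hL : Loaded D Z s) {t : ℕ}
    {sc : ℕ → ℕ} (hsc : ∀ t', s.natMem (9 * D.n + 3 + 3 * t') = sc t')
    (h8 : s.natReg 8 = 3 * D.B ^ 9) (h20 : s.natReg 20 = 9 * D.n + 3 + 3 * t)
    (h21 : s.natReg 21 = 9 * D.n + 3 + 3 * (t / D.B))
    (hu : ∀ a < D.B, D.Chk a t ↔ s.realReg 21 ≤ D.K a + 1) :
    Halts predProg s (D.B * 18 + 7) fun s' => ∃ v q, s'.natReg 26 = v ∧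
      s'.natReg 27 = 9 * D.n + 3 + 3 * q ∧
      (v = sc t ∨
        (sc t < v ∧ ∃ a < D.B, D.Chk a t ∧ v + 1 = sc (D.pred a t) ∧ q = D.pred a t)) ∧
      ∀ a < D.B, D.Chk a t → sc (D.pred a t) ≤ v + 1 := by
  refine (Halts.seq (T := 5) (T' := D.B * 18 + 2) (Halts.block (l := [_, _, _, _]) (Q := fun s' =>
    s'.natReg 26 = sc t ∧ s'.natReg 27 = 9 * D.n + 3 + 3 * 0 ∧
    s'.natReg 28 = 9 * D.n + 3 + 3 * D.pred 0 t ∧ s'.natReg 8 = 3 * D.B ^ 9) ?_)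
    fun s₁ hf₁ h₁ => ?_).mono (by omega) fun _ _ h => h
  · simp [exec, Instr.apply, hL.consts.r7, h20, h21, h8, hsc, StripData.pred]
  obtain ⟨a1, a2, a3, a4⟩ := h₁
  have hL₁ : Loaded D Z s₁ := hL.congr (hL.consts.framed hf₁ (by unfold KeepsConsts; decide))
    (hf₁.realMem (by decide)) (by rw [hf₁.natMem (by decide)]; exact fun _ _ => rfl)
  refine (Halts.forUpto (c := 14) (fun k s' =>
    s'.natReg 28 = 9 * D.n + 3 + 3 * D.pred k t ∧ ∃ v q, s'.natReg 26 = v ∧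
      s'.natReg 27 = 9 * D.n + 3 + 3 * q ∧
      (v = sc t ∨
        (sc t < v ∧ ∃ a < D.B, D.Chk a t ∧ v + 1 = sc (D.pred a t) ∧ q = D.pred a t)) ∧
      ∀ a < k, D.Chk a t → sc (D.pred a t) ≤ v + 1)
    hL₁.consts.r4 (by decide) (by decide)
    (by decide) (by decide) (by decide) ?_ ?_).mono le_rfl ?_
  · exact ⟨by simp [Instr.apply, a3], sc t, 0, by simp [Instr.apply, a1],
      by simp [Instr.apply, a2], Or.inl rfl, fun a ha => by omega⟩
  · rintro k s₂ hk hik hf ⟨g1, v, q, g2, g3, g4, g5⟩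
    have hkB : k < D.B := hk
    have hL₂ : Loaded D Z s₂ := hL₁.congr (hL₁.consts.framed hf (by unfold KeepsConsts; decide))
      (hf.realMem (by decide)) (by rw [hf.natMem (by decide)]; exact fun _ _ => rfl)
    have hnm : s₂.natMem = s.natMem := by rw [hf.natMem (by decide), hf₁.natMem (by decide)]
    have e21 : s₂.realReg 21 = s.realReg 21 := by
      rw [hf.real 21 (by decide), hf₁.real 21 (by decide)]
    have e8 : s₂.natReg 8 = 3 * D.B ^ 9 := by rw [hf.nat 8 (by decide), a4]
    refine Halts.seq (T := 6) (T' := 8) (Halts.block (l := [_, _, _, _, _]) (Q := fun s' =>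
      s'.natReg 29 = sc (D.pred k t) - 1 ∧ s'.realReg 22 = D.K k + 1 ∧ s'.natReg 26 = v ∧
      s'.natReg 27 = 9 * D.n + 3 + 3 * q ∧ s'.natReg 28 = 9 * D.n + 3 + 3 * D.pred k t ∧
      s'.realReg 21 = s.realReg 21 ∧ s'.natReg 8 = 3 * D.B ^ 9) ?_)
      fun s₃ hf₃ h₃ => ?_
    · simp [exec, Instr.apply, hik, g1, g2, g3, hnm, hsc, hL₂.consts.r1, hL₂.consts.r6,
        hL₂.consts.z2, hL₂.memK k hkB, e21, e8]
    obtain ⟨b1, b2, b3, b4, b5, b6, b7⟩ := h₃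
    have split : ∀ P : ℕ → Prop, (∀ i < k, P i) → P k → ∀ i < k + 1, P i := by
      rintro P h h' i hi
      rcases Nat.lt_succ_iff_lt_or_eq.mp hi with h1 | rfl
      · exact h i h1
      · exact h'
    refine Halts.seq (T := 6) (T' := 2) (R := fun s' => ∃ v q, s'.natReg 26 = v ∧
      s'.natReg 27 = 9 * D.n + 3 + 3 * q ∧
      (v = sc t ∨
        (sc t < v ∧ ∃ a < D.B, D.Chk a t ∧ v + 1 = sc (D.pred a t) ∧ q = D.pred a t)) ∧
      ∀ a < k + 1, D.Chk a t → sc (D.pred a t) ≤ v + 1)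
      (Halts.ite (T := 5) (fun hb => Halts.ite (T := 4)
        (fun hb' => Halts.block (l := [_, _, _]) ?_)
        (fun hb' => (Halts.skip ?_).mono (by norm_num) fun _ _ h => h))
        (fun hb => (Halts.skip ?_).mono (by norm_num) fun _ _ h => h)) ?_
    · simp only [Test.Holds, b1, b2, b3, b6] at hb hb'
      rw [← hu k hkB] at hb'
      refine ⟨sc (D.pred k t) - 1, D.pred k t, by simp [exec, Instr.apply, b1],
        by simp [exec, Instr.apply, b5], Or.inr ⟨?_, k, hkB, hb', by omega, rfl⟩, ?_⟩
      · rcases g4 with g4 | ⟨g4, -⟩ <;> omega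
      · refine split _ (fun a ha h => ?_) (fun _ => by omega)
        have := g5 a ha h
        omega
    · simp only [Test.Holds, b2, b6] at hb'
      rw [← hu k hkB] at hb'
      exact ⟨v, q, b3, b4, g4, split _ g5 fun h => absurd h hb'⟩
    · simp only [Test.Holds, b1, b3] at hb
      exact ⟨v, q, b3, b4, g4, split _ g5 fun _ => by omega⟩
    · rintro s₄ hf₄ ⟨v', q', c1, c2, c3, c4⟩
      have c5 : s₄.natReg 28 = 9 * D.n + 3 + 3 * D.pred k t := by
        rw [hf₄.nat 28 (by decide), b5]
      have c6 : s₄.natReg 8 = 3 * D.B ^ 9 := by rw [hf₄.nat 8 (by decide), b7]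
      refine Halts.block (l := [_]) ⟨?_, v', q', ?_, ?_, c3, c4⟩
      · simp [exec, incr, Instr.apply, c5, c6, StripData.pred]
        ring
      · simp [exec, incr, Instr.apply, c1]
      · simp [exec, incr, Instr.apply, c2]
  · rintro s' - ⟨-, h⟩
    exact h

/-- The state of the machine before the code `t` is processed. -/
structure DPInv (D : StripData) (Z : ℝ) (t : ℕ) (s : State) : Prop where
  loaded : Loaded D Z s
  power : s.natReg 8 = 3 * D.B ^ 9
  low : ∀ a < D.n, s.natMem a = 0
  addr : s.natReg 20 = 9 * D.n + 3 + 3 * t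
  table : ∃ sc pr, D.Table t sc pr ∧ (∀ t', s.natMem (9 * D.n + 3 + 3 * t') = sc t') ∧
    (∀ t' < t, s.natMem (9 * D.n + 3 + 3 * t' + 1) = 9 * D.n + 3 + 3 * pr t') ∧
    (∀ t' < t, s.natMem (9 * D.n + 3 + 3 * t' + 2) = D.C (t' % D.B)) ∧
    (∀ t' < t, D.Fin t' → sc t' ≤ s.natReg 22) ∧
    ∃ tf, s.natReg 23 = 9 * D.n + 3 + 3 * tf ∧
      (s.natReg 22 = 0 ∨ (tf < t ∧ D.Fin tf ∧ sc tf = s.natReg 22))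

/-- Writes the table entries of the current code. -/
def recordProg : Program :=
  .seq (block [.natStore 20 26, .natAdd 12 20 1, .natStore 12 27, .natAdd 12 12 1, .natAdd 13 6 30,
      .natLoad 13 13, .natStore 12 13])
    (.seq (.ifThenElse (.natLt 22 26) (.ifThenElse (.natEq 24 1)
        (block [.natConst 12 0, .natAdd 22 26 12, .natAdd 23 20 12]) .skip) .skip)
      (block [.natAdd 20 20 9]))

/-- Processes one code. -/
def stepProg : Program := .seq windowProg (.seq predProg recordProg)

-- All table writes go to addresses from 9n + 3 on, so the items and the still blank output area
-- survive. Registers 22 and 23 keep the best score of an accepted code and its address.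
set_option maxHeartbeats 1000000 in
theorem stepProg_spec {D : StripData} {Z : ℝ} {s : State} {t : ℕ} (h : DPInv D Z t s)
    (hC : ∀ r < D.B, D.C r ≤ D.n) (hK : ∀ r < D.B, D.K 0 ≤ D.K r) (ht : t < D.B ^ 10)
    (hg : ∀ j < 10, s.natReg (30 + j) = D.dig t j)
    (h21 : s.natReg 21 = 9 * D.n + 3 + 3 * (t / D.B)) :
    Halts stepProg s (200 * D.B) fun s' => DPInv D Z (t + 1) s' := by
  obtain ⟨sc, pr, hT, m1, m2, m3, m4, tf, m5, m6⟩ := h.table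
  refine (Halts.seq (T := D.n * 172 + 8) (T' := D.B * 18 + 7 + 16)
    (windowProg_spec h.loaded hC hK ht hg) fun s₁ hf₁ h₁ => ?_).mono
      (by unfold StripData.B; omega) fun _ _ h => h
  obtain ⟨a1, a2⟩ := h₁
  have nm₁ : s₁.natMem = s.natMem := hf₁.natMem (by decide)
  have hL₁ : Loaded D Z s₁ := h.loaded.congr
    (h.loaded.consts.framed hf₁ (by unfold KeepsConsts; decide))
    (hf₁.realMem (by decide)) (by rw [nm₁]; exact fun _ _ => rfl)
  refine Halts.seq (T := D.B * 18 + 7) (T' := 16) (predProg_spec (t := t) (sc := sc) hL₁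
    (by rw [nm₁]; exact m1) (by rw [hf₁.nat 8 (by decide), h.power])
    (by rw [hf₁.nat 20 (by decide), h.addr]) (by rw [hf₁.nat 21 (by decide), h21]) a1)
    fun s₂ hf₂ h₂ => ?_
  obtain ⟨v, q, b1, b2, b3, b4⟩ := h₂
  have nm₂ : s₂.natMem = s.natMem := by rw [hf₂.natMem (by decide), nm₁]
  have hL₂ : Loaded D Z s₂ := hL₁.congr
    (hL₁.consts.framed hf₂ (by unfold KeepsConsts; decide))
    (hf₂.realMem (by decide)) (by rw [nm₂, nm₁]; exact fun _ _ => rfl)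
  have c8 : s₂.natReg 8 = 3 * D.B ^ 9 := by
    rw [hf₂.nat 8 (by decide), hf₁.nat 8 (by decide), h.power]
  have c20 : s₂.natReg 20 = 9 * D.n + 3 + 3 * t := by
    rw [hf₂.nat 20 (by decide), hf₁.nat 20 (by decide), h.addr]
  have c22 : s₂.natReg 22 = s.natReg 22 := by
    rw [hf₂.nat 22 (by decide), hf₁.nat 22 (by decide)]
  have c23 : s₂.natReg 23 = s.natReg 23 := by
    rw [hf₂.nat 23 (by decide), hf₁.nat 23 (by decide)]
  have c24 : s₂.natReg 24 = 1 ↔ D.Fin t := by rw [hf₂.nat 24 (by decide), a2]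
  have c30 : s₂.natReg 30 = t % D.B := by
    rw [hf₂.nat 30 (by decide), hf₁.nat 30 (by decide)]
    have := hg 0 (by norm_num)
    simpa [StripData.dig] using this
  have hstep := hT.step b3 b4
  have htB : t % D.B < D.B := Nat.mod_lt _ StripData.one_le_B
  refine Halts.seq (T := 8) (T' := 8) (Halts.block (l := [_, _, _, _, _, _, _]) (Q := fun s' =>
    s'.natMem = Function.update (Function.update (Function.update s.natMem (9 * D.n + 3 + 3 * t) v)
      (9 * D.n + 3 + 3 * t + 1) (9 * D.n + 3 + 3 * q)) (9 * D.n + 3 + 3 * t + 1 + 1)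
      (D.C (t % D.B)) ∧ s'.natReg 20 = 9 * D.n + 3 + 3 * t ∧ s'.natReg 26 = v) ?_)
    fun s₃ hf₃ h₃ => ?_
  · have e : s.natMem (6 * D.n + 2 + t % D.B) = D.C (t % D.B) := h.loaded.memC _ htB
    have e' : Function.update (Function.update s.natMem (9 * D.n + 3 + 3 * t) v)
        (9 * D.n + 3 + 3 * t + 1) (9 * D.n + 3 + 3 * q) (6 * D.n + 2 + t % D.B)
        = D.C (t % D.B) := by
      unfold StripData.B at htB ⊢
      rw [Function.update_of_ne (by omega), Function.update_of_ne (by omega)]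
      exact e
    simp [exec, Instr.apply, hL₂.consts.r1, hL₂.consts.r6, c20, b1, b2, c30, nm₂, e']
  obtain ⟨d1, d2, d3⟩ := h₃
  have hL₃ : Loaded D Z s₃ := by
    refine hL₂.congr (hL₂.consts.framed hf₃ (by unfold KeepsConsts; decide))
      (hf₃.realMem (by decide)) fun a ha => ?_
    rw [d1, nm₂, Function.update_of_ne (by omega), Function.update_of_ne (by omega),
      Function.update_of_ne (by omega)]
  have d22 : s₃.natReg 22 = s.natReg 22 := by rw [hf₃.nat 22 (by decide), c22]
  have d23 : s₃.natReg 23 = s.natReg 23 := by rw [hf₃.nat 23 (by decide), c23]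
  have d24 : s₃.natReg 24 = 1 ↔ D.Fin t := by rw [hf₃.nat 24 (by decide), c24]
  have d8 : s₃.natReg 8 = 3 * D.B ^ 9 := by rw [hf₃.nat 8 (by decide), c8]
  have fin_lt : ∀ t' < t, D.Fin t' → Function.update sc t v t' ≤ s.natReg 22 := by
    intro t' ht' hF
    rw [Function.update_of_ne (by omega)]
    exact m4 t' ht' hF
  have best_lt : s.natReg 22 = 0 ∨ (tf < t + 1 ∧ D.Fin tf ∧
      Function.update sc t v tf = s.natReg 22) := by
    rcases m6 with h | ⟨h1, h2, h3⟩
    · exact Or.inl h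
    · refine Or.inr ⟨by omega, h2, ?_⟩
      rw [Function.update_of_ne (by omega)]
      exact h3
  refine Halts.seq (T := 6) (T' := 2) (R := fun s' =>
      (∀ t' < t + 1, D.Fin t' → Function.update sc t v t' ≤ s'.natReg 22) ∧
      ∃ tf, s'.natReg 23 = 9 * D.n + 3 + 3 * tf ∧ (s'.natReg 22 = 0 ∨ (tf < t + 1 ∧ D.Fin tf ∧
        Function.update sc t v tf = s'.natReg 22)))
    (Halts.ite (T := 5) (fun hb => Halts.ite (T := 4)
        (fun hb' => Halts.block (l := [_, _, _]) ?_)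
        (fun hb' => (Halts.skip ?_).mono (by norm_num) fun _ _ h => h))
        (fun hb => (Halts.skip ?_).mono (by norm_num) fun _ _ h => h)) fun s₄ hf₄ h₄ => ?_
  · simp only [Test.Holds, d22, d3, hL₃.consts.r1, d24] at hb hb'
    have e1 : (exec [.natConst 12 0, .natAdd 22 26 12, .natAdd 23 20 12] s₃).natReg 22 = v := by
      simp [exec, Instr.apply, d3]
    have e2 : (exec [.natConst 12 0, .natAdd 22 26 12, .natAdd 23 20 12] s₃).natReg 23
        = 9 * D.n + 3 + 3 * t := by
      simp [exec, Instr.apply, d2]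
    rw [e1, e2]
    refine ⟨fun t' ht' hF => ?_, t, rfl, Or.inr ⟨by omega, hb', by simp⟩⟩
    rcases Nat.lt_succ_iff_lt_or_eq.mp ht' with h | rfl
    · exact (fin_lt t' h hF).trans hb.le
    · simp
  · simp only [Test.Holds, hL₃.consts.r1, d24] at hb'
    rw [d22, d23]
    refine ⟨fun t' ht' hF => ?_, tf, m5, best_lt⟩
    rcases Nat.lt_succ_iff_lt_or_eq.mp ht' with h | rfl
    · exact fin_lt t' h hF
    · exact absurd hF hb'
  · simp only [Test.Holds, d22, d3] at hb
    rw [d22, d23]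
    refine ⟨fun t' ht' hF => ?_, tf, m5, best_lt⟩
    rcases Nat.lt_succ_iff_lt_or_eq.mp ht' with h | rfl
    · exact fin_lt t' h hF
    · simpa using hb
  obtain ⟨e1, tf', e2, e3⟩ := h₄
  have nm₄ : s₄.natMem = s₃.natMem := hf₄.natMem (by decide)
  have hL₄ : Loaded D Z s₄ := hL₃.congr
    (hL₃.consts.framed hf₄ (by unfold KeepsConsts; decide))
    (hf₄.realMem (by decide)) (by rw [nm₄]; exact fun _ _ => rfl)
  have e20 : s₄.natReg 20 = 9 * D.n + 3 + 3 * t := by rw [hf₄.nat 20 (by decide), d2]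
  have e8 : s₄.natReg 8 = 3 * D.B ^ 9 := by rw [hf₄.nat 8 (by decide), d8]
  refine (Halts.block (l := [.natAdd 20 20 9]) (Q := fun s' =>
    s'.natReg 20 = 9 * D.n + 3 + 3 * (t + 1)) ?_).mono le_rfl fun s₅ hf₅ h₅ => ?_
  · simp [exec, Instr.apply, e20, hL₄.consts.r9]
    ring
  have nm₅ : s₅.natMem = s₃.natMem := by rw [hf₅.natMem (by decide), nm₄]
  have hL₅ : Loaded D Z s₅ := hL₄.congr
    (hL₄.consts.framed hf₅ (by unfold KeepsConsts; decide))
    (hf₅.realMem (by decide)) (by rw [nm₅, nm₄]; exact fun _ _ => rfl)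
  refine ⟨hL₅, by rw [hf₅.nat 8 (by decide), e8], fun a ha => ?_, h₅, _, _, hstep,
    fun t' => ?_, fun t' ht' => ?_, fun t' ht' => ?_, ?_, ?_⟩
  · rw [nm₅, d1, Function.update_of_ne (by omega), Function.update_of_ne (by omega),
      Function.update_of_ne (by omega)]
    exact h.low a ha
  · rw [nm₅, d1, Function.update_of_ne (by omega), Function.update_of_ne (by omega)]
    by_cases htt : t' = t
    · subst htt; simp
    · rw [Function.update_of_ne (by omega), Function.update_of_ne htt]
      exact m1 t'
  · rw [nm₅, d1, Function.update_of_ne (by omega)]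
    by_cases htt : t' = t
    · subst htt; simp
    · rw [Function.update_of_ne (by omega), Function.update_of_ne (by omega),
        Function.update_of_ne htt]
      exact m2 t' (by omega)
  · rw [nm₅, d1]
    by_cases htt : t' = t
    · subst htt; rw [Function.update_self]
    · rw [Function.update_of_ne (by omega), Function.update_of_ne (by omega),
        Function.update_of_ne (by omega)]
      exact m3 t' (by omega)
  · rw [hf₅.nat 22 (by decide)]
    exact e1
  · rw [hf₅.nat 22 (by decide), hf₅.nat 23 (by decide)]
    exact ⟨tf', e2, e3⟩

end GeomMDS

/-! ### Enumeration of all codes by nested loops -/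

namespace GeomMDS

theorem DPInv.congr {D : StripData} {Z : ℝ} {t : ℕ} {s s' : State} (h : DPInv D Z t s)
    (h1 : ∀ r < 30, s'.natReg r = s.natReg r) (h2 : s'.realReg = s.realReg)
    (h3 : s'.natMem = s.natMem) (h4 : s'.realMem = s.realMem) : DPInv D Z t s' := by
  refine ⟨h.loaded.congr (h.loaded.consts.congr (fun r hr _ => h1 r (by omega))
    fun r _ => by rw [h2]) h4 (by rw [h3]; exact fun _ _ => rfl), ?_, ?_, ?_, ?_⟩
  · rw [h1 8 (by norm_num), h.power]
  · rw [h3]; exact h.low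
  · rw [h1 20 (by norm_num), h.addr]
  · rw [h1 22 (by norm_num), h1 23 (by norm_num), h3]
    exact h.table

theorem DPInv.incr {D : StripData} {Z : ℝ} {t : ℕ} {s : State} (h : DPInv D Z t s) {i : ℕ}
    (hi : 30 ≤ i) : DPInv D Z t (exec (incr i) s) := by
  refine h.congr (fun r hr => ?_) rfl rfl rfl
  simp only [exec, GeomMDS.incr, Instr.apply]
  rw [Function.update_of_ne (by omega), Function.update_of_ne (by omega)]

/-- Processes all codes, whose last `k + 1` digits are enumerated by nested loops. -/
def nest : ℕ → Program
  | 0 => .seq (forUpto 30 4 stepProg) (block [.natAdd 21 21 9])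
  | k + 1 => forUpto (31 + k) 4 (nest k)

theorem natWrites_nest {k r : ℕ} (h : r ∈ (nest k).natWrites) :
    (r < 31 + k ∨ r = 99) ∧ r ≠ 4 := by
  induction k with
  | zero =>
    have : ∀ r ∈ (nest 0).natWrites, (r < 31 + 0 ∨ r = 99) ∧ r ≠ 4 := by decide
    exact this r h
  | succ k ih =>
    rw [nest, natWrites_forUpto] at h
    simp only [List.mem_cons, List.mem_append, List.not_mem_nil, or_false] at h
    rcases h with rfl | h | rfl | rfl
    · omega
    · have := ih h; omega
    · omega
    · omega

/-- The machine cannot divide natural numbers, so the digits of the code are the loop counters and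
the address belonging to t / B is advanced whenever the innermost loop ends. Here `u` is the number
formed by the digits fixed outside; there are B^(k+1) codes of cost 200 B, and each loop level adds
at most 6 to the leading constant. -/
theorem nest_spec {D : StripData} {Z : ℝ} (hC : ∀ r < D.B, D.C r ≤ D.n)
    (hK : ∀ r < D.B, D.K 0 ≤ D.K r) {k : ℕ} (hk : k < 10) {u : ℕ} (hu : u < D.B ^ (9 - k))
    {s : State} (h : DPInv D Z (u * D.B ^ (k + 1)) s)
    (h21 : s.natReg 21 = 9 * D.n + 3 + 3 * (u * D.B ^ k))
    (hg : ∀ j, k < j → j < 10 → s.natReg (30 + j) = u / D.B ^ (j - k - 1) % D.B) :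
    Halts (nest k) s ((208 + 6 * k) * D.B ^ (k + 2)) fun s' =>
      DPInv D Z ((u + 1) * D.B ^ (k + 1)) s' ∧
      s'.natReg 21 = 9 * D.n + 3 + 3 * ((u + 1) * D.B ^ k) := by
  have hB := D.one_le_B
  induction k generalizing u s with
  | zero =>
    refine (Halts.seq (T := D.B * (200 * D.B + 4) + 2) (T' := 2)
      (Halts.forUpto (c := 200 * D.B) (fun d s' => DPInv D Z (u * D.B + d) s')
      h.loaded.consts.r4 (by decide) (by decide) (by decide) (by decide) (by decide) ?_ ?_)
      fun s₁ hf₁ h₁ => ?_).mono ?_ fun _ _ h => h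
    · have := h
      rw [pow_one] at this
      refine this.congr (fun r hr => ?_) rfl rfl rfl
      simp only [Instr.apply]
      rw [Function.update_of_ne (by omega)]
    · intro d s₁ hd hid hf h₁
      have hd' : d < D.B := hd
      have ediv : (u * D.B + d) / D.B = u := by
        rw [mul_comm, Nat.mul_add_div hB, Nat.div_eq_of_lt hd', add_zero]
      refine (stepProg_spec h₁ hC hK ?_ ?_ ?_).mono le_rfl fun s₂ _ h₂ => h₂.incr le_rfl
      · have : (u + 1) * D.B ≤ D.B ^ (9 - 0) * D.B := Nat.mul_le_mul_right _ hu
        rw [← pow_succ, add_mul, one_mul] at this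
        exact lt_of_lt_of_le (by omega) this
      · rintro (_ | j) hj
        · rw [StripData.dig, pow_zero, Nat.div_one, mul_comm, Nat.mul_add_mod,
            Nat.mod_eq_of_lt hd']
          exact hid
        · rw [StripData.dig, pow_succ', ← Nat.div_div_eq_div_mul, ediv, hf.nat]
          · exact hg (j + 1) (by omega) hj
          · have hj' : j < 9 := by omega
            interval_cases j <;> decide
      · rw [ediv, hf.nat 21 (by decide), h21, pow_zero, mul_one]
    · have hf21 : s₁.natReg 21 = 9 * D.n + 3 + 3 * u := by
        rw [hf₁.nat 21 (by decide), h21, pow_zero, mul_one]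
      have h₁' : DPInv D Z ((u + 1) * D.B ^ (0 + 1)) s₁ := by
        have e : (u + 1) * D.B ^ (0 + 1) = u * D.B + (3 * D.n + 1) := by
          rw [zero_add, pow_one, add_mul, one_mul, StripData.B]
        rw [e]
        exact h₁
      refine Halts.block (l := [_]) ⟨?_, ?_⟩
      · obtain ⟨q1, q2, q3, q4, q5⟩ := h₁'
        have hfr : Framed (.instr (.natAdd 21 21 9)) s₁ _ := framed_instr (.natAdd 21 21 9) s₁
        refine ⟨q1.congr (q1.consts.framed hfr (by unfold KeepsConsts; decide)) rfl
          fun _ _ => rfl, ?_, q3, ?_, ?_⟩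
        · rw [← q2]; exact hfr.nat 8 (by decide)
        · rw [← q4]; exact hfr.nat 20 (by decide)
        · have e22 := hfr.nat 22 (by decide)
          have e23 := hfr.nat 23 (by decide)
          simp only [exec]
          rw [e22, e23]
          exact q5
      · simp [exec, Instr.apply, hf21, h.loaded.consts.r9, hf₁.nat 9 (by decide)]
        ring
    · have : D.B ≤ D.B * D.B := Nat.le_mul_self _
      have e1 : D.B * (200 * D.B + 4) = 200 * (D.B * D.B) + 4 * D.B := by ring
      have e2 : (208 + 6 * 0) * D.B ^ (0 + 2) = 208 * (D.B * D.B) := by ring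
      rw [e1, e2]
      omega
  | succ k ih =>
    have hw : ∀ r, 31 + k < r → r < 99 → r ∉ (nest (k + 1)).natWrites := by
      intro r hr hr' hmem
      rw [nest, natWrites_forUpto] at hmem
      simp only [List.mem_cons, List.mem_append, List.not_mem_nil, or_false] at hmem
      rcases hmem with rfl | hmem | rfl | rfl
      · omega
      · have := natWrites_nest hmem; omega
      · omega
      · omega
    refine (Halts.forUpto (c := (208 + 6 * k) * D.B ^ (k + 2)) (fun d s' =>
      DPInv D Z ((u * D.B + d) * D.B ^ (k + 1)) s' ∧
      s'.natReg 21 = 9 * D.n + 3 + 3 * ((u * D.B + d) * D.B ^ k))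
      h.loaded.consts.r4 (by omega) (by omega) (by decide) (fun h => ?_) (fun h => ?_)
      ?_ ?_).mono ?_ ?_
    · have := natWrites_nest h; omega
    · exact (natWrites_nest h).2 rfl
    · have e : ∀ r < 30, ((Instr.natConst (31 + k) 0).apply s).natReg r = s.natReg r := by
        intro r hr
        simp only [Instr.apply]
        rw [Function.update_of_ne (by omega)]
      constructor
      · have := h
        rw [pow_succ' _ (k + 1), ← mul_assoc] at this
        exact this.congr e rfl rfl rfl
      · rw [e 21 (by norm_num), h21, pow_succ' _ k, ← mul_assoc u, add_zero]
    · rintro d s₁ hd hid hf ⟨h₁, h₂⟩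
      have hd' : d < D.B := hd
      have ediv : (u * D.B + d) / D.B = u := by
        rw [mul_comm, Nat.mul_add_div hB, Nat.div_eq_of_lt hd', add_zero]
      refine (ih (by omega) (u := u * D.B + d) ?_ h₁ h₂ ?_).mono le_rfl
        fun s₂ _ h₃ => ⟨h₃.1.incr (by omega), ?_⟩
      · have : (u + 1) * D.B ≤ D.B ^ (9 - (k + 1)) * D.B := Nat.mul_le_mul_right _ hu
        rw [← pow_succ, add_mul, one_mul, show 9 - (k + 1) + 1 = 9 - k by omega] at this
        exact lt_of_lt_of_le (by omega) this
      · intro j hkj hj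
        rcases (show k + 1 ≤ j from hkj).eq_or_lt with rfl | hlt
        · rw [show k + 1 - k - 1 = 0 by omega, pow_zero, Nat.div_one, mul_comm,
            Nat.mul_add_mod, Nat.mod_eq_of_lt hd', ← hid]
          congr 1
          omega
        · rw [hf.nat _ (hw _ (by omega) (by omega)), hg j hlt hj,
            show j - k - 1 = j - (k + 1) - 1 + 1 by omega, pow_succ' _ (j - (k + 1) - 1),
            ← Nat.div_div_eq_div_mul, ediv]
      · have := h₃.2
        simp only [exec, GeomMDS.incr, Instr.apply]
        rw [Function.update_of_ne (by omega), Function.update_of_ne (by omega)]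
        exact this
    · have h1 : 4 * D.B + 2 ≤ 6 * D.B ^ (k + 3) := by
        have : D.B ^ 1 ≤ D.B ^ (k + 3) := Nat.pow_le_pow_right hB (by omega)
        rw [pow_one] at this
        omega
      have e1 : (3 * D.n + 1) * ((208 + 6 * k) * D.B ^ (k + 2) + 4) + 2
          = (208 + 6 * k) * D.B ^ (k + 3) + (4 * D.B + 2) := by
        unfold StripData.B
        ring
      have e2 : (208 + 6 * (k + 1)) * D.B ^ (k + 1 + 2)
          = (208 + 6 * k) * D.B ^ (k + 3) + 6 * D.B ^ (k + 3) := by ring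
      rw [e1, e2]
      omega
    · rintro s' - ⟨h1, h2⟩
      have e : u * D.B + (3 * D.n + 1) = (u + 1) * D.B := by
        rw [add_mul, one_mul, StripData.B]
      rw [e] at h1 h2
      rw [pow_succ' _ (k + 1), ← mul_assoc]
      refine ⟨h1, ?_⟩
      rw [pow_succ' _ k, ← mul_assoc (u + 1)]
      exact h2

/-- Computes three times the `k`-th power of the radix. -/
def powProg : ℕ → Program
  | 0 => block [.natConst 8 3]
  | k + 1 => .seq (powProg k) (.seq (block [.natConst 12 0])
      (.seq (forUpto 10 4 (block [.natAdd 12 12 8])) (block [.natConst 15 0, .natAdd 8 12 15])))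

theorem natWrites_powProg {k r : ℕ} (h : r ∈ (powProg k).natWrites) :
    r = 8 ∨ r = 10 ∨ r = 12 ∨ r = 15 ∨ r = 99 := by
  induction k with
  | zero =>
    have : ∀ r ∈ (powProg 0).natWrites, r = 8 ∨ r = 10 ∨ r = 12 ∨ r = 15 ∨ r = 99 := by decide
    exact this r h
  | succ k ih =>
    rcases List.mem_append.mp h with h | h
    · exact ih h
    · have : ∀ r ∈ (Program.seq (block [.natConst 12 0]) (.seq
          (forUpto 10 4 (block [.natAdd 12 12 8]))
          (block [.natConst 15 0, .natAdd 8 12 15]))).natWrites,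
          r = 8 ∨ r = 10 ∨ r = 12 ∨ r = 15 ∨ r = 99 := by decide
      exact this r h

/-- Natural numbers cannot be multiplied by one instruction, so each power comes from the previous
one by `B` additions. -/
theorem powProg_spec {B : ℕ} {s : State} (h4 : s.natReg 4 = B) (k : ℕ) :
    Halts (powProg k) s (k * (B * 6 + 7) + 2) fun s' => s'.natReg 8 = 3 * B ^ k := by
  induction k with
  | zero =>
    exact (Halts.block (l := [_]) (by simp [exec, Instr.apply])).mono (by simp) fun _ _ h => h
  | succ k ih =>
    refine (Halts.seq (T' := B * 6 + 7) ih fun s₁ hf₁ h₁ => ?_).mono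
      (by rw [add_mul]; omega) fun _ _ h => h
    have e4 : s₁.natReg 4 = B := by
      rw [hf₁.nat 4 fun h => by have := natWrites_powProg h; omega, h4]
    refine (Halts.seq (T := 2) (T' := B * 6 + 5) (Halts.block (l := [_]) (Q := fun s' =>
      s'.natReg 12 = 0 ∧ s'.natReg 8 = 3 * B ^ k ∧ s'.natReg 4 = B) ?_)
      fun s₂ hf₂ h₂ => ?_).mono (by omega) fun _ _ h => h
    · simp [exec, Instr.apply, h₁, e4]
    obtain ⟨a1, a2, a3⟩ := h₂
    refine Halts.seq (T := B * 6 + 2) (T' := 3) (Halts.forUpto (c := 2) (fun d s' =>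
      s'.natReg 12 = d * (3 * B ^ k)) a3 (by decide) (by decide)
      (by decide) (by decide) (by decide) ?_ ?_) fun s₃ _ h₃ => ?_
    · simp [Instr.apply, a1]
    · intro d s₃ _ _ hf h₃
      refine Halts.block (l := [_]) ?_
      simp [exec, incr, Instr.apply, h₃, hf.nat 8 (by decide), a2]
      ring
    · refine Halts.block (l := [_, _]) ?_
      simp [exec, Instr.apply, h₃]
      ring

/-- The dynamic program as a whole. -/
def dpProg : Program :=
  .seq (powProg 9) (.seq (block [.natConst 12 0, .natAdd 20 7 12, .natStore 20 4, .natAdd 21 7 12,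
    .natConst 22 0, .natAdd 23 7 12]) (nest 9))

theorem storesNat_powProg (k : ℕ) : (powProg k).storesNat = false := by
  induction k with
  | zero => rfl
  | succ k ih =>
    simp [powProg, Program.storesNat, ih, block, Instr.storesNat, storesNat_forUpto]

theorem storesReal_powProg (k : ℕ) : (powProg k).storesReal = false := by
  induction k with
  | zero => rfl
  | succ k ih =>
    simp [powProg, Program.storesReal, ih, block, Instr.storesReal, storesReal_forUpto]

theorem realWrites_powProg (k : ℕ) : (powProg k).realWrites = [] := by
  induction k with
  | zero => rfl
  | succ k ih =>
    simp [powProg, Program.realWrites, ih, block, Instr.realWrites, realWrites_forUpto]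

theorem dpProg_spec {D : StripData} {Z : ℝ} {s : State} (h : Loaded D Z s)
    (hC : ∀ r < D.B, D.C r ≤ D.n) (hK : ∀ r < D.B, D.K 0 ≤ D.K r)
    (hlow : ∀ a < D.n, s.natMem a = 0) (hhigh : ∀ a, 9 * D.n + 3 ≤ a → s.natMem a = 0) :
    Halts dpProg s (400 * D.B ^ 11) fun s' => DPInv D Z (D.B ^ 10) s' := by
  have hB := D.one_le_B
  refine (Halts.seq (T := 9 * (D.B * 6 + 7) + 2) (T' := 7 + 262 * D.B ^ 11)
    (powProg_spec h.consts.r4 9) fun s₁ hf₁ h₁ => ?_).mono ?_ fun _ _ h => h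
  · have nm₁ : s₁.natMem = s.natMem := hf₁.natMem (storesNat_powProg 9)
    have hL₁ : Loaded D Z s₁ := h.congr (h.consts.framed hf₁ (by
        refine ⟨fun r hr h8 hmem => ?_, fun r _ => by simp [realWrites_powProg]⟩
        have := natWrites_powProg hmem
        omega)) (hf₁.realMem (storesReal_powProg 9)) (by rw [nm₁]; exact fun _ _ => rfl)
    refine Halts.seq (T := 7) (T' := 262 * D.B ^ 11) (Halts.block (l := [_, _, _, _, _, _])
      (Q := fun s' => s'.natReg 20 = 9 * D.n + 3 ∧ s'.natReg 21 = 9 * D.n + 3 ∧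
        s'.natReg 22 = 0 ∧ s'.natReg 23 = 9 * D.n + 3 ∧
        s'.natMem = Function.update s.natMem (9 * D.n + 3) D.B) ?_) fun s₂ hf₂ h₂ => ?_
    · simp [exec, Instr.apply, hL₁.consts.r7, hL₁.consts.r4, nm₁, StripData.B]
    obtain ⟨a1, a2, a3, a4, a5⟩ := h₂
    have hL₂ : Loaded D Z s₂ := hL₁.congr (hL₁.consts.framed hf₂ (by unfold KeepsConsts; decide))
      (hf₂.realMem (by decide)) fun a ha => by
        rw [a5, nm₁, Function.update_of_ne (by omega)]
    have hI : DPInv D Z (0 * D.B ^ (9 + 1)) s₂ := by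
      rw [zero_mul]
      refine ⟨hL₂, ?_, fun a ha => ?_, a1, _, _, StripData.Table.init, fun t' => ?_,
        fun t' h => by omega, fun t' h => by omega, fun t' h => by omega, 0, a4, Or.inl a3⟩
      · rw [hf₂.nat 8 (by decide)]; exact h₁
      · rw [a5, Function.update_of_ne (by omega)]; exact hlow a ha
      · rw [a5]
        split_ifs with ht
        · subst ht; simp
        · rw [Function.update_of_ne (by omega)]
          exact hhigh _ (by omega)
    refine (nest_spec hC hK (by norm_num : 9 < 10) (u := 0) (by positivity) hI (by simpa using a2)
      (fun j h1 h2 => by omega)).mono (by norm_num) fun s₃ _ h₃ => ?_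
    simpa using h₃.1
  · have : D.B ^ 1 ≤ D.B ^ 11 := Nat.pow_le_pow_right hB (by norm_num)
    rw [pow_one] at this
    generalize D.B ^ 11 = w at this ⊢
    omega

/-! ### Reading off the solution -/

/-- Marks the centres of the best sequence of items. -/
def traceProg : Program :=
  .whileDo (.natLt 7 23) (block [.natConst 12 2, .natAdd 12 23 12, .natLoad 13 12, .natStore 13 1,
    .natAdd 12 23 1, .natLoad 23 12])

/-- The score rises by 1 along every pointer, so code 0 is reached after `k` rounds. Marks are put
at addresses up to `n`, below the table, so the entries still to be read are intact. -/
theorem traceProg_spec {D : StripData} {t₀ : ℕ} {sc pr : ℕ → ℕ} (hT : D.Table t₀ sc pr)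
    (hC : ∀ r < D.B, D.C r ≤ D.n) {k t : ℕ} (ht : t < t₀) (hpos : 0 < sc t) (hk : sc t + k = D.B)
    {s : State} (h1 : s.natReg 1 = 1) (h7 : s.natReg 7 = 9 * D.n + 3)
    (h23 : s.natReg 23 = 9 * D.n + 3 + 3 * t)
    (hpr : ∀ t' < t₀, s.natMem (9 * D.n + 3 + 3 * t' + 1) = 9 * D.n + 3 + 3 * pr t')
    (hc : ∀ t' < t₀, s.natMem (9 * D.n + 3 + 3 * t' + 2) = D.C (t' % D.B)) :
    Halts traceProg s (8 * k + 1) fun s' =>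
      ∀ i, i < D.n → (s'.natMem i ≠ 0 ↔ s.natMem i ≠ 0 ∨ i ∈ D.trace pr k t) := by
  induction k generalizing t s with
  | zero =>
    have : t = 0 := by
      by_contra h0
      obtain ⟨a, ha, -, -, h3⟩ := hT.back t ht h0 hpos
      have := hT.le (pr t)
      omega
    subst this
    exact ⟨1, s, .whileFalse (by simp [Test.Holds, h7, h23]), by omega,
      fun i _ => by simp [StripData.trace]⟩
  | succ k ih =>
    have h0 : t ≠ 0 := by
      rintro rfl
      have := hT.zero
      omega
    obtain ⟨a, ha, -, -, h3⟩ := hT.back t ht h0 hpos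
    have hpt : pr t < t₀ := by
      by_contra hcon
      have hp0 : pr t ≠ 0 := by
        intro h; rw [h] at hcon; omega
      have := hT.undone (pr t) (by omega) hp0
      omega
    have hle : D.C (t % D.B) ≤ D.n := hC _ (Nat.mod_lt _ D.one_le_B)
    obtain ⟨τ, s₁, hr, hτ, e1, e2, e3, e4⟩ := Halts.block (s := s)
      (l := [.natConst 12 2, .natAdd 12 23 12, .natLoad 13 12, .natStore 13 1,
        .natAdd 12 23 1, .natLoad 23 12]) (Q := fun s' => s'.natReg 1 = 1 ∧
        s'.natReg 7 = 9 * D.n + 3 ∧ s'.natReg 23 = 9 * D.n + 3 + 3 * pr t ∧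
        s'.natMem = Function.update s.natMem (D.C (t % D.B)) 1) (by
          have e := hpr t ht
          have e' := hc t ht
          have e'' : Function.update s.natMem (D.C (t % D.B)) 1 (9 * D.n + 3 + 3 * t + 1)
              = 9 * D.n + 3 + 3 * pr t := by
            rw [Function.update_of_ne (by omega), e]
          simp [exec, Instr.apply, h1, h7, h23, e', e''])
    obtain ⟨τ', s₂, hr', hτ', hq⟩ := ih hpt (by omega) (by omega) e1 e2 e3
      (fun t' ht' => by rw [e4, Function.update_of_ne (by omega), hpr t' ht'])
      (fun t' ht' => by rw [e4, Function.update_of_ne (by omega), hc t' ht'])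
    refine ⟨1 + τ + τ', s₂, .whileTrue (by simp only [Test.Holds, h7, h23]; omega) hr hr', ?_,
      fun i hi => ?_⟩
    · simp only [List.length_cons, List.length_nil] at hτ
      omega
    · rw [hq i hi, e4, StripData.trace, Finset.mem_insert]
      by_cases hic : i = D.C (t % D.B)
      · subst hic; simp
      · rw [Function.update_of_ne hic]
        tauto

end GeomMDS

namespace GeomMDS

/-! ### The algorithm -/

/-- The approximation algorithm. -/
def mdsProg : Program := .seq prepProg (.seq dpProg traceProg)

theorem mdsProg_spec {n : ℕ} {x y : ℕ → ℝ} {s : State} (hn : s.natReg 0 = n)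
    (hx : ∀ i < n, s.realMem (i + i) = x i) (hy : ∀ i < n, s.realMem (i + i + 1) = y i)
    (h0 : s.realMem (n + n) = 0) (hnat : s.natMem = fun _ => 0) :
    Halts mdsProg s (1000 * (3 * n + 1) ^ 11) fun s' => ∃ E : Finset ℕ,
      (∀ i < n, s'.natMem i ≠ 0 ↔ i ∈ E) ∧
      (∀ i < n, ∃ c ∈ E, c < n ∧ (x c - x i) ^ 2 + (y c - y i) ^ 2 ≤ 1) ∧
      ∀ O : Finset ℕ, (∀ o ∈ O, o < n) →
        (∀ i < n, ∃ o ∈ O, (x o - x i) ^ 2 + (y o - y i) ^ 2 ≤ 1) → E.card ≤ 3 * O.card := by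
  refine (Halts.seq (T' := 400 * (3 * n + 1) ^ 11 + (8 * (3 * n + 1) + 1))
    (prepProg_spec hn hx hy h0 hnat) fun s₁ _ h₁ => ?_).mono ?_ fun _ _ h => h
  · obtain ⟨D, Z, rfl, hxy, hL, ⟨⟨b, hV⟩, hc0, hnc, hlt⟩, hlow, hhigh⟩ := h₁
    have hB := D.one_le_B
    have hC : ∀ r < D.B, D.C r ≤ D.n := by
      intro r hr
      rcases Nat.eq_zero_or_pos r with rfl | hr0
      · exact hc0.le
      · exact (hV.centre r hr0 hr).le
    have hCov : ∀ c < D.n, ∀ i < D.n,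
        (D.Cov c i ↔ (x c - x i) ^ 2 + (y c - y i) ^ 2 ≤ 1) := by
      intro c hc i hi
      rw [StripData.Cov, (hxy c hc).1, (hxy c hc).2, (hxy i hi).1, (hxy i hi).2]
    refine Halts.seq (dpProg_spec hL hC (fun r hr => hV.mono' 0 r (Nat.zero_le r) hr) hlow hhigh)
      fun s₂ _ h₂ => ?_
    obtain ⟨sc, pr, hT, -, m2, m3, m4, tf, m5, m6⟩ := h₂.table
    -- Any dominating set yields a chain of length at most 3|O| and below `B`, whose last window is
    -- an accepted code; the recorded score is at least its score, hence positive.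
    have hbest : ∀ O : Finset ℕ, (∀ o ∈ O, o < D.n) →
        (∀ i < D.n, ∃ o ∈ O, (x o - x i) ^ 2 + (y o - y i) ^ 2 ≤ 1) →
        D.B ≤ s₂.natReg 22 + 3 * O.card ∧ 0 < s₂.natReg 22 := by
      intro O hO hcov
      obtain ⟨m, c, hch, hm, hmB⟩ := hV.exists_chain O hO fun i hi => by
        obtain ⟨o, ho, h⟩ := hcov i hi
        exact ⟨o, ho, (hCov o (hO o ho) i hi).mpr h⟩
      have h1 := hch.score hV.mono' hT le_rfl
      have h2 := m4 _ (StripData.code_lt fun j hj => hch.lt _ (by omega)) (hch.fin hV.mono')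
      omega
    -- The set of all points dominates itself, so some accepted code has been recorded.
    have hpos := (hbest (Finset.range D.n) (fun o ho => Finset.mem_range.mp ho) fun i hi =>
      ⟨i, Finset.mem_range.mpr hi, by norm_num⟩).2
    obtain ⟨htf, hfin, hsc⟩ := m6.resolve_left hpos.ne'
    have hle := hT.le tf
    refine (traceProg_spec hT hC (k := D.B - sc tf) htf (by omega) (by omega) h₂.loaded.consts.r1
      h₂.loaded.consts.r7 m5 m2 m3).mono (by unfold StripData.B; omega) fun s₃ _ h₃ =>
        ⟨D.trace pr (D.B - sc tf) tf, fun i hi => ?_, fun i hi => ?_, fun O hO hcov => ?_⟩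
    · rw [h₃ i hi, h₂.low i hi]
      simp
    · obtain ⟨c, hc, hcov⟩ := hT.trace_covers_of_fin hlt (by rw [hc0]; exact hnc) htf (by omega)
        (k := D.B - sc tf) (by omega) hfin i hi
      have hcn : c < D.n := by
        refine lt_of_le_of_ne (StripData.trace_le hC _ _ _ c hc) ?_
        rintro rfl
        exact hnc i hi hcov
      exact ⟨c, hc, hcn, (hCov c hcn i hi).mp hcov⟩
    · have h1 := (hbest O hO hcov).1
      have h2 := StripData.card_trace_le (D := D) pr (D.B - sc tf) tf
      omega
  · have h1 : (3 * n + 1) ^ 2 ≤ (3 * n + 1) ^ 11 := Nat.pow_le_pow_right (by omega) (by norm_num)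
    have h2 : (3 * n + 1) ^ 1 ≤ (3 * n + 1) ^ 11 := Nat.pow_le_pow_right (by omega) (by norm_num)
    rw [pow_one] at h2
    generalize (3 * n + 1) ^ 11 = w at h1 h2 ⊢
    generalize (3 * n + 1) ^ 2 = u at h1 ⊢
    omega

theorem isApproxAlgorithm_mdsProg :
    IsApproxAlgorithm 3 mdsProg fun n => 1000 * (3 * n + 1) ^ 11 := by
  classical
  intro n p hp
  have hmem : ∀ i (hi : i < n), (initState p).realMem (i + i) = p ⟨i, hi⟩ 0 ∧
      (initState p).realMem (i + i + 1) = p ⟨i, hi⟩ 1 := by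
    intro i hi
    have h1 : (i + i) / 2 = i := by omega
    have h2 : (i + i + 1) / 2 = i := by omega
    have h3 : (i + i) % 2 = 0 := by omega
    have h4 : (i + i + 1) % 2 = 1 := by omega
    simp [initState, h1, h2, h3, h4, hi]
  obtain ⟨t, s, hr, ht, E, hE, hcov, hbest⟩ := mdsProg_spec (n := n) (s := initState p)
    (x := fun i => (initState p).realMem (i + i)) (y := fun i => (initState p).realMem (i + i + 1))
    (by simp [initState]) (fun _ _ => rfl) (fun _ _ => rfl)
    (by
      have : ¬ (n + n) / 2 < n := by omega
      simp [initState, this]) rfl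
  have hdist : ∀ i j : Fin n, dist (p i) (p j) ≤ 1 ↔
      ((initState p).realMem ((j : ℕ) + j) - (initState p).realMem ((i : ℕ) + i)) ^ 2 +
      ((initState p).realMem ((j : ℕ) + j + 1) - (initState p).realMem ((i : ℕ) + i + 1)) ^ 2
        ≤ 1 := by
    intro i j
    rw [(hmem i i.2).1, (hmem i i.2).2, (hmem j j.2).1, (hmem j j.2).2, dist_comm,
      Pt.dist_le_one_iff]
  refine ⟨t, s, hr, ht, ⟨image_subset_range _ _, ?_⟩, ?_⟩
  · rintro _ ⟨i, rfl⟩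
    obtain ⟨c, hc, hcn, h⟩ := hcov i i.2
    exact ⟨p ⟨c, hcn⟩, ⟨⟨c, hcn⟩, (hE c hcn).mpr hc, rfl⟩, (hdist i ⟨c, hcn⟩).mpr h⟩
  · rintro O ⟨⟨hOS, hOcov⟩, -⟩
    set A : Finset (Fin n) := Finset.univ.filter fun i => p i ∈ O with hA
    have hOA : O = p '' (A : Set (Fin n)) := by
      ext z
      constructor
      · intro hz
        obtain ⟨i, rfl⟩ := hOS hz
        exact ⟨i, by simpa [hA] using hz, rfl⟩
      · rintro ⟨i, hi, rfl⟩
        simpa [hA] using hi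
    have hcard := hbest (A.map Fin.valEmbedding) (by simp) fun i hi => by
      obtain ⟨o, ho, h⟩ := hOcov (p ⟨i, hi⟩) (mem_range_self _)
      obtain ⟨j, rfl⟩ := hOS ho
      refine ⟨j, Finset.mem_map.mpr ⟨j, by simpa [hA] using ho, rfl⟩, ?_⟩
      exact (hdist ⟨i, hi⟩ j).mp h
    rw [Finset.card_map] at hcard
    have hout : (output p s).encard ≤ E.card := by
      rw [output, hp.encard_image, ← Fin.val_injective.encard_image,
        ← Set.encard_coe_eq_coe_finsetCard]
      refine Set.encard_le_encard ?_
      rintro _ ⟨i, hi, rfl⟩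
      exact (hE i i.2).mp hi
    rw [hOA, hp.encard_image, Set.encard_coe_eq_coe_finsetCard]
    exact hout.trans (by exact_mod_cast hcard)

/-- For n ≥ 3 one has 3n + 1 ≤ 4n and log n ≥ 1; the logarithm is only slack. -/
theorem isBigO_runningTime :
    (fun n : ℕ => ((1000 * (3 * n + 1) ^ 11 : ℕ) : ℝ)) =O[atTop]
      fun n : ℕ => (n : ℝ) ^ 11 * Real.log n := by
  refine IsBigO.of_bound (1000 * 4 ^ 11) (eventually_atTop.mpr ⟨3, fun n hn => ?_⟩)
  have h3 : (3 : ℝ) ≤ n := by exact_mod_cast hn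
  have hlog : 1 ≤ Real.log n := by
    rw [Real.le_log_iff_exp_le (by linarith)]
    linarith [Real.exp_one_lt_d9]
  have hpow : (3 * (n : ℝ) + 1) ^ 11 ≤ (4 * n) ^ 11 :=
    pow_le_pow_left₀ (by positivity) (by linarith) 11
  rw [Real.norm_of_nonneg (by positivity), Real.norm_of_nonneg (by positivity)]
  push_cast
  rw [mul_pow] at hpow
  calc 1000 * (3 * (n : ℝ) + 1) ^ 11 ≤ 1000 * (4 ^ 11 * (n : ℝ) ^ 11) := by gcongr
    _ = 1000 * 4 ^ 11 * ((n : ℝ) ^ 11 * 1) := by ring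
    _ ≤ 1000 * 4 ^ 11 * ((n : ℝ) ^ 11 * Real.log n) := by gcongr

end GeomMDS
theorem theorem2 :
    -- the super-cells tile the plane, those of equal colour are more than distance 2 apart
    -- (off their boundaries), and the outer regions of a super-cell are more than 2 apart
    (∀ v : Pt,
      (⋃ d : ℤ × ℤ, superCell v d) = Set.univ ∧
      (∀ d e : ℤ × ℤ, d ≠ e →
        Disjoint (interior (superCell v d)) (interior (superCell v e))) ∧
      (∀ d e : ℤ × ℤ, d ≠ e → colour d = colour e →
        ∀ x ∈ interior (superCell v d), ∀ y ∈ interior (superCell v e), 2 < dist x y) ∧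
      (∀ d : ℤ × ℤ, ∀ x ∈ leftRegion v d, ∀ y ∈ rightRegion v d, 2 < dist x y)) ∧
    -- solving every super-cell optimally gives a 3-approximation
    (∀ S : Set Pt, S.Finite →
      (∃ v : Pt, OffBoundary S v) ∧
      ∀ v : Pt, OffBoundary S v → ∀ N : ℤ × ℤ → Set Pt,
        (∀ d : ℤ × ℤ, IsOptimalFor S (superCell v d) (N d)) →
          IsApproxMDS 3 S (⋃ d : ℤ × ℤ, N d)) ∧
    -- there is a 3-factor approximation algorithm with running time O(n^11 log n)
    (∃ (P : Program) (T : ℕ → ℕ), IsApproxAlgorithm 3 P T ∧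
      (fun n : ℕ => (T n : ℝ)) =O[atTop] (fun n : ℕ => (n : ℝ) ^ 11 * Real.log (n : ℝ))) := by
  exact ⟨fun v => ⟨iUnion_superCell v, fun _ _ hde => disjoint_interior_superCell v hde,
      fun _ _ hde hc _ hx _ hy => two_lt_dist_of_colour_eq v hde hc hx (interior_subset hy),
      fun d _ hx _ hy => two_lt_dist_left_right v d hx hy⟩,
    fun S hS => ⟨exists_offBoundary hS, fun v hv N hN => isApproxMDS_three_of_isOptimalFor hS hv hN⟩,
    mdsProg, fun n => 1000 * (3 * n + 1) ^ 11, isApproxAlgorithm_mdsProg, isBigO_runningTime⟩
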